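/- Let $(X,d)$ be a metric space and let $\ell\ge 0$ be a real number. For a finite sequence of points of $X$ put $d(x_0,\dots,x_n)=\sum_{i=1}^n d(x_{i-1},x_i)$. **Magnitude homology.** For $k\ge 0$ let $\mathrm{MC}^\ell_k(X)$ be the free abelian group on the sequences $(x_0,\dots,x_k)\in X^{k+1}$ with $x_{i-1}\ne x_i$ for $1\le i\le k$ and $d(x_0,\dots,x_k)=\ell$. Its boundary map is $\partial=\sum_{i=1}^{k-1}(-1)^i\partial_i:\mathrm{MC}^\ell_k(X)\to\mathrm{MC}^\ell_{k-1}(X)$, where $\partial_i(x_0,\dots,x_k)=(x_0,\dots,\widehat{x_i},\dots,x_k)$ if this sequence has length $\ell$, and $\partial_i(x_0,\dots,x_k)=0$ otherwise. For $a,b\in X$ let $\mathrm{MC}^\ell_*(X;a,b)$ be the chain complex defined in the same way from the sequences with $x_0=a$ and $x_k=b$ only. Put $\mathrm{MH}^\ell_k(X)=H_k(\mathrm{MC}^\ell_*(X))$ and $\mathrm{MH}^\ell_k(X;a,b)=H_k(\mathrm{MC}^\ell_*(X;a,b))$. **Magnitude homotopy type.** Order $X\times\mathbb R$ by $(x,t)\le(x',t')$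 if and only if $d(x,x')\le t'-t$. For $a,b\in X$ let $\mathrm{Cau}^\ell(X;a,b)=\{(x,t)\mid (a,0)\le (x,t)\le (b,\ell)\}$, and let $\mathrm{Cau}^\ell(X)=\bigsqcup_{a,b\in X}\mathrm{Cau}^\ell(X;a,b)$ be the disjoint union of posets. For $P$ any of these posets, let $\Delta P$ be its order complex (its simplices are the nonempty finite chains of $P$), and let $\dot\Delta P\subseteq\Delta P$ be the subcomplex of the chains $(x_0,t_0)<\dots<(x_n,t_n)$ with $d(x_0,\dots,x_n)<\ell$. Define the spaces $$\mathcal M^\ell(X;a,b)=\frac{|\Delta\mathrm{Cau}^\ell(X;a,b)|}{|\dot\Delta\mathrm{Cau}^\ell(X;a,b)|},\qquad \mathcal M^\ell(X)=\frac{|\Delta\mathrm{Cau}^\ell(X)|}{|\dot\Delta\mathrm{Cau}^\ell(X)|},$$ where $|\cdot|$ denotes geometric realization (with the weak topology), and where $Y/\emptyset$ means $Y\sqcup\{*\}$. **Theorem.** For every metric space $X$, all $\ell\ge 0$, all integers $k\ge 0$ and all $a,b\in X$, there are isomorphisms of abelian groups $$\widetilde H_k(\mathcal M^\ell(X;a,b))\cong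 \mathrm{MH}^\ell_k(X;a,b),\qquad \widetilde H_k(\mathcal M^\ell(X))\cong \mathrm{MH}^\ell_k(X),$$ where $\widetilde H_k$ is reduced singular homology with integer coefficients. -/

import Mathlib

universe u

/-! ### Sequences of points and their lengths -/

/-- The length `d(x₀, x₁) + ⋯ + d(xₙ₋₁, xₙ)` of a finite sequence of points. -/
def seqLength {X : Type u} [MetricSpace X] {n : ℕ} (x : Fin (n + 1) → X) : ℝ :=
  ∑ i : Fin n, dist (x i.castSucc) (x i.succ)

/-- The distances between consecutive points, indexed by `ℕ` (auxiliary, for proofs only). -/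
def seqGap {X : Type u} [MetricSpace X] {n : ℕ} (x : Fin (n + 1) → X) (j : ℕ) : ℝ :=
  dist (x (Fin.ofNat (n + 1) (min j n))) (x (Fin.ofNat (n + 1) (min (j + 1) n)))

theorem seqGap_nonneg {X : Type u} [MetricSpace X] {n : ℕ} (x : Fin (n + 1) → X) (j : ℕ) :
    0 ≤ seqGap x j := dist_nonneg

theorem seqGap_fin {X : Type u} [MetricSpace X] {n : ℕ} (x : Fin (n + 1) → X) (i : Fin n) :
    seqGap x i = dist (x i.castSucc) (x i.succ) := by
  unfold seqGap
  congr 2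
  · ext; simp [Fin.ofNat]
  · ext; simp [Fin.ofNat]

theorem seqLength_eq_sum {X : Type u} [MetricSpace X] {n : ℕ} (x : Fin (n + 1) → X) :
    seqLength x = ∑ j ∈ Finset.Ico 0 n, seqGap x j := by
  rw [← Finset.range_eq_Ico, Finset.sum_range]
  exact Finset.sum_congr rfl fun i _ => (seqGap_fin x i).symm

theorem sum_Ico_telescope (D : ℕ → ℝ) {n : ℕ} :
    ∀ {m : ℕ} (f : Fin (m + 1) → Fin (n + 1)), StrictMono f →
      ∑ j ∈ Finset.Ico 0 n, D j =
        ∑ j ∈ Finset.Ico 0 (f 0 : ℕ), D j +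
          ∑ i : Fin m, ∑ j ∈ Finset.Ico (f i.castSucc : ℕ) (f i.succ : ℕ), D j +
          ∑ j ∈ Finset.Ico (f (Fin.last m) : ℕ) n, D j := by
  intro m
  induction m with
  | zero =>
    intro f _
    have := (f 0).is_lt
    simp only [Finset.univ_eq_empty, Finset.sum_empty, add_zero]
    exact (Finset.sum_Ico_consecutive D (Nat.zero_le _) (by omega)).symm
  | succ m ih =>
    intro f hf
    have h := ih (fun i => f i.castSucc) (fun i j hij => hf (by simpa using hij))
    have h1 := (f (Fin.last (m + 1))).is_lt
    have h2 : f (Fin.last m).castSucc < f (Fin.last (m + 1)) := hf (Fin.castSucc_lt_last _)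
    have h3 := Finset.sum_Ico_consecutive D (le_of_lt (Fin.lt_def.mp h2))
      (show (f (Fin.last (m + 1)) : ℕ) ≤ n by omega)
    rw [h, Fin.sum_univ_castSucc, ← h3]
    simp only [Fin.castSucc_zero, Fin.succ_last, Fin.succ_castSucc]
    ring

theorem dist_le_sum_seqGap {X : Type u} [MetricSpace X] {n : ℕ} (x : Fin (n + 1) → X)
    {p q : Fin (n + 1)} (h : p ≤ q) :
    dist (x p) (x q) ≤ ∑ j ∈ Finset.Ico (p : ℕ) (q : ℕ), seqGap x j := by
  have := dist_le_Ico_sum_dist (fun j => x (Fin.ofNat (n + 1) (min j n))) (Fin.le_def.mp h)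
  have e : ∀ p : Fin (n + 1), Fin.ofNat (n + 1) (min (p : ℕ) n) = p := by
    intro p
    have := p.is_lt
    ext
    simp only [Fin.ofNat]
    rw [min_eq_left (by omega), Nat.mod_eq_of_lt this]
  rw [e p, e q] at this
  exact this

/-- Passing to a subsequence does not increase the length (the triangle inequality). -/
theorem seqLength_comp_le {X : Type u} [MetricSpace X] {n m : ℕ} (x : Fin (n + 1) → X)
    (f : Fin (m + 1) → Fin (n + 1)) (hf : StrictMono f) :
    seqLength (x ∘ f) ≤ seqLength x := by
  rw [seqLength_eq_sum x, sum_Ico_telescope _ f hf]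
  have h1 : 0 ≤ ∑ j ∈ Finset.Ico 0 (f 0 : ℕ), seqGap x j :=
    Finset.sum_nonneg fun j _ => seqGap_nonneg x j
  have h2 : 0 ≤ ∑ j ∈ Finset.Ico (f (Fin.last m) : ℕ) n, seqGap x j :=
    Finset.sum_nonneg fun j _ => seqGap_nonneg x j
  have h3 : seqLength (x ∘ f) ≤
      ∑ i : Fin m, ∑ j ∈ Finset.Ico (f i.castSucc : ℕ) (f i.succ : ℕ), seqGap x j :=
    Finset.sum_le_sum fun i _ => dist_le_sum_seqGap x (hf (Fin.castSucc_lt_succ)).le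
  linarith

/-- If a subsequence of a sequence without consecutive repetitions has the same length, then it
has no consecutive repetitions either and it contains both end points. -/
theorem subseq_of_seqLength_eq {X : Type u} [MetricSpace X] {n m : ℕ} (x : Fin (n + 1) → X)
    (hx : ∀ i : Fin n, x i.castSucc ≠ x i.succ)
    (f : Fin (m + 1) → Fin (n + 1)) (hf : StrictMono f)
    (h : seqLength (x ∘ f) = seqLength x) :
    (∀ i : Fin m, (x ∘ f) i.castSucc ≠ (x ∘ f) i.succ) ∧ f 0 = 0 ∧
      f (Fin.last m) = Fin.last n := by
  have hpos : ∀ j < n, 0 < seqGap x j := fun j hj => by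
    rw [show j = ((⟨j, hj⟩ : Fin n) : ℕ) from rfl, seqGap_fin]
    exact dist_pos.mpr (hx _)
  have hIco : ∀ p q : ℕ, q ≤ n → p < q → 0 < ∑ j ∈ Finset.Ico p q, seqGap x j :=
    fun p q hq hpq => Finset.sum_pos
      (fun j hj => hpos j (by have := (Finset.mem_Ico.mp hj).2; omega))
      (Finset.nonempty_Ico.mpr hpq)
  rw [seqLength_eq_sum x, sum_Ico_telescope _ f hf] at h
  have h1 : 0 ≤ ∑ j ∈ Finset.Ico 0 (f 0 : ℕ), seqGap x j :=
    Finset.sum_nonneg fun j _ => seqGap_nonneg x j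
  have h2 : 0 ≤ ∑ j ∈ Finset.Ico (f (Fin.last m) : ℕ) n, seqGap x j :=
    Finset.sum_nonneg fun j _ => seqGap_nonneg x j
  have h3' : ∀ i : Fin m, dist ((x ∘ f) i.castSucc) ((x ∘ f) i.succ) ≤
      ∑ j ∈ Finset.Ico (f i.castSucc : ℕ) (f i.succ : ℕ), seqGap x j :=
    fun i => dist_le_sum_seqGap x (hf (Fin.castSucc_lt_succ)).le
  have h3 : seqLength (x ∘ f) ≤
      ∑ i : Fin m, ∑ j ∈ Finset.Ico (f i.castSucc : ℕ) (f i.succ : ℕ), seqGap x j :=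
    Finset.sum_le_sum fun i _ => h3' i
  refine ⟨fun i hi => ?_, ?_, ?_⟩
  · have : seqLength (x ∘ f) <
        ∑ i : Fin m, ∑ j ∈ Finset.Ico (f i.castSucc : ℕ) (f i.succ : ℕ), seqGap x j := by
      refine Finset.sum_lt_sum (fun i _ => h3' i) ⟨i, Finset.mem_univ _, ?_⟩
      rw [hi, dist_self]
      exact hIco _ _ (by have := (f i.succ).is_lt; omega)
        (Fin.lt_def.mp (hf (Fin.castSucc_lt_succ)))
    linarith
  · by_contra h0
    have := hIco 0 (f 0 : ℕ) (by have := (f 0).is_lt; omega)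
      (Nat.pos_of_ne_zero fun h' => h0 (Fin.ext h'))
    linarith
  · by_contra h0
    have h4 : (f (Fin.last m) : ℕ) < n := by
      have h5 := (f (Fin.last m)).is_lt
      have h6 : (f (Fin.last m) : ℕ) ≠ n := fun h' => h0 (Fin.ext (by simpa using h'))
      omega
    have := hIco _ n le_rfl h4
    linarith

/-! ### Magnitude homology -/

/-- The generators of the magnitude chain group in degree `k`: sequences `(x₀, …, xₖ)` with
`xᵢ₋₁ ≠ xᵢ`, of length `ℓ`, whose pair of end points `(x₀, xₖ)` is in `E`. -/
@[ext]
structure MagSeq {X : Type u} [MetricSpace X] (E : Set (X × X)) (ℓ : ℝ) (k : ℕ) : Type u where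
  /-- The underlying sequence of points. -/
  seq : Fin (k + 1) → X
  /-- Consecutive points are distinct. -/
  ne : ∀ i : Fin k, seq i.castSucc ≠ seq i.succ
  /-- The length is `ℓ`. -/
  length_eq : seqLength seq = ℓ
  /-- The pair of end points is in `E`. -/
  ends_mem : (seq 0, seq (Fin.last k)) ∈ E

/-- The sequence with `xᵢ` removed, if it still has length `ℓ`. Such a sequence automatically has
no consecutive repetitions and has the same end points. -/
def MagSeq.remove {X : Type u} [MetricSpace X] {E : Set (X × X)} {ℓ : ℝ} {k : ℕ}
    (x : MagSeq E ℓ (k + 1)) (i : Fin (k + 2)) (h : seqLength (x.seq ∘ i.succAbove) = ℓ) :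
    MagSeq E ℓ k where
  seq := x.seq ∘ i.succAbove
  ne := (subseq_of_seqLength_eq x.seq x.ne i.succAbove
    (Fin.strictMono_succAbove i) (h.trans x.length_eq.symm)).1
  length_eq := h
  ends_mem := by
    obtain ⟨_, h2, h3⟩ := subseq_of_seqLength_eq x.seq x.ne i.succAbove
      (Fin.strictMono_succAbove i) (h.trans x.length_eq.symm)
    simp only [Function.comp, h2, h3]
    exact x.ends_mem

open Classical in
/-- The face `∂ᵢ(x₀, …, xₖ₊₁)`: remove the point `xᵢ` if the resulting sequence still has length
`ℓ`, and `0` otherwise. -/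
noncomputable def MagSeq.face {X : Type u} [MetricSpace X] {E : Set (X × X)} {ℓ : ℝ} {k : ℕ}
    (i : Fin (k + 2)) (x : MagSeq E ℓ (k + 1)) : MagSeq E ℓ k →₀ ℤ :=
  if h : seqLength (x.seq ∘ i.succAbove) = ℓ then
    Finsupp.single (x.remove i h) 1
  else 0

/-- The linear extension of the face `∂ᵢ`. -/
noncomputable def magFace {X : Type u} [MetricSpace X] (E : Set (X × X)) (ℓ : ℝ) {k : ℕ}
    (i : Fin (k + 2)) : (MagSeq E ℓ (k + 1) →₀ ℤ) →ₗ[ℤ] (MagSeq E ℓ k →₀ ℤ) :=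
  Finsupp.linearCombination ℤ (MagSeq.face i)

/-- The boundary `∂ = ∑_{i=1}^{k} (-1)ⁱ ∂ᵢ` from degree `k + 1` to degree `k` (only interior points
are removed). -/
noncomputable def magBoundary {X : Type u} [MetricSpace X] (E : Set (X × X)) (ℓ : ℝ) (k : ℕ) :
    (MagSeq E ℓ (k + 1) →₀ ℤ) →ₗ[ℤ] (MagSeq E ℓ k →₀ ℤ) :=
  ∑ i : Fin k, (-1 : ℤ) ^ ((i : ℕ) + 1) • magFace E ℓ i.succ.castSucc

theorem magFace_zero {X : Type u} [MetricSpace X] (E : Set (X × X)) (ℓ : ℝ) {k : ℕ} :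
    magFace E ℓ (0 : Fin (k + 2)) = 0 := by
  ext1 x
  ext1
  simp only [magFace, LinearMap.comp_apply, Finsupp.lsingle_apply,
    Finsupp.linearCombination_single, one_smul, LinearMap.zero_apply]
  rw [MagSeq.face, dif_neg]
  intro h
  obtain ⟨_, h2, _⟩ := subseq_of_seqLength_eq x.seq x.ne _
    (Fin.strictMono_succAbove 0) (h.trans x.length_eq.symm)
  simp at h2

theorem magFace_last {X : Type u} [MetricSpace X] (E : Set (X × X)) (ℓ : ℝ) {k : ℕ} :
    magFace E ℓ (Fin.last (k + 1)) = 0 := by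
  ext1 x
  ext1
  simp only [magFace, LinearMap.comp_apply, Finsupp.lsingle_apply,
    Finsupp.linearCombination_single, one_smul, LinearMap.zero_apply]
  rw [MagSeq.face, dif_neg]
  intro h
  obtain ⟨_, _, h3⟩ := subseq_of_seqLength_eq x.seq x.ne _
    (Fin.strictMono_succAbove _) (h.trans x.length_eq.symm)
  rw [Fin.succAbove_last] at h3
  exact absurd h3 (Fin.castSucc_lt_last _).ne

theorem magBoundary_eq_sum {X : Type u} [MetricSpace X] (E : Set (X × X)) (ℓ : ℝ) (k : ℕ) :
    magBoundary E ℓ k = ∑ i : Fin (k + 2), (-1 : ℤ) ^ (i : ℕ) • magFace E ℓ i := by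
  rw [Fin.sum_univ_castSucc, Fin.sum_univ_succ, magFace_last, Fin.castSucc_zero, magFace_zero]
  simp [magBoundary]

theorem magFace_face {X : Type u} [MetricSpace X] (E : Set (X × X)) (ℓ : ℝ) {k : ℕ}
    (i : Fin (k + 2)) (j : Fin (k + 3)) (x : MagSeq E ℓ (k + 2)) (y : MagSeq E ℓ k →₀ ℤ)
    (h1 : ∀ z : MagSeq E ℓ k, z.seq = x.seq ∘ j.succAbove ∘ i.succAbove → y = Finsupp.single z 1)
    (h0 : seqLength (x.seq ∘ j.succAbove ∘ i.succAbove) ≠ ℓ → y = 0) :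
    magFace E ℓ i (MagSeq.face j x) = y := by
  by_cases h : seqLength (x.seq ∘ j.succAbove) = ℓ
  · rw [MagSeq.face, dif_pos h, magFace, Finsupp.linearCombination_single, one_smul]
    by_cases h' : seqLength (x.seq ∘ j.succAbove ∘ i.succAbove) = ℓ
    · rw [MagSeq.face, dif_pos (by exact h')]
      exact (h1 _ rfl).symm
    · rw [MagSeq.face, dif_neg (by exact h'), h0 h']
  · rw [MagSeq.face, dif_neg h, map_zero]
    refine (h0 fun h' => h ?_).symm
    have e1 := seqLength_comp_le (x.seq ∘ j.succAbove) i.succAbove (Fin.strictMono_succAbove i)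
    have e2 := seqLength_comp_le x.seq j.succAbove (Fin.strictMono_succAbove j)
    have e3 := x.length_eq
    rw [Function.comp_assoc, h'] at e1
    linarith

theorem magFace_comp {X : Type u} [MetricSpace X] (E : Set (X × X)) (ℓ : ℝ) {k : ℕ}
    (i j : Fin (k + 2)) (hij : i ≤ j) :
    magFace E ℓ i ∘ₗ magFace E ℓ j.succ = magFace E ℓ j ∘ₗ magFace E ℓ i.castSucc := by
  have e : j.succ.succAbove ∘ i.succAbove = i.castSucc.succAbove ∘ j.succAbove := by
    have := congrArg SimplexCategory.Hom.toOrderHom (SimplexCategory.δ_comp_δ hij)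
    funext a
    exact (DFunLike.congr_fun this a)
  ext1 x
  ext1
  simp only [LinearMap.comp_apply, Finsupp.lsingle_apply]
  have s : ∀ i : Fin (k + 3), magFace E ℓ i (Finsupp.single x 1) = MagSeq.face i x := fun i => by
    rw [magFace, Finsupp.linearCombination_single, one_smul]
  rw [s, s]
  refine magFace_face E ℓ i j.succ x _ (fun z hz => ?_) (fun h' => ?_)
  · refine magFace_face E ℓ j i.castSucc x _ (fun z' hz' => ?_) (fun g' => ?_)
    · congr 1
      exact MagSeq.ext (by rw [hz, hz', e])
    · exact absurd (by rw [← e, ← hz]; exact z.length_eq) g'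
  · refine magFace_face E ℓ j i.castSucc x _ (fun z' hz' => ?_) (fun g' => rfl)
    exact absurd (by rw [e, ← hz']; exact z'.length_eq) h'

theorem magBoundary_comp {X : Type u} [MetricSpace X] (E : Set (X × X)) (ℓ : ℝ) (k : ℕ) :
    magBoundary E ℓ k ∘ₗ magBoundary E ℓ (k + 1) = 0 := by
  rw [magBoundary_eq_sum, magBoundary_eq_sum]
  rw [show ∀ f : Fin (k + 2) → ((MagSeq E ℓ (k + 1) →₀ ℤ) →ₗ[ℤ] (MagSeq E ℓ k →₀ ℤ)),
      ∀ g : Fin (k + 3) → ((MagSeq E ℓ (k + 2) →₀ ℤ) →ₗ[ℤ] (MagSeq E ℓ (k + 1) →₀ ℤ)),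
      (∑ i, f i) ∘ₗ (∑ j, g j) = ∑ i, ∑ j, f i ∘ₗ g j from fun f g => by
        ext1 x
        ext1
        simp only [LinearMap.comp_apply, LinearMap.sum_apply, map_sum]
        exact Finset.sum_comm]
  rw [← Finset.sum_product']
  let P := Fin (k + 2) × Fin (k + 3)
  let S : Finset P := {ij : P | (ij.2 : ℕ) ≤ (ij.1 : ℕ)}
  rw [Finset.univ_product_univ, ← Finset.sum_add_sum_compl S, ← eq_neg_iff_add_eq_zero,
    ← Finset.sum_neg_distrib]
  let φ : ∀ ij : P, ij ∈ S → P := fun ij hij =>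
    (Fin.castLT ij.2 (lt_of_le_of_lt (Finset.mem_filter.mp hij).right (Fin.is_lt ij.1)), ij.1.succ)
  apply Finset.sum_bij φ
  · intro ij hij
    simp_rw [S, φ, Finset.compl_filter, Finset.mem_filter_univ, Fin.val_succ,
      Fin.val_castLT] at hij ⊢
    lia
  · rintro ⟨i, j⟩ hij ⟨i', j'⟩ hij' h
    rw [Prod.mk_inj]
    exact ⟨by simpa [φ] using! congr_arg Prod.snd h,
      by simpa [φ, Fin.castSucc_castLT] using! congr_arg Fin.castSucc (congr_arg Prod.fst h)⟩
  · rintro ⟨i', j'⟩ hij'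
    simp_rw [S, Finset.compl_filter, Finset.mem_filter_univ, not_le] at hij'
    refine ⟨(j'.pred <| ?_, Fin.castSucc i'), ?_, ?_⟩
    · rintro rfl
      simp only [Fin.val_zero, not_lt_zero] at hij'
    · simpa [S] using! Nat.le_sub_one_of_lt hij'
    · simp only [φ, Fin.castLT_castSucc, Fin.succ_pred]
  · rintro ⟨i, j⟩ hij
    have hji : (j : ℕ) ≤ (i : ℕ) := (Finset.mem_filter.mp hij).right
    have hj : (j : ℕ) < k + 2 := lt_of_le_of_lt hji i.is_lt
    have key := magFace_comp E ℓ (Fin.castLT j hj) i (Fin.le_def.mpr hji)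
    rw [Fin.castSucc_castLT] at key
    simp only [φ, LinearMap.smul_comp, LinearMap.comp_smul, smul_smul, ← neg_smul, key]
    congr 1
    simp only [Fin.val_succ, Fin.val_castLT, pow_add, pow_one]
    ring

/-- The chain complex of free abelian groups on the sequences of length `ℓ` with end points
in `E`. -/
noncomputable def magnitudeComplexOn {X : Type u} [MetricSpace X] (E : Set (X × X)) (ℓ : ℝ) :
    ChainComplex AddCommGrpCat.{u} ℕ :=
  ChainComplex.of (fun k => AddCommGrpCat.of (MagSeq E ℓ k →₀ ℤ))
    (fun k => AddCommGrpCat.ofHom (magBoundary E ℓ k).toAddMonoidHom)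
    (fun k => by
      ext1
      exact AddMonoidHom.ext fun x => DFunLike.congr_fun (magBoundary_comp E ℓ k) x)

/-- The magnitude chain complex `MC_*^ℓ(X; a, b)`. -/
noncomputable def magnitudeComplex {X : Type u} [MetricSpace X] (ℓ : ℝ) (a b : X) :
    ChainComplex AddCommGrpCat.{u} ℕ :=
  magnitudeComplexOn {(a, b)} ℓ

/-- The magnitude chain complex `MC_*^ℓ(X)`. -/
noncomputable def totalMagnitudeComplex (X : Type u) [MetricSpace X] (ℓ : ℝ) :
    ChainComplex AddCommGrpCat.{u} ℕ :=
  magnitudeComplexOn (Set.univ : Set (X × X)) ℓ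

/-- The magnitude homology `MH_k^ℓ(X; a, b)`. -/
noncomputable abbrev magnitudeHomology {X : Type u} [MetricSpace X] (k : ℕ) (ℓ : ℝ) (a b : X) :
    AddCommGrpCat.{u} :=
  (magnitudeComplex ℓ a b).homology k

/-- The magnitude homology `MH_k^ℓ(X)`. -/
noncomputable abbrev totalMagnitudeHomology (X : Type u) [MetricSpace X] (k : ℕ) (ℓ : ℝ) :
    AddCommGrpCat.{u} :=
  (totalMagnitudeComplex X ℓ).homology k

/-! ### Geometric realizations and quotients -/

/-- The points of the geometric realization of an abstract simplicial complex, in barycentric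
coordinates. -/
def GeomRealization {V : Type u} (K : PreAbstractSimplicialComplex V) : Type u :=
  {w : V →₀ ℝ // (∀ v, 0 ≤ w v) ∧ w.support ∈ K.faces ∧ (w.sum fun _ r => r) = 1}

open Classical in
/-- The inclusion of the closed geometric simplex spanned by the face `σ`. -/
noncomputable def GeomRealization.ofFace {V : Type u} (K : PreAbstractSimplicialComplex V)
    (σ : K.faces) (w : stdSimplex ℝ (σ : Finset V)) : GeomRealization K :=
  ⟨Finsupp.onFinset (σ : Finset V)
      (fun v => if h : v ∈ (σ : Finset V) then w.1 ⟨v, h⟩ else 0)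
      (fun v hv => by by_contra h; exact hv (dif_neg h)), by
    have hsum : ((Finsupp.onFinset (σ : Finset V)
        (fun v => if h : v ∈ (σ : Finset V) then w.1 ⟨v, h⟩ else 0)
        (fun v hv => by by_contra h; exact hv (dif_neg h))).sum fun _ r => r) = 1 := by
      rw [Finsupp.onFinset_sum _ (fun _ => rfl), ← Finset.sum_coe_sort (σ : Finset V)]
      simpa using w.2.2
    refine ⟨fun v => ?_, ?_, hsum⟩
    · rw [Finsupp.onFinset_apply]
      split_ifs with h
      · exact w.2.1 _
      · exact le_rfl
    · refine (K.isRelLowerSet_faces σ.2).2 Finsupp.support_onFinset_subset ?_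
      rw [Finsupp.support_nonempty_iff]
      intro h0
      rw [h0, Finsupp.sum_zero_index] at hsum
      exact zero_ne_one hsum⟩

/-- The coherent (weak) topology: a set is open iff its intersection with every closed geometric
simplex is open in that simplex. -/
noncomputable instance GeomRealization.topologicalSpace {V : Type u} (K : PreAbstractSimplicialComplex V) :
    TopologicalSpace (GeomRealization K) :=
  ⨆ σ : K.faces, TopologicalSpace.coinduced (GeomRealization.ofFace K σ) inferInstance

/-- The subset `|L|` of `|K|`, for a subcomplex `L` of `K`. -/
def GeomRealization.subcomplexSet {V : Type u} (K L : PreAbstractSimplicialComplex V) :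
    Set (GeomRealization K) :=
  {w | w.1.support ∈ L.faces}

/-- The quotient `Y / A` as a pointed space: the disjoint union of `Y` with a base point, with all
points of `A` identified with the base point. In particular `Y / ∅ = Y ⊔ {*}`. -/
def PointedQuotient (Y : Type u) (A : Set Y) : Type u :=
  Quot fun p q : Y ⊕ PUnit.{u + 1} => ∃ y ∈ A, p = Sum.inl y ∧ q = Sum.inr PUnit.unit

/-- The quotient topology. -/
instance PointedQuotient.topologicalSpace (Y : Type u) [TopologicalSpace Y] (A : Set Y) :
    TopologicalSpace (PointedQuotient Y A) :=
  inferInstanceAs (TopologicalSpace (Quot _))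

/-- The base point. -/
instance PointedQuotient.inhabited (Y : Type u) (A : Set Y) : Inhabited (PointedQuotient Y A) :=
  ⟨Quot.mk _ (Sum.inr PUnit.unit)⟩

/-- The reduced singular homology `H̃_k(Y; ℤ)` of a (nonempty) topological space `Y`, as the kernel
of the map induced by the map from `Y` to a point. -/
noncomputable def ReducedHomology (k : ℕ) (Y : Type u) [TopologicalSpace Y] :
    AddSubgroup (((AlgebraicTopology.singularHomologyFunctor AddCommGrpCat.{u} k).obj
      (AddCommGrpCat.of (ULift.{u} ℤ))).obj (TopCat.of Y)) :=
  AddMonoidHom.ker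
    (((AlgebraicTopology.singularHomologyFunctor AddCommGrpCat.{u} k).obj
      (AddCommGrpCat.of (ULift.{u} ℤ))).map
        (TopCat.ofHom (ContinuousMap.const Y PUnit.unit) :
          TopCat.of Y ⟶ TopCat.of PUnit.{u + 1})).hom

/-! ### The causal order and the magnitude homotopy type -/

/-- The product `X × ℝ`, whose elements are points of `X` with a time parameter. -/
@[ext]
structure Spacetime (X : Type u) where
  /-- The position in `X`. -/
  pt : X
  /-- The time. -/
  time : ℝ

/-- The causal order: `(x, t) ≤ (x', t')` iff `d(x, x') ≤ t' - t`. -/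
instance Spacetime.partialOrder (X : Type u) [MetricSpace X] : PartialOrder (Spacetime X) where
  le p q := dist p.pt q.pt ≤ q.time - p.time
  le_refl p := by simp
  le_trans p q r hpq hqr := by
    have := dist_triangle p.pt q.pt r.pt
    change dist p.pt q.pt ≤ q.time - p.time at hpq
    change dist q.pt r.pt ≤ r.time - q.time at hqr
    change dist p.pt r.pt ≤ r.time - p.time
    linarith
  le_antisymm p q hpq hqp := by
    change dist p.pt q.pt ≤ q.time - p.time at hpq
    change dist q.pt p.pt ≤ p.time - q.time at hqp
    have h1 : 0 ≤ dist p.pt q.pt := dist_nonneg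
    have h2 : 0 ≤ dist q.pt p.pt := dist_nonneg
    exact Spacetime.ext (dist_le_zero.mp (by linarith)) (by linarith)

/-- The causal interval between `(a, 0)` and `(b, ℓ)`, with the causal order. -/
abbrev CausalInterval {X : Type u} [MetricSpace X] (ℓ : ℝ) (a b : X) : Type u :=
  Set.Icc (⟨a, 0⟩ : Spacetime X) ⟨b, ℓ⟩

/-- The total causal poset: the disjoint union of all causal intervals (elements of different
summands are incomparable). -/
abbrev TotalCausal (X : Type u) [MetricSpace X] (ℓ : ℝ) : Type u :=
  Σ p : X × X, CausalInterval ℓ p.1 p.2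

/-- The order complex of a poset: its simplices are the nonempty finite chains. -/
def posetOrderComplex (P : Type u) [PartialOrder P] : PreAbstractSimplicialComplex P where
  faces := {σ | σ.Nonempty ∧ IsChain (· ≤ ·) (σ : Set P)}
  isRelLowerSet_faces := fun _ h =>
    ⟨h.1, fun _ ht hne => ⟨hne, h.2.mono (Finset.coe_subset.mpr ht)⟩⟩

/-- For a poset `P` whose elements have positions `π` in `X`, the simplices `{p₀ < ⋯ < pₙ}` of the
order complex such that `d(π p₀, …, π pₙ) < ℓ`. -/
def shortChains {X : Type u} [MetricSpace X] (P : Type u) [PartialOrder P] (π : P → X) (ℓ : ℝ) :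
    PreAbstractSimplicialComplex P where
  faces := {σ | ∃ (n : ℕ) (s : Fin (n + 1) → P),
    StrictMono s ∧ (σ : Set P) = Set.range s ∧ seqLength (π ∘ s) < ℓ}
  isRelLowerSet_faces := by
    classical
    rintro σ ⟨n, s, hs, hσ, hl⟩
    refine ⟨?_, fun τ hτ hne => ?_⟩
    · rw [← Finset.coe_nonempty, hσ]
      exact Set.range_nonempty s
    · let I : Finset (Fin (n + 1)) := Finset.univ.filter fun i => s i ∈ τ
      have hI : I.Nonempty := by
        obtain ⟨p, hp⟩ := hne
        have hp' : p ∈ (σ : Set P) := hτ hp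
        rw [hσ] at hp'
        obtain ⟨i, rfl⟩ := hp'
        exact ⟨i, by simp [I, hp]⟩
      obtain ⟨m, hm⟩ : ∃ m, I.card = m + 1 :=
        ⟨I.card - 1, by have := hI.card_pos; omega⟩
      refine ⟨m, s ∘ I.orderEmbOfFin hm, hs.comp (I.orderEmbOfFin hm).strictMono, ?_,
        lt_of_le_of_lt (seqLength_comp_le (π ∘ s) _ (I.orderEmbOfFin hm).strictMono) hl⟩
      rw [Set.range_comp, Finset.range_orderEmbOfFin]
      ext p
      constructor
      · intro hp
        have hp' : p ∈ (σ : Set P) := hτ hp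
        rw [hσ] at hp'
        obtain ⟨i, rfl⟩ := hp'
        exact ⟨i, by simpa [I] using hp, rfl⟩
      · rintro ⟨i, hi, rfl⟩
        simpa [I] using hi

theorem shortChains_le {X : Type u} [MetricSpace X] (P : Type u) [PartialOrder P] (π : P → X)
    (ℓ : ℝ) : shortChains P π ℓ ≤ posetOrderComplex P := by
  rintro σ h
  have h1 := ((shortChains P π ℓ).isRelLowerSet_faces h).1
  obtain ⟨n, s, hs, hσ, -⟩ := h
  refine ⟨h1, ?_⟩
  rw [hσ]
  exact hs.monotone.isChain_range

/-- The magnitude homotopy type `M^ℓ(X; a, b)`: the geometric realization of the order complex of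
the causal interval, modulo the realization of the subcomplex of chains of length less
than `ℓ`. -/
abbrev MagnitudeHomotopyType {X : Type u} [MetricSpace X] (ℓ : ℝ) (a b : X) : Type u :=
  PointedQuotient (GeomRealization (posetOrderComplex (CausalInterval ℓ a b)))
    (GeomRealization.subcomplexSet _ (shortChains (CausalInterval ℓ a b) (fun p => p.1.pt) ℓ))

/-- The total magnitude homotopy type `M^ℓ(X)`. -/
abbrev TotalMagnitudeHomotopyType (X : Type u) [MetricSpace X] (ℓ : ℝ) : Type u :=
  PointedQuotient (GeomRealization (posetOrderComplex (TotalCausal X ℓ)))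
    (GeomRealization.subcomplexSet _ (shortChains (TotalCausal X ℓ) (fun p => p.2.1.pt) ℓ))

universe v w

/-! ### Augmented semi-simplicial sets and their chains -/

/-! The magnitude complex is the relative simplicial chain complex of the pair (order complex, short
chains), and the relative homology of such a pair is the reduced homology of the quotient of its
realizations.

Combinatorial half. Along a causal chain from `(a, 0)` to `(b, ℓ)` each distance is bounded by the
elapsed time, so the length of a strict chain is at most `ℓ`. If it is not smaller than `ℓ`, all
these bounds are equalities: the chain starts at position `a`, ends at position `b`, and the time of
each event is the length travelled so far. Chains outside the short subcomplex are therefore the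
generators of the magnitude complex (`exists_seqEvent_eq`). A face of such a chain either still has
length `ℓ` or is short, so the two boundaries agree modulo short chains (`d_magMap_sub_mem`).

Topological half. Simplices are indexed by their number of vertices, with the empty simplex in
degree 0; this augmentation makes cones acyclic in every degree and removes special cases for
relative cycles in homological degree 0. Barycentric subdivision and the homotopies are values of
chains of affine tuples on universal models, and the required homotopies on models are filled by
cones (`d_modelHomotopy`). Subdivision makes singular chains small for any open cover. The order
complex is covered by the sets `starSet τ`, where the coordinates in `τ` dominate. The dominant
vertices of a small simplex lie in the support of all its points, hence form a chain of the poset,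
and coning from the least one defines an approximation `approxMap`. Acyclic carriers show that it
inverts `affineMap` up to homotopy, respecting subcomplexes (`exists_affineMap_add_eq`,
`exists_eq_d_add`). For the quotient, `deform` pushes an open neighborhood of the subcomplex into
it. Subdividing with respect to this neighborhood and the complement of the base point is an
excision argument that compares relative chains with chains of the quotient modulo the base point
(`PointedQuotient.exists_singMap_add_eq`, `PointedQuotient.exists_sub_d_mem`).

Assembly. Subtracting constant simplices at the base point turns the comparison into a genuine chain
map whose composite to a point is zero. Each comparison is stated on chains, as a surjectivity and
an injectivity assertion modulo a subcomplex, and `nonempty_ker_homologyMap_addEquiv` converts these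
into the isomorphism; no relative complexes or long exact sequences are needed. -/

theorem alternating_double_sum_eq_zero {M : Type*} [AddCommGroup M] {n : ℕ}
    (a : Fin (n + 1) → Fin (n + 2) → M)
    (h : ∀ i j : Fin (n + 1), i ≤ j → a i j.succ = a j i.castSucc) :
    ∑ i : Fin (n + 1), ∑ j : Fin (n + 2),
      ((-1 : ℤ) ^ (i : ℕ) * (-1) ^ (j : ℕ)) • a i j = 0 := by
  rw [← Finset.sum_product']
  let P := Fin (n + 1) × Fin (n + 2)
  let S : Finset P := {ij : P | (ij.2 : ℕ) ≤ (ij.1 : ℕ)}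
  rw [Finset.univ_product_univ, ← Finset.sum_add_sum_compl S, ← eq_neg_iff_add_eq_zero,
    ← Finset.sum_neg_distrib]
  -- A pair `(i, j)` with `j ≤ i` is matched with `(j, i + 1)`: the terms agree by `h` and the signs
  -- are opposite.
  let φ : ∀ ij : P, ij ∈ S → P := fun ij hij =>
    (Fin.castLT ij.2 (lt_of_le_of_lt (Finset.mem_filter.mp hij).right (Fin.is_lt ij.1)), ij.1.succ)
  apply Finset.sum_bij φ
  · intro ij hij
    simp_rw [S, φ, Finset.compl_filter, Finset.mem_filter_univ, Fin.val_succ,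
      Fin.val_castLT] at hij ⊢
    lia
  · rintro ⟨i, j⟩ hij ⟨i', j'⟩ hij' h
    rw [Prod.mk_inj]
    exact ⟨by simpa [φ] using! congr_arg Prod.snd h,
      by simpa [φ, Fin.castSucc_castLT] using! congr_arg Fin.castSucc (congr_arg Prod.fst h)⟩
  · rintro ⟨i', j'⟩ hij'
    simp_rw [S, Finset.compl_filter, Finset.mem_filter_univ, not_le] at hij'
    refine ⟨(j'.pred <| ?_, Fin.castSucc i'), ?_, ?_⟩
    · rintro rfl
      simp only [Fin.val_zero, not_lt_zero] at hij'
    · simpa [S] using! Nat.le_sub_one_of_lt hij'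
    · simp only [φ, Fin.castLT_castSucc, Fin.succ_pred]
  · rintro ⟨i, j⟩ hij
    have hji : (j : ℕ) ≤ (i : ℕ) := (Finset.mem_filter.mp hij).right
    have hj : (j : ℕ) < n + 1 := lt_of_le_of_lt hji i.is_lt
    have key := h (Fin.castLT j hj) i (Fin.le_def.mpr hji)
    rw [Fin.castSucc_castLT] at key
    simp only [φ, ← neg_smul, key]
    congr 1
    simp only [Fin.val_succ, Fin.val_castLT, pow_add, pow_one]
    ring

theorem succAbove_succAbove_comm {n : ℕ} {i j : Fin (n + 1)} (h : i ≤ j) (k : Fin n) :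
    j.succ.succAbove (i.succAbove k) = i.castSucc.succAbove (j.succAbove k) := by
  have := Fin.le_def.mp h
  ext
  simp only [Fin.succAbove, Fin.lt_def, apply_ite Fin.val, apply_ite Fin.castSucc,
    apply_ite Fin.succ, Fin.val_castSucc, Fin.val_succ]
  split_ifs <;> simp_all <;> omega

/-- An augmented semi-simplicial set, indexed by the number of vertices: `X n` is the set of
simplices with `n` vertices, and `δ i` removes the `i`-th vertex. -/
structure AugSSet where
  /-- The simplices with `n` vertices. -/
  X : ℕ → Type u
  /-- The face maps. -/
  δ : ∀ {n : ℕ}, Fin (n + 1) → X (n + 1) → X n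
  δ_δ : ∀ {n : ℕ} {i j : Fin (n + 1)}, i ≤ j → ∀ x : X (n + 2),
    δ i (δ j.succ x) = δ j (δ i.castSucc x)

namespace AugSSet

/-- The integral chains on the simplices with `n` vertices. -/
abbrev Chain (A : AugSSet.{u}) (n : ℕ) : Type u := A.X n →₀ ℤ

/-- The boundary map of the augmented chain complex. -/
noncomputable def d (A : AugSSet.{u}) (n : ℕ) : A.Chain (n + 1) →ₗ[ℤ] A.Chain n :=
  ∑ i : Fin (n + 1), (-1 : ℤ) ^ (i : ℕ) • Finsupp.lmapDomain ℤ ℤ (A.δ i)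

variable (A : AugSSet.{u}) (B : AugSSet.{v})

theorem d_apply {n : ℕ} (x : A.Chain (n + 1)) :
    A.d n x = ∑ i : Fin (n + 1), (-1 : ℤ) ^ (i : ℕ) • Finsupp.lmapDomain ℤ ℤ (A.δ i) x := by
  simp [d]

theorem d_single {n : ℕ} (x : A.X (n + 1)) (c : ℤ) :
    A.d n (Finsupp.single x c) =
      ∑ i : Fin (n + 1), (-1 : ℤ) ^ (i : ℕ) • Finsupp.single (A.δ i x) c := by
  simp [d_apply]

theorem d_d {n : ℕ} (x : A.Chain (n + 2)) : A.d n (A.d (n + 1) x) = 0 := by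
  suffices h : A.d n ∘ₗ A.d (n + 1) = 0 from DFunLike.congr_fun h x
  ext1 x
  ext1
  simp only [LinearMap.comp_apply, Finsupp.lsingle_apply, d_single, map_sum, map_smul,
    LinearMap.zero_apply, Finset.smul_sum, smul_smul]
  rw [Finset.sum_comm]
  rw [← alternating_double_sum_eq_zero
    (fun (i : Fin (n + 1)) (j : Fin (n + 2)) => Finsupp.single (A.δ i (A.δ j x)) (1 : ℤ))
    (fun i j h => by rw [A.δ_δ h])]
  exact Finset.sum_congr rfl fun i _ => Finset.sum_congr rfl fun j _ => by
    rw [mul_comm ((-1 : ℤ) ^ (i : ℕ))]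

variable {A B}

/-- A map commuting with faces induces a map commuting with boundaries. -/
theorem d_lmapDomain {n : ℕ} (f : A.X (n + 1) → B.X (n + 1)) (g : A.X n → B.X n)
    (h : ∀ i x, B.δ i (f x) = g (A.δ i x)) (x : A.Chain (n + 1)) :
    B.d n (Finsupp.lmapDomain ℤ ℤ f x) = Finsupp.lmapDomain ℤ ℤ g (A.d n x) := by
  suffices e : B.d n ∘ₗ Finsupp.lmapDomain ℤ ℤ f = Finsupp.lmapDomain ℤ ℤ g ∘ₗ A.d n from
    DFunLike.congr_fun e x
  ext1 x
  ext1
  simp [d_single, h]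

end AugSSet

/-- Subcomplexes are encoded throughout as chains supported on a set of simplices, so this reduction
to generators replaces all arguments with quotient complexes. -/
theorem map_mem_of_supported {α : Type*} {M : Type*} [AddCommGroup M] {s : Set α}
    (f : (α →₀ ℤ) →ₗ[ℤ] M) (N : Submodule ℤ M) (h : ∀ a ∈ s, f (Finsupp.single a 1) ∈ N)
    {x : α →₀ ℤ} (hx : x ∈ Finsupp.supported ℤ ℤ s) : f x ∈ N := by
  rw [Finsupp.supported_eq_span_single] at hx
  have : Submodule.span ℤ ((fun i => Finsupp.single i (1 : ℤ)) '' s) ≤ N.comap f := by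
    rw [Submodule.span_le]
    rintro _ ⟨a, ha, rfl⟩
    exact h a ha
  exact this hx

theorem map_eq_of_supported {α : Type*} {M : Type*} [AddCommGroup M] {s : Set α}
    (f g : (α →₀ ℤ) →ₗ[ℤ] M) (h : ∀ a ∈ s, f (Finsupp.single a 1) = g (Finsupp.single a 1))
    {x : α →₀ ℤ} (hx : x ∈ Finsupp.supported ℤ ℤ s) : f x = g x := by
  have := map_mem_of_supported (f - g) ⊥ (fun a ha => by simp [h a ha]) hx
  simpa [sub_eq_zero] using this

theorem map_eq_of_forall_single {α : Type*} {M : Type*} [AddCommGroup M]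
    (f g : (α →₀ ℤ) →ₗ[ℤ] M) (h : ∀ a, f (Finsupp.single a 1) = g (Finsupp.single a 1))
    (x : α →₀ ℤ) : f x = g x :=
  map_eq_of_supported f g (s := Set.univ) (fun a _ => h a) (by simp)

theorem lmapDomain_mem_supported {α β : Type*} {s : Set α} {t : Set β} (f : α → β)
    (h : ∀ a ∈ s, f a ∈ t) {x : α →₀ ℤ} (hx : x ∈ Finsupp.supported ℤ ℤ s) :
    Finsupp.lmapDomain ℤ ℤ f x ∈ Finsupp.supported ℤ ℤ t :=
  map_mem_of_supported _ _ (fun a ha => by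
    simpa using Finsupp.single_mem_supported ℤ 1 (h a ha)) hx

theorem lmapDomain_comp_apply {α β γ : Type*} (f : α → β) (g : β → γ) (x : α →₀ ℤ) :
    Finsupp.lmapDomain ℤ ℤ g (Finsupp.lmapDomain ℤ ℤ f x) =
      Finsupp.lmapDomain ℤ ℤ (g ∘ f) x := by
  simp [Finsupp.mapDomain_comp]

theorem AugSSet.d_mem_supported {A : AugSSet.{u}} {n : ℕ} {s : Set (A.X (n + 1))}
    {t : Set (A.X n)} (h : ∀ x ∈ s, ∀ i, A.δ i x ∈ t) {x : A.Chain (n + 1)}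
    (hx : x ∈ Finsupp.supported ℤ ℤ s) : A.d n x ∈ Finsupp.supported ℤ ℤ t :=
  map_mem_of_supported _ _ (fun a ha => by
    rw [A.d_single]
    exact Submodule.sum_mem _ fun i _ => Submodule.smul_mem _ _
      (Finsupp.single_mem_supported ℤ 1 (h a ha i))) hx

/-! ### Tuples and cones -/

/-- The augmented semi-simplicial set of all tuples of elements of a type. -/
abbrev tupleSSet (V : Type u) : AugSSet.{u} where
  X n := Fin n → V
  δ i x := x ∘ i.succAbove
  δ_δ h x := by
    funext k
    simp only [Function.comp, succAbove_succAbove_comm h]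

/-- The cone on a chain of tuples, with a given vertex. -/
noncomputable def tupleCone {V : Type u} (b : V) (n : ℕ) :
    (tupleSSet V).Chain n →ₗ[ℤ] (tupleSSet V).Chain (n + 1) :=
  Finsupp.lmapDomain ℤ ℤ fun x : (tupleSSet V).X n =>
    ((Fin.cons b x : Fin (n + 1) → V) : (tupleSSet V).X (n + 1))

theorem tupleCone_single {V : Type u} (b : V) (n : ℕ) (x : (tupleSSet V).X n) (c : ℤ) :
    tupleCone b n (Finsupp.single x c) =
      Finsupp.single ((Fin.cons b x : Fin (n + 1) → V) : (tupleSSet V).X (n + 1)) c := by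
  simp [tupleCone]

theorem tuple_cons_δ_zero {V : Type u} (b : V) {n : ℕ} (x : (tupleSSet V).X n) :
    (tupleSSet V).δ 0 ((Fin.cons b x : Fin (n + 1) → V) : (tupleSSet V).X (n + 1)) = x := by
  funext k
  simp

theorem tuple_cons_δ_succ {V : Type u} (b : V) {n : ℕ} (i : Fin (n + 1))
    (x : (tupleSSet V).X (n + 1)) :
    (tupleSSet V).δ i.succ ((Fin.cons b x : Fin (n + 2) → V) : (tupleSSet V).X (n + 2)) =
      ((Fin.cons b ((tupleSSet V).δ i x) : Fin (n + 1) → V) : (tupleSSet V).X (n + 1)) := by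
  funext k
  refine Fin.cases ?_ (fun k => ?_) k <;> simp

/-- The lowest degree has no correction term, since the empty tuple has no faces. -/
theorem d_tupleCone_zero {V : Type u} (b : V) (x : (tupleSSet V).Chain 0) :
    (tupleSSet V).d 0 (tupleCone b 0 x) = x := by
  refine map_eq_of_forall_single ((tupleSSet V).d 0 ∘ₗ tupleCone b 0) LinearMap.id (fun a => ?_) x
  rw [LinearMap.comp_apply, tupleCone_single, AugSSet.d_single, Fin.sum_univ_succ,
    tuple_cons_δ_zero]
  simp

/-- Removing the apex returns the tuple, and the other faces are cones on its faces with shifted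
sign. Hence a cycle of tuples bounds its own cone; this explicit filling produces the homotopies on
models. -/
theorem d_tupleCone {V : Type u} (b : V) {n : ℕ} (x : (tupleSSet V).Chain (n + 1)) :
    (tupleSSet V).d (n + 1) (tupleCone b (n + 1) x) =
      x - tupleCone b n ((tupleSSet V).d n x) := by
  refine map_eq_of_forall_single ((tupleSSet V).d (n + 1) ∘ₗ tupleCone b (n + 1))
    (LinearMap.id - tupleCone b n ∘ₗ (tupleSSet V).d n) (fun a => ?_) x
  simp only [LinearMap.comp_apply, LinearMap.sub_apply, LinearMap.id_apply]
  rw [tupleCone_single, AugSSet.d_single, Fin.sum_univ_succ, tuple_cons_δ_zero, AugSSet.d_single,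
    map_sum, sub_eq_add_neg, ← Finset.sum_neg_distrib]
  congr 1
  · simp
  · refine Finset.sum_congr rfl fun i _ => ?_
    rw [tuple_cons_δ_succ, map_smul, tupleCone_single, ← neg_smul, Fin.val_succ, pow_succ,
      mul_neg_one]

/-! ### Singular simplices and affine simplices -/

/-- The standard topological simplex with `n` vertices. -/
abbrev TopSimplex (n : ℕ) : Type := stdSimplex ℝ (Fin n)

/-- Change of variables for pushed-forward barycentric weights. With the coordinates of vertices as
`g` it says that restricting an affine simplex to a face gives the affine simplex on the remaining
vertices. -/
theorem sum_stdSimplex_map {n m : ℕ} (f : Fin n → Fin m) (t : TopSimplex n) (g : Fin m → ℝ) :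
    ∑ i, (stdSimplex.map f t) i * g i = ∑ j, t j * g (f j) := by
  classical
  simp only [stdSimplex.map_coe, FunOnFinite.linearMap_apply_apply, Finset.sum_mul]
  rw [← Finset.sum_fiberwise Finset.univ f (fun j => t j * g (f j))]
  refine Finset.sum_congr rfl fun i _ => Finset.sum_congr rfl fun j hj => ?_
  rw [(Finset.mem_filter.mp hj).2]

/-- The inclusion of a face of the standard simplex. -/
noncomputable def topFace {n : ℕ} (i : Fin (n + 1)) : C(TopSimplex n, TopSimplex (n + 1)) :=
  ⟨stdSimplex.map i.succAbove, stdSimplex.continuous_map _⟩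

theorem topFace_topFace {n : ℕ} {i j : Fin (n + 1)} (h : i ≤ j) :
    (topFace j.succ).comp (topFace i) = (topFace i.castSucc).comp (topFace j) := by
  ext1 t
  simp only [topFace, ContinuousMap.comp_apply, ContinuousMap.coe_mk, stdSimplex.map_comp_apply]
  congr 1
  funext k
  exact succAbove_succAbove_comm h k

/-- The augmented semi-simplicial set of singular simplices of a space. -/
noncomputable abbrev singSSet (Y : Type u) [TopologicalSpace Y] : AugSSet.{u} where
  X n := C(TopSimplex n, Y)
  δ i σ := σ.comp (topFace i)
  δ_δ h σ := by
    rw [ContinuousMap.comp_assoc, ContinuousMap.comp_assoc, topFace_topFace h]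

/-- The map on singular chains induced by a continuous map. -/
noncomputable def singMap {Y : Type u} {Z : Type v} [TopologicalSpace Y] [TopologicalSpace Z]
    (g : C(Y, Z)) (n : ℕ) : (singSSet Y).Chain n →ₗ[ℤ] (singSSet Z).Chain n :=
  Finsupp.lmapDomain ℤ ℤ fun σ : (singSSet Y).X n => (g.comp σ : (singSSet Z).X n)

theorem singMap_single {Y : Type u} {Z : Type v} [TopologicalSpace Y] [TopologicalSpace Z]
    (g : C(Y, Z)) {n : ℕ} (σ : (singSSet Y).X n) (c : ℤ) :
    singMap g n (Finsupp.single σ c) = Finsupp.single (g.comp σ : (singSSet Z).X n) c := by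
  simp [singMap]

theorem d_singMap {Y : Type u} {Z : Type v} [TopologicalSpace Y] [TopologicalSpace Z]
    (g : C(Y, Z)) {n : ℕ} (x : (singSSet Y).Chain (n + 1)) :
    (singSSet Z).d n (singMap g (n + 1) x) = singMap g n ((singSSet Y).d n x) :=
  AugSSet.d_lmapDomain _ _ (fun _ _ => rfl) x

/-- Spaces in which finitely many points can be combined affinely. -/
class AffinelyCombinable (E : Type u) [TopologicalSpace E] where
  /-- The affine simplex with given vertices. -/
  comb : ∀ {n : ℕ}, (Fin n → E) → C(TopSimplex n, E)
  comb_face : ∀ {n : ℕ} (v : Fin (n + 1) → E) (i : Fin (n + 1)),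
    (comb v).comp (topFace i) = comb (v ∘ i.succAbove)

open AffinelyCombinable

noncomputable instance TopSimplex.affinelyCombinable (m : ℕ) :
    AffinelyCombinable (TopSimplex m) where
  comb {n} v := ⟨fun t => ⟨fun k => ∑ i, t i * v i k, fun k => Finset.sum_nonneg fun i _ =>
      mul_nonneg (stdSimplex.zero_le t i) (stdSimplex.zero_le (v i) k), by
        rw [Finset.sum_comm]
        simp [← Finset.mul_sum]⟩, by
    refine Continuous.subtype_mk (continuous_pi fun k => continuous_finsetSum _ fun i _ => ?_) _
    exact ((continuous_apply i).comp continuous_subtype_val).mul continuous_const⟩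
  comb_face v i := by
    ext t k
    exact sum_stdSimplex_map i.succAbove t fun j => v j k

noncomputable instance unitInterval.affinelyCombinable : AffinelyCombinable unitInterval where
  comb {n} v := ⟨fun t => ⟨∑ i, t i * (v i : ℝ), Finset.sum_nonneg fun i _ =>
      mul_nonneg (stdSimplex.zero_le t i) (v i).2.1, by
        rw [← stdSimplex.sum_eq_one t]
        exact Finset.sum_le_sum fun i _ =>
          mul_le_of_le_one_right (stdSimplex.zero_le t i) (v i).2.2⟩, by
    refine Continuous.subtype_mk (continuous_finsetSum _ fun i _ => ?_) _
    exact ((continuous_apply i).comp continuous_subtype_val).mul continuous_const⟩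
  comb_face v i := by
    ext t
    exact sum_stdSimplex_map i.succAbove t fun j => (v j : ℝ)

theorem unitInterval.comb_const {n : ℕ} (a : unitInterval) (t : TopSimplex n) :
    comb (fun _ : Fin n => a) t = a := by
  apply Subtype.ext
  change ∑ i, t i * (a : ℝ) = a
  rw [← Finset.sum_mul, stdSimplex.sum_eq_one, one_mul]

noncomputable instance Prod.affinelyCombinable (E : Type u) (F : Type v) [TopologicalSpace E]
    [TopologicalSpace F] [AffinelyCombinable E] [AffinelyCombinable F] :
    AffinelyCombinable (E × F) where
  comb v := (comb fun i => (v i).1).prodMk (comb fun i => (v i).2)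
  comb_face v i := by
    ext1 t
    exact Prod.ext (DFunLike.congr_fun (comb_face (fun j => (v j).1) i) t)
      (DFunLike.congr_fun (comb_face (fun j => (v j).2) i) t)

theorem comb_vertex {n : ℕ} :
    comb (fun i : Fin n => (stdSimplex.vertex i : TopSimplex n)) = ContinuousMap.id _ := by
  ext t k
  change ∑ i, t i * (Pi.single i (1 : ℝ) : Fin n → ℝ) k = t k
  rw [Finset.sum_eq_single k]
  · simp
  · intro b _ hb
    simp [hb.symm]
  · simp

theorem comb_topFace {n m : ℕ} (v : Fin m → TopSimplex n) (i : Fin (n + 1)) :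
    comb (topFace i ∘ v) = (topFace i).comp (comb v) := by
  ext t k
  change ∑ j, t j * FunOnFinite.linearMap ℝ ℝ i.succAbove (v j) k =
    FunOnFinite.linearMap ℝ ℝ i.succAbove (fun l => ∑ j, t j * v j l) k
  have : (fun l => ∑ j, t j * v j l) = ∑ j, t j • (v j : Fin n → ℝ) := by
    funext l
    simp
  rw [this, map_sum]
  simp

theorem comb_comb {n m k : ℕ} (v : Fin m → TopSimplex n) (w : Fin k → TopSimplex m) :
    comb (comb v ∘ w) = (comb v).comp (comb w) := by
  ext t l
  change ∑ j, t j * ∑ i, w j i * v i l = ∑ i, (∑ j, t j * w j i) * v i l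
  simp only [Finset.mul_sum, Finset.sum_mul]
  rw [Finset.sum_comm]
  exact Finset.sum_congr rfl fun i _ => Finset.sum_congr rfl fun j _ => by ring

/-- The map on chains of tuples induced by a map. -/
noncomputable def tupleMap {V : Type u} {W : Type v} (g : V → W) (n : ℕ) :
    (tupleSSet V).Chain n →ₗ[ℤ] (tupleSSet W).Chain n :=
  Finsupp.lmapDomain ℤ ℤ fun x : (tupleSSet V).X n => (g ∘ x : (tupleSSet W).X n)

theorem d_tupleMap {V : Type u} {W : Type v} (g : V → W) {n : ℕ}
    (x : (tupleSSet V).Chain (n + 1)) :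
    (tupleSSet W).d n (tupleMap g (n + 1) x) = tupleMap g n ((tupleSSet V).d n x) :=
  AugSSet.d_lmapDomain _ _ (fun _ _ => rfl) x

theorem tupleMap_tupleMap {V : Type u} {W : Type v} {U : Type w} (g : V → W) (f : W → U) {n : ℕ}
    (x : (tupleSSet V).Chain n) : tupleMap f n (tupleMap g n x) = tupleMap (f ∘ g) n x :=
  lmapDomain_comp_apply _ _ _

/-! ### Cosimplicial models -/

/-- The alternating sum of the coface maps, on chains of tuples. -/
noncomputable def cofaceSum {E : ℕ → Type u} (e : ∀ {n}, Fin (n + 1) → E n → E (n + 1))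
    (n m : ℕ) : (tupleSSet (E n)).Chain m →ₗ[ℤ] (tupleSSet (E (n + 1))).Chain m :=
  ∑ i : Fin (n + 1), (-1 : ℤ) ^ (i : ℕ) • tupleMap (e i) m

section Models

variable {E : ℕ → Type u} (e : ∀ {n}, Fin (n + 1) → E n → E (n + 1))

theorem cofaceSum_apply (n m : ℕ) (x : (tupleSSet (E n)).Chain m) :
    cofaceSum e n m x = ∑ i : Fin (n + 1), (-1 : ℤ) ^ (i : ℕ) • tupleMap (e i) m x := by
  simp [cofaceSum]

theorem d_cofaceSum (n m : ℕ) (x : (tupleSSet (E n)).Chain (m + 1)) :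
    (tupleSSet _).d m (cofaceSum e n (m + 1) x) = cofaceSum e n m ((tupleSSet _).d m x) := by
  simp only [cofaceSum_apply, map_sum, map_smul, d_tupleMap]

theorem cofaceSum_cofaceSum
    (he : ∀ {n : ℕ} {i j : Fin (n + 1)}, i ≤ j → e j.succ ∘ e i = e i.castSucc ∘ e j)
    (n m : ℕ) (x : (tupleSSet (E n)).Chain m) :
    cofaceSum e (n + 1) m (cofaceSum e n m x) = 0 := by
  simp only [cofaceSum_apply, map_sum, map_smul, tupleMap_tupleMap, Finset.smul_sum, smul_smul]
  exact alternating_double_sum_eq_zero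
    (fun (i : Fin (n + 1)) (j : Fin (n + 2)) => tupleMap (e j ∘ e i) m x)
    (fun i j h => by rw [he h])

/-- The homotopy between two compatible families of chains on the models. -/
noncomputable def modelHomotopy (p : ∀ n, E (n + 1)) (f g : ∀ n, (tupleSSet (E n)).Chain n) :
    ∀ n, (tupleSSet (E n)).Chain (n + 1)
  | 0 => 0
  | n + 1 => tupleCone (p n) (n + 1)
      (f (n + 1) - g (n + 1) - cofaceSum e n (n + 1) (modelHomotopy p f g n))

theorem modelHomotopy_succ (p : ∀ n, E (n + 1)) (f g : ∀ n, (tupleSSet (E n)).Chain n) (n : ℕ) :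
    modelHomotopy e p f g (n + 1) = tupleCone (p n) (n + 1)
      (f (n + 1) - g (n + 1) - cofaceSum e n (n + 1) (modelHomotopy e p f g n)) := rfl

/-- Method of acyclic models. A compatible family of chains on the models is the universal form of a
natural chain map. By induction the chain to be filled is a cycle, because the coface sum squares to
zero, so its cone fills it; `h0` starts the induction. -/
theorem d_modelHomotopy
    (he : ∀ {n : ℕ} {i j : Fin (n + 1)}, i ≤ j → e j.succ ∘ e i = e i.castSucc ∘ e j)
    (p : ∀ n, E (n + 1)) (f g : ∀ n, (tupleSSet (E n)).Chain n) (h0 : f 0 = g 0)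
    (hf : ∀ n, (tupleSSet _).d n (f (n + 1)) = cofaceSum e n n (f n))
    (hg : ∀ n, (tupleSSet _).d n (g (n + 1)) = cofaceSum e n n (g n)) (n : ℕ) :
    (tupleSSet _).d (n + 1) (modelHomotopy e p f g (n + 1)) =
      f (n + 1) - g (n + 1) - cofaceSum e n (n + 1) (modelHomotopy e p f g n) := by
  induction n with
  | zero =>
    rw [modelHomotopy_succ, d_tupleCone, sub_eq_self, modelHomotopy, map_zero, sub_zero, map_sub,
      hf, hg, h0, sub_self, map_zero]
  | succ n ih =>
    have h1 : cofaceSum e (n + 1) (n + 1)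
        (f (n + 1) - g (n + 1) - cofaceSum e n (n + 1) (modelHomotopy e p f g n)) =
        cofaceSum e (n + 1) (n + 1) (f (n + 1)) - cofaceSum e (n + 1) (n + 1) (g (n + 1)) := by
      rw [map_sub, map_sub, cofaceSum_cofaceSum e he, sub_zero]
    have h2 : (tupleSSet _).d (n + 1) (f (n + 2) - g (n + 2) -
        cofaceSum e (n + 1) (n + 2) (modelHomotopy e p f g (n + 1))) = 0 := by
      rw [map_sub, map_sub, hf, hg, d_cofaceSum, ih, h1, sub_self]
    rw [modelHomotopy_succ, d_tupleCone, sub_eq_self, h2, map_zero]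

end Models

/-! ### Subdivision of the standard simplices -/

/-- The barycentric subdivision of the standard simplex, as a chain of tuples. -/
noncomputable def simplexSd : ∀ n, (tupleSSet (TopSimplex n)).Chain n
  | 0 => Finsupp.single (Fin.elim0 : Fin 0 → TopSimplex 0) 1
  | n + 1 => tupleCone stdSimplex.barycenter n
      (cofaceSum (E := TopSimplex) (fun i => topFace i) n n (simplexSd n))

theorem topFace_comp_topFace {n : ℕ} {i j : Fin (n + 1)} (h : i ≤ j) :
    (topFace j.succ : TopSimplex (n + 1) → _) ∘ (topFace i : TopSimplex n → _) =
      (topFace i.castSucc : TopSimplex (n + 1) → _) ∘ (topFace j : TopSimplex n → _) :=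
  congrArg DFunLike.coe (topFace_topFace h)

theorem simplexSd_succ (n : ℕ) : simplexSd (n + 1) = tupleCone stdSimplex.barycenter n
    (cofaceSum (E := TopSimplex) (fun i => topFace i) n n (simplexSd n)) := rfl

/-- The sum of the subdivided faces is a cycle, and the cone on a cycle has that cycle as boundary.
-/
theorem d_simplexSd (n : ℕ) :
    (tupleSSet _).d n (simplexSd (n + 1)) =
      cofaceSum (E := TopSimplex) (fun i => topFace i) n n (simplexSd n) := by
  cases n with
  | zero => rw [simplexSd_succ, d_tupleCone_zero]
  | succ n =>
    rw [simplexSd_succ, d_tupleCone, d_cofaceSum, d_simplexSd n,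
      cofaceSum_cofaceSum (E := TopSimplex) (fun i => topFace i) topFace_comp_topFace,
      map_zero, sub_zero]

/-- The identity of the standard simplex, as a tuple. -/
noncomputable def simplexTuple (n : ℕ) : (tupleSSet (TopSimplex n)).Chain n :=
  Finsupp.single (fun i : Fin n => (stdSimplex.vertex i : TopSimplex n)) 1

theorem d_simplexTuple (n : ℕ) :
    (tupleSSet _).d n (simplexTuple (n + 1)) =
      cofaceSum (E := TopSimplex) (fun i => topFace i) n n (simplexTuple n) := by
  rw [simplexTuple, AugSSet.d_single, cofaceSum_apply]
  refine Finset.sum_congr rfl fun i _ => ?_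
  congr 1
  simp only [simplexTuple, tupleMap, Finsupp.lmapDomain_apply, Finsupp.mapDomain_single]
  congr 1
  funext k
  simp [topFace]

theorem topFace_apply_succAbove {n : ℕ} (i : Fin (n + 1)) (x : TopSimplex n) (k : Fin n) :
    topFace i x (i.succAbove k) = x k := by
  classical
  have := sum_stdSimplex_map i.succAbove x (Pi.single (i.succAbove k) 1)
  simp only [Pi.single_apply, mul_ite, mul_one, mul_zero, Finset.sum_ite_eq', Finset.mem_univ,
    if_true, Fin.succAbove_right_inj] at this
  exact this

/-- Two points of a simplex whose common mass is at least `r`. -/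
def Overlap (r : ℝ) {n : ℕ} (x y : TopSimplex n) : Prop := r ≤ ∑ k, min (x k) (y k)

theorem Overlap.symm {r : ℝ} {n : ℕ} {x y : TopSimplex n} (h : Overlap r x y) :
    Overlap r y x := by
  simpa only [Overlap, min_comm] using h

theorem Overlap.mono {r s : ℝ} {n : ℕ} {x y : TopSimplex n} (h : Overlap r x y) (hs : s ≤ r) :
    Overlap s x y := hs.trans h

theorem Overlap.topFace {r : ℝ} {n : ℕ} {x y : TopSimplex n} (h : Overlap r x y)
    (i : Fin (n + 1)) : Overlap r (topFace i x) (topFace i y) := by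
  refine h.trans ?_
  rw [Fin.sum_univ_succAbove _ i]
  simp only [topFace_apply_succAbove]
  exact le_add_of_nonneg_left (le_min (stdSimplex.zero_le _ _) (stdSimplex.zero_le _ _))

/-- If some coordinate of `x` reaches the common value of the barycenter, that coordinate alone
supplies the overlap; otherwise the minimum is `x` everywhere and the overlap is the full mass. -/
theorem overlap_barycenter {n : ℕ} (x : TopSimplex (n + 1)) :
    Overlap ((n + 1 : ℝ)⁻¹) stdSimplex.barycenter x := by
  have hb : ∀ k, (stdSimplex.barycenter : TopSimplex (n + 1)) k = ((n + 1 : ℝ)⁻¹) := fun k => by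
    have := stdSimplex.barycenter_apply (𝕜 := ℝ) (X := Fin (n + 1)) k
    rw [Fintype.card_fin] at this
    exact_mod_cast this
  have hn : 0 ≤ ((n + 1 : ℝ)⁻¹) := by positivity
  by_cases h : ∃ k, ((n + 1 : ℝ)⁻¹) ≤ x k
  · obtain ⟨k, hk⟩ := h
    have := Finset.single_le_sum (f := fun k => min ((stdSimplex.barycenter : TopSimplex (n + 1)) k)
      (x k)) (fun i _ => le_min (stdSimplex.zero_le _ _) (stdSimplex.zero_le _ _))
      (Finset.mem_univ k)
    refine le_trans ?_ this
    simp [hb, hk]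
  · push Not at h
    have : ∑ k, min ((stdSimplex.barycenter : TopSimplex (n + 1)) k) (x k) = ∑ k, x k :=
      Finset.sum_congr rfl fun k _ => min_eq_right (by rw [hb]; exact (h k).le)
    rw [Overlap, this, stdSimplex.sum_eq_one]
    exact inv_le_one_of_one_le₀ (by linarith [n.cast_nonneg (α := ℝ)])

theorem cofaceSum_mem_supported {E : ℕ → Type u} (e : ∀ {n}, Fin (n + 1) → E n → E (n + 1))
    {n m : ℕ} {s : Set (Fin m → E n)} {t : Set (Fin m → E (n + 1))}
    (h : ∀ i, ∀ x ∈ s, e i ∘ x ∈ t) {x : (tupleSSet (E n)).Chain m}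
    (hx : x ∈ Finsupp.supported ℤ ℤ s) : cofaceSum e n m x ∈ Finsupp.supported ℤ ℤ t := by
  rw [cofaceSum_apply]
  exact Submodule.sum_mem _ fun i _ => Submodule.smul_mem _ _
    (lmapDomain_mem_supported _ (h i) hx)

/-- Any two vertices of a simplex of the barycentric subdivision overlap. -/
theorem simplexSd_mem_supported (n : ℕ) :
    simplexSd n ∈ Finsupp.supported ℤ ℤ
      {v : Fin n → TopSimplex n | ∀ i j, Overlap ((n : ℝ)⁻¹) (v i) (v j)} := by
  induction n with
  | zero => exact Finsupp.single_mem_supported ℤ 1 fun i => i.elim0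
  | succ n ih =>
    rw [simplexSd_succ]
    refine lmapDomain_mem_supported (s := {v : Fin n → TopSimplex (n + 1) |
      ∀ i j, Overlap ((n + 1 : ℝ)⁻¹) (v i) (v j)})
      (t := {v : Fin (n + 1) → TopSimplex (n + 1) |
        ∀ i j, Overlap (((n + 1 : ℕ) : ℝ)⁻¹) (v i) (v j)}) _ (fun v hv => ?_)
      (cofaceSum_mem_supported _ (fun i v hv j k => ?_) ih)
    · push_cast
      refine Fin.cases (Fin.cases (overlap_barycenter _) fun j => overlap_barycenter _)
        fun i => Fin.cases (overlap_barycenter _).symm fun j => hv i j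
    · refine ((hv j k).topFace i).mono ?_
      have : 0 < n := j.pos
      gcongr
      linarith

/-- The common mass of `x` and `y` cancels. What remains has mass at most `1 - r` on each side, and
moving it changes the average of `a` by at most its oscillation `D`. -/
theorem sum_mul_sub_sum_mul_le {n : ℕ} (a : Fin n → ℝ) {r D : ℝ}
    (hD : ∀ i j, a i - a j ≤ D) {x y : TopSimplex n} (h : Overlap r x y) :
    ∑ i, x i * a i - ∑ i, y i * a i ≤ (1 - r) * D := by
  have hne : (Finset.univ : Finset (Fin n)).Nonempty := by
    rw [Finset.nonempty_iff_ne_empty]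
    intro h0
    have := stdSimplex.sum_eq_one x
    rw [h0, Finset.sum_empty] at this
    exact zero_ne_one this
  obtain ⟨p, -, hp⟩ := Finset.exists_max_image Finset.univ a hne
  obtain ⟨q, -, hq⟩ := Finset.exists_min_image Finset.univ a hne
  have h1 : ∑ i, (x i - min (x i) (y i)) * a i ≤ ∑ i, (x i - min (x i) (y i)) * a p :=
    Finset.sum_le_sum fun i hi => mul_le_mul_of_nonneg_left (hp i hi)
      (sub_nonneg.mpr (min_le_left _ _))
  have h2 : ∑ i, (y i - min (x i) (y i)) * a q ≤ ∑ i, (y i - min (x i) (y i)) * a i :=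
    Finset.sum_le_sum fun i hi => mul_le_mul_of_nonneg_left (hq i hi)
      (sub_nonneg.mpr (min_le_right _ _))
  rw [← Finset.sum_mul, Finset.sum_sub_distrib, stdSimplex.sum_eq_one] at h1 h2
  simp only [sub_mul, Finset.sum_sub_distrib] at h1 h2
  have h3 : ∑ i, min (x i) (y i) ≤ 1 := by
    rw [← stdSimplex.sum_eq_one x]
    exact Finset.sum_le_sum fun i _ => min_le_left _ _
  have h4 : (1 - ∑ i, min (x i) (y i)) * (a p - a q) ≤ (1 - ∑ i, min (x i) (y i)) * D :=
    mul_le_mul_of_nonneg_left (hD p q) (by linarith)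
  have h5 : (1 - ∑ i, min (x i) (y i)) * D ≤ (1 - r) * D := by
    refine mul_le_mul_of_nonneg_right ?_ (by simpa using hD p p)
    have : r ≤ ∑ i, min (x i) (y i) := h
    linarith
  linarith

/-- Affine maps contract the distance of overlapping points. -/
theorem dist_comb_le {n m : ℕ} (w : Fin n → TopSimplex m) {r D : ℝ} (hr : r ≤ 1)
    (hn : 0 ≤ D) (hD : ∀ i j, dist (w i) (w j) ≤ D) {x y : TopSimplex n} (h : Overlap r x y) :
    dist (comb w x) (comb w y) ≤ (1 - r) * D := by
  -- The distance on a simplex is the supremum distance, so the scalar estimate applies coordinate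
  -- by coordinate.
  have key : ∀ k i j, w i k - w j k ≤ D := fun k i j =>
    (le_abs_self _).trans (((dist_le_pi_dist (w i).1 (w j).1 k).trans (hD i j)))
  refine (dist_pi_le_iff (mul_nonneg (by linarith) hn)).mpr fun k => ?_
  rw [Real.dist_eq]
  exact abs_sub_le_iff.mpr ⟨sum_mul_sub_sum_mul_le _ (key k) h,
    sum_mul_sub_sum_mul_le _ (key k) h.symm⟩

/-! ### Natural operators on singular chains -/

section Realize

variable {E : Type v} [TopologicalSpace E] [AffinelyCombinable E] {Z : Type u} [TopologicalSpace Z]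

/-- The singular chain obtained from a chain of tuples by a continuous map. -/
noncomputable def realizeTuple (τ : C(E, Z)) (n : ℕ) :
    (tupleSSet E).Chain n →ₗ[ℤ] (singSSet Z).Chain n :=
  Finsupp.lmapDomain ℤ ℤ fun u : (tupleSSet E).X n => (τ.comp (comb u) : (singSSet Z).X n)

theorem d_realizeTuple (τ : C(E, Z)) {n : ℕ} (x : (tupleSSet E).Chain (n + 1)) :
    (singSSet Z).d n (realizeTuple τ (n + 1) x) = realizeTuple τ n ((tupleSSet E).d n x) :=
  AugSSet.d_lmapDomain _ _ (fun i u => by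
    rw [← comb_face]
    rfl) x

theorem realizeTuple_tupleMap {F : Type w} [TopologicalSpace F] [AffinelyCombinable F]
    (τ : C(E, Z)) (g : C(F, E)) {n : ℕ} (hg : ∀ u : Fin n → F, comb (g ∘ u) = g.comp (comb u))
    (x : (tupleSSet F).Chain n) :
    realizeTuple τ n (tupleMap g n x) = realizeTuple (τ.comp g) n x := by
  rw [realizeTuple, tupleMap, lmapDomain_comp_apply, realizeTuple]
  congr 2
  funext u
  simp only [Function.comp_apply, hg]
  rfl

theorem singMap_realizeTuple {Y : Type w} [TopologicalSpace Y] (τ : C(E, Z)) (g : C(Z, Y)) {n : ℕ}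
    (x : (tupleSSet E).Chain n) :
    singMap g n (realizeTuple τ n x) = realizeTuple (g.comp τ) n x :=
  lmapDomain_comp_apply _ _ _

end Realize

/-- A family of sets of singular simplices closed under precomposition. -/
def IsSieve {Y : Type u} [TopologicalSpace Y] (P : ∀ n, Set (C(TopSimplex n, Y))) : Prop :=
  ∀ ⦃n m : ℕ⦄, ∀ σ ∈ P n, ∀ θ : C(TopSimplex m, TopSimplex n), σ.comp θ ∈ P m

section Operators

variable {Y : Type u} [TopologicalSpace Y] {Z : Type v} [TopologicalSpace Z]

theorem IsSieve.d_mem {P : ∀ n, Set (C(TopSimplex n, Y))} (hP : IsSieve P) {n : ℕ}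
    {x : (singSSet Y).Chain (n + 1)} (hx : x ∈ Finsupp.supported ℤ ℤ (P (n + 1))) :
    (singSSet Y).d n x ∈ Finsupp.supported ℤ ℤ (P n) :=
  AugSSet.d_mem_supported (fun σ hσ i => hP σ hσ (topFace i)) hx

variable (Y) in
/-- The barycentric subdivision of singular chains. -/
noncomputable def sdOp (n : ℕ) : (singSSet Y).Chain n →ₗ[ℤ] (singSSet Y).Chain n :=
  Finsupp.linearCombination ℤ fun σ : (singSSet Y).X n => realizeTuple σ n (simplexSd n)

theorem sdOp_single {n : ℕ} (σ : (singSSet Y).X n) :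
    sdOp Y n (Finsupp.single σ 1) = realizeTuple σ n (simplexSd n) := by
  simp [sdOp]

theorem realizeTuple_cofaceSum {n m : ℕ} (σ : (singSSet Y).X (n + 1))
    (x : (tupleSSet (TopSimplex n)).Chain m) :
    realizeTuple σ m (cofaceSum (E := TopSimplex) (fun i => topFace i) n m x) =
      ∑ i : Fin (n + 1), (-1 : ℤ) ^ (i : ℕ) • realizeTuple ((singSSet Y).δ i σ) m x := by
  simp only [cofaceSum_apply, map_sum, map_smul]
  exact Finset.sum_congr rfl fun i _ => by
    rw [realizeTuple_tupleMap σ (topFace i) (fun u => comb_topFace u i)]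

theorem d_sdOp {n : ℕ} (x : (singSSet Y).Chain (n + 1)) :
    (singSSet Y).d n (sdOp Y (n + 1) x) = sdOp Y n ((singSSet Y).d n x) := by
  refine map_eq_of_forall_single ((singSSet Y).d n ∘ₗ sdOp Y (n + 1))
    (sdOp Y n ∘ₗ (singSSet Y).d n) (fun σ => ?_) x
  simp only [LinearMap.comp_apply]
  rw [sdOp_single, d_realizeTuple, d_simplexSd, realizeTuple_cofaceSum, AugSSet.d_single, map_sum]
  exact Finset.sum_congr rfl fun i _ => by rw [map_smul, sdOp_single]

theorem singMap_sdOp (g : C(Y, Z)) {n : ℕ} (x : (singSSet Y).Chain n) :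
    singMap g n (sdOp Y n x) = sdOp Z n (singMap g n x) := by
  refine map_eq_of_forall_single (singMap g n ∘ₗ sdOp Y n) (sdOp Z n ∘ₗ singMap g n)
    (fun σ => ?_) x
  simp only [LinearMap.comp_apply]
  rw [sdOp_single, singMap_single, sdOp_single, singMap_realizeTuple]

theorem sdOp_mem {P : ∀ n, Set (C(TopSimplex n, Y))} (hP : IsSieve P) {n : ℕ}
    {x : (singSSet Y).Chain n} (hx : x ∈ Finsupp.supported ℤ ℤ (P n)) :
    sdOp Y n x ∈ Finsupp.supported ℤ ℤ (P n) :=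
  map_mem_of_supported _ _ (fun σ hσ => by
    rw [sdOp_single]
    exact lmapDomain_mem_supported (s := Set.univ) _ (fun u _ => hP σ hσ _)
      (by simp)) hx

/-- The cofaces of the prisms. -/
noncomputable def prismFace {n : ℕ} (i : Fin (n + 1)) :
    C(TopSimplex n × unitInterval, TopSimplex (n + 1) × unitInterval) :=
  (topFace i).prodMap (ContinuousMap.id _)

theorem prismFace_comp_prismFace {n : ℕ} {i j : Fin (n + 1)} (h : i ≤ j) :
    (prismFace j.succ : TopSimplex (n + 1) × unitInterval → _) ∘
      (prismFace i : TopSimplex n × unitInterval → _) =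
      (prismFace i.castSucc : TopSimplex (n + 1) × unitInterval → _) ∘
        (prismFace j : TopSimplex n × unitInterval → _) := by
  funext x
  exact Prod.ext (congrFun (topFace_comp_topFace h) x.1) rfl

theorem comb_prismFace {n m : ℕ} (v : Fin m → TopSimplex n × unitInterval) (i : Fin (n + 1)) :
    comb (prismFace i ∘ v) = (prismFace i).comp (comb v) := by
  ext1 t
  exact Prod.ext (DFunLike.congr_fun (comb_topFace (fun j => (v j).1) i) t) rfl

/-- The operator on singular chains given by chains on the prisms and a homotopy. -/
noncomputable def prismOp (H : C(Y × unitInterval, Z)) {n m : ℕ}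
    (c : (tupleSSet (TopSimplex n × unitInterval)).Chain m) :
    (singSSet Y).Chain n →ₗ[ℤ] (singSSet Z).Chain m :=
  Finsupp.linearCombination ℤ fun σ : (singSSet Y).X n =>
    realizeTuple (H.comp (ContinuousMap.prodMap σ (ContinuousMap.id _))) m c

theorem prismOp_single (H : C(Y × unitInterval, Z)) {n m : ℕ}
    (c : (tupleSSet (TopSimplex n × unitInterval)).Chain m) (σ : (singSSet Y).X n) :
    prismOp H c (Finsupp.single σ 1) =
      realizeTuple (H.comp (ContinuousMap.prodMap σ (ContinuousMap.id _))) m c := by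
  simp [prismOp]

theorem prismOp_sub (H : C(Y × unitInterval, Z)) {n m : ℕ}
    (c c' : (tupleSSet (TopSimplex n × unitInterval)).Chain m) :
    prismOp H (c - c') = prismOp H c - prismOp H c' := by
  refine LinearMap.ext fun x => map_eq_of_forall_single _ _ (fun σ => ?_) x
  rw [LinearMap.sub_apply, prismOp_single, prismOp_single, prismOp_single, map_sub]

theorem d_prismOp (H : C(Y × unitInterval, Z)) {n m : ℕ}
    (c : (tupleSSet (TopSimplex n × unitInterval)).Chain (m + 1)) (x : (singSSet Y).Chain n) :
    (singSSet Z).d m (prismOp H c x) = prismOp H ((tupleSSet _).d m c) x := by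
  refine map_eq_of_forall_single ((singSSet Z).d m ∘ₗ prismOp H c) _ (fun σ => ?_) x
  rw [LinearMap.comp_apply, prismOp_single, prismOp_single, d_realizeTuple]

/-- Restricting the prism on a simplex to the prism on one of its faces is the same as using that
face from the start; this turns the coface sum on models into the boundary of singular chains. -/
theorem prismOp_cofaceSum (H : C(Y × unitInterval, Z)) {n m : ℕ}
    (c : (tupleSSet (TopSimplex n × unitInterval)).Chain m) (x : (singSSet Y).Chain (n + 1)) :
    prismOp H (cofaceSum (E := fun n => TopSimplex n × unitInterval)
      (fun i => prismFace i) n m c) x = prismOp H c ((singSSet Y).d n x) := by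
  refine map_eq_of_forall_single (prismOp H _) (prismOp H c ∘ₗ (singSSet Y).d n) (fun σ => ?_) x
  rw [LinearMap.comp_apply, prismOp_single, AugSSet.d_single, cofaceSum_apply, map_sum, map_sum]
  refine Finset.sum_congr rfl fun i _ => ?_
  rw [map_smul, map_smul, prismOp_single,
    realizeTuple_tupleMap _ (prismFace i) (fun u => comb_prismFace u i)]
  rfl

theorem prismOp_mem (H : C(Y × unitInterval, Z)) {n m : ℕ}
    (c : (tupleSSet (TopSimplex n × unitInterval)).Chain m) {s : Set (C(TopSimplex n, Y))}
    {t : Set (C(TopSimplex m, Z))}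
    (h : ∀ σ ∈ s, ∀ θ : C(TopSimplex m, TopSimplex n × unitInterval),
      (H.comp (ContinuousMap.prodMap σ (ContinuousMap.id _))).comp θ ∈ t)
    {x : (singSSet Y).Chain n} (hx : x ∈ Finsupp.supported ℤ ℤ s) :
    prismOp H c x ∈ Finsupp.supported ℤ ℤ t :=
  map_mem_of_supported _ _ (fun σ hσ => by
    rw [prismOp_single]
    exact lmapDomain_mem_supported (s := Set.univ) _ (fun u _ => h σ hσ _) (by simp)) hx

/-- The inclusion of a simplex in a prism, at a given height. -/
noncomputable def prismLevel (n : ℕ) (a : unitInterval) :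
    C(TopSimplex n, TopSimplex n × unitInterval) :=
  (ContinuousMap.id _).prodMk (ContinuousMap.const _ a)

theorem comb_prismLevel {n m : ℕ} (a : unitInterval) (v : Fin m → TopSimplex n) :
    comb (prismLevel n a ∘ v) = (prismLevel n a).comp (comb v) := by
  ext1 t
  exact Prod.ext rfl (unitInterval.comb_const a t)

theorem d_tupleMap_prismLevel (a : unitInterval)
    (c : ∀ n, (tupleSSet (TopSimplex n)).Chain n)
    (hc : ∀ n, (tupleSSet _).d n (c (n + 1)) =
      cofaceSum (E := TopSimplex) (fun i => topFace i) n n (c n)) (n : ℕ) :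
    (tupleSSet _).d n (tupleMap (prismLevel (n + 1) a) (n + 1) (c (n + 1))) =
      cofaceSum (E := fun n => TopSimplex n × unitInterval) (fun i => prismFace i) n n
        (tupleMap (prismLevel n a) n (c n)) := by
  rw [d_tupleMap, hc, cofaceSum_apply, cofaceSum_apply, map_sum]
  refine Finset.sum_congr rfl fun i _ => ?_
  rw [map_smul, tupleMap_tupleMap, tupleMap_tupleMap]
  rfl

theorem prismOp_tupleMap_prismLevel (H : C(Y × unitInterval, Z)) {n m : ℕ} (a : unitInterval)
    (c : (tupleSSet (TopSimplex n)).Chain m) (σ : (singSSet Y).X n) :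
    prismOp H (tupleMap (prismLevel n a) m c) (Finsupp.single σ 1) =
      realizeTuple (H.comp (σ.prodMk (ContinuousMap.const _ a))) m c := by
  rw [prismOp_single, realizeTuple_tupleMap _ _ (fun u => comb_prismLevel a u)]
  rfl

/-- The chain homotopy between the operators given by two families of chains on the prisms. -/
noncomputable def prismHomotopy (H : C(Y × unitInterval, Z))
    (f g : ∀ n, (tupleSSet (TopSimplex n × unitInterval)).Chain n) (n : ℕ) :
    (singSSet Y).Chain n →ₗ[ℤ] (singSSet Z).Chain (n + 1) :=
  prismOp H (modelHomotopy (E := fun n => TopSimplex n × unitInterval)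
    (fun i => prismFace i) (fun _ => (stdSimplex.barycenter, 0)) f g n)

/-- Two heights and two families are allowed so that one formula serves twice: the same family at
heights 1 and 0 gives homotopy invariance, while subdivision and the identity at one height, with
the projection as `H`, give the homotopy from subdivision to the identity. -/
theorem d_prismHomotopy (H : C(Y × unitInterval, Z)) (a b : unitInterval)
    (f g : ∀ n, (tupleSSet (TopSimplex n)).Chain n)
    (h0 : tupleMap (prismLevel 0 a) 0 (f 0) = tupleMap (prismLevel 0 b) 0 (g 0))
    (hf : ∀ n, (tupleSSet _).d n (f (n + 1)) =
      cofaceSum (E := TopSimplex) (fun i => topFace i) n n (f n))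
    (hg : ∀ n, (tupleSSet _).d n (g (n + 1)) =
      cofaceSum (E := TopSimplex) (fun i => topFace i) n n (g n)) {n : ℕ}
    (x : (singSSet Y).Chain (n + 1)) :
    (singSSet Z).d (n + 1) (prismHomotopy H (fun n => tupleMap (prismLevel n a) n (f n))
        (fun n => tupleMap (prismLevel n b) n (g n)) (n + 1) x) =
      prismOp H (tupleMap (prismLevel (n + 1) a) (n + 1) (f (n + 1))) x -
      prismOp H (tupleMap (prismLevel (n + 1) b) (n + 1) (g (n + 1))) x -
      prismHomotopy H (fun n => tupleMap (prismLevel n a) n (f n))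
        (fun n => tupleMap (prismLevel n b) n (g n)) n ((singSSet Y).d n x) := by
  rw [prismHomotopy, d_prismOp, d_modelHomotopy (E := fun n => TopSimplex n × unitInterval) _
    prismFace_comp_prismFace _ _ _ h0 (d_tupleMap_prismLevel a f hf)
    (d_tupleMap_prismLevel b g hg), prismOp_sub, prismOp_sub, LinearMap.sub_apply,
    LinearMap.sub_apply, prismOp_cofaceSum]
  rfl

/-- Homotopic maps induce chain homotopic maps on singular chains. -/
theorem exists_singMap_homotopy (H : C(Y × unitInterval, Z)) (f g : C(Y, Z))
    (hf : ∀ y, H (y, 1) = f y) (hg : ∀ y, H (y, 0) = g y) :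
    ∃ h : ∀ n, (singSSet Y).Chain n →ₗ[ℤ] (singSSet Z).Chain (n + 1),
      (∀ n x, (singSSet Z).d (n + 1) (h (n + 1) x) =
        singMap f (n + 1) x - singMap g (n + 1) x - h n ((singSSet Y).d n x)) ∧
      ∀ n (s : Set (C(TopSimplex n, Y))) (t : Set (C(TopSimplex (n + 1), Z))),
        (∀ σ ∈ s, ∀ θ : C(TopSimplex (n + 1), TopSimplex n × unitInterval),
          (H.comp (ContinuousMap.prodMap σ (ContinuousMap.id _))).comp θ ∈ t) →
        ∀ x ∈ Finsupp.supported ℤ ℤ s, h n x ∈ Finsupp.supported ℤ ℤ t := by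
  have key : ∀ (a : unitInterval) (k : C(Y, Z)), (∀ y, H (y, a) = k y) → ∀ n x,
      prismOp H (tupleMap (prismLevel n a) n (simplexTuple n)) x = singMap k n x := by
    intro a k hk n x
    refine map_eq_of_forall_single _ _ (fun σ => ?_) x
    rw [prismOp_tupleMap_prismLevel, singMap_single, simplexTuple, realizeTuple,
      Finsupp.lmapDomain_apply, Finsupp.mapDomain_single, comb_vertex]
    congr 1
    ext1 t
    exact hk _
  refine ⟨_, fun n x => (d_prismHomotopy H 1 0 simplexTuple simplexTuple ?_ d_simplexTuple
    d_simplexTuple x).trans ?_, fun n s t h x hx => prismOp_mem H _ h hx⟩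
  · simp only [simplexTuple, tupleMap, Finsupp.lmapDomain_apply, Finsupp.mapDomain_single]
    congr 1
    exact Subsingleton.elim (α := Fin 0 → _) _ _
  · rw [key 1 f hf, key 0 g hg]

variable (Y) in
/-- Iterated barycentric subdivision is naturally homotopic to the identity. -/
theorem exists_sdOp_homotopy :
    ∃ h : ∀ n, (singSSet Y).Chain n →ₗ[ℤ] (singSSet Y).Chain (n + 1),
      (∀ n x, (singSSet Y).d (n + 1) (h (n + 1) x) =
        sdOp Y (n + 1) x - x - h n ((singSSet Y).d n x)) ∧
      ∀ P : ∀ n, Set (C(TopSimplex n, Y)), IsSieve P → ∀ n,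
        ∀ x ∈ Finsupp.supported ℤ ℤ (P n), h n x ∈ Finsupp.supported ℤ ℤ (P (n + 1)) := by
  refine ⟨_, fun n x => (d_prismHomotopy (Y := Y) ContinuousMap.fst 0 0 simplexSd simplexTuple ?_
    d_simplexSd d_simplexTuple x).trans ?_, fun P hP n x hx =>
      prismOp_mem _ _ (fun σ hσ θ => hP σ hσ (ContinuousMap.fst.comp θ)) hx⟩
  · simp only [simplexTuple, simplexSd, tupleMap, Finsupp.lmapDomain_apply,
      Finsupp.mapDomain_single]
    congr 1
    exact Subsingleton.elim (α := Fin 0 → _) _ _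
  · congr 2
    · refine map_eq_of_forall_single _ _ (fun σ => ?_) x
      rw [prismOp_tupleMap_prismLevel, sdOp_single]
      rfl
    · refine map_eq_of_forall_single _ LinearMap.id (fun σ => ?_) x
      rw [prismOp_tupleMap_prismLevel, simplexTuple, realizeTuple,
        Finsupp.lmapDomain_apply, Finsupp.mapDomain_single, comb_vertex]
      rfl

end Operators

/-! ### Small simplices -/

section Small

variable {Y : Type u} [TopologicalSpace Y] {Z : Type v} [TopologicalSpace Z]

variable (Y) in
/-- Iterated barycentric subdivision. -/
noncomputable def sdIter (N n : ℕ) : (singSSet Y).Chain n →ₗ[ℤ] (singSSet Y).Chain n :=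
  sdOp Y n ^ N

theorem sdIter_succ (N : ℕ) {n : ℕ} (x : (singSSet Y).Chain n) :
    sdIter Y (N + 1) n x = sdOp Y n (sdIter Y N n x) := by
  rw [sdIter, pow_succ', Module.End.mul_apply, sdIter]

theorem d_sdIter (N : ℕ) {n : ℕ} (x : (singSSet Y).Chain (n + 1)) :
    (singSSet Y).d n (sdIter Y N (n + 1) x) = sdIter Y N n ((singSSet Y).d n x) := by
  induction N with
  | zero => rfl
  | succ N ih => rw [sdIter_succ, d_sdOp, ih, sdIter_succ]

theorem singMap_sdIter (g : C(Y, Z)) (N : ℕ) {n : ℕ} (x : (singSSet Y).Chain n) :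
    singMap g n (sdIter Y N n x) = sdIter Z N n (singMap g n x) := by
  induction N with
  | zero => rfl
  | succ N ih => rw [sdIter_succ, singMap_sdOp, ih, sdIter_succ]

theorem sdIter_mem {P : ∀ n, Set (C(TopSimplex n, Y))} (hP : IsSieve P) (N : ℕ) {n : ℕ}
    {x : (singSSet Y).Chain n} (hx : x ∈ Finsupp.supported ℤ ℤ (P n)) :
    sdIter Y N n x ∈ Finsupp.supported ℤ ℤ (P n) := by
  induction N with
  | zero => exact hx
  | succ N ih =>
    rw [sdIter_succ]
    exact sdOp_mem hP ih

variable (Y) in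
/-- Iterated barycentric subdivision is naturally chain homotopic to the identity. -/
theorem exists_sdIter_homotopy (N : ℕ) :
    ∃ h : ∀ n, (singSSet Y).Chain n →ₗ[ℤ] (singSSet Y).Chain (n + 1),
      (∀ n x, (singSSet Y).d (n + 1) (h (n + 1) x) =
        sdIter Y N (n + 1) x - x - h n ((singSSet Y).d n x)) ∧
      ∀ P : ∀ n, Set (C(TopSimplex n, Y)), IsSieve P → ∀ n,
        ∀ x ∈ Finsupp.supported ℤ ℤ (P n), h n x ∈ Finsupp.supported ℤ ℤ (P (n + 1)) := by
  obtain ⟨h, h1, h2⟩ := exists_sdOp_homotopy Y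
  induction N with
  | zero => exact ⟨fun n => 0, fun n x => by simp [sdIter], fun P _ n x _ => Submodule.zero_mem _⟩
  | succ N ih =>
    obtain ⟨k, k1, k2⟩ := ih
    -- This follows the splitting of `sd^(N+1) - id` as `(sd - id) sd^N + (sd^N - id)`.
    refine ⟨fun n => h n ∘ₗ sdIter Y N n + k n, fun n x => ?_, fun P hP n x hx =>
      Submodule.add_mem _ (h2 P hP n _ (sdIter_mem hP N hx)) (k2 P hP n x hx)⟩
    rw [LinearMap.add_apply, LinearMap.add_apply, map_add, LinearMap.comp_apply,
      LinearMap.comp_apply, h1, k1, d_sdIter, sdIter_succ]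
    abel

/-- The singular simplices contained in a given set. -/
def simplicesIn (A : Set Y) (n : ℕ) : Set (C(TopSimplex n, Y)) := {σ | Set.range σ ⊆ A}

theorem isSieve_simplicesIn (A : Set Y) : IsSieve (simplicesIn A) := fun _ _ _ hσ θ => by
  rintro _ ⟨t, rfl⟩
  exact hσ ⟨θ t, rfl⟩

theorem simplicesIn_mono {A B : Set Y} (h : A ⊆ B) (n : ℕ) :
    simplicesIn A n ⊆ simplicesIn B n := fun _ hσ => hσ.trans h

theorem mem_simplicesIn_zero (A : Set Y) (σ : C(TopSimplex 0, Y)) : σ ∈ simplicesIn A 0 := by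
  rintro _ ⟨t, rfl⟩
  have := stdSimplex.sum_eq_one t
  simp at this

/-- The singular simplices contained in a member of a family of sets. -/
def simplicesSmall {ι : Type w} (U : ι → Set Y) (n : ℕ) : Set (C(TopSimplex n, Y)) :=
  {σ | ∃ i, Set.range σ ⊆ U i}

theorem isSieve_simplicesSmall {ι : Type w} (U : ι → Set Y) : IsSieve (simplicesSmall U) :=
  fun _ _ _ hσ θ => by
  obtain ⟨i, hi⟩ := hσ
  refine ⟨i, ?_⟩
  rintro _ ⟨t, rfl⟩
  exact hi ⟨θ t, rfl⟩

/-- The affine simplices whose vertices have distances at most `r`. -/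
def affineMesh (m : ℕ) (r : ℝ) (n : ℕ) : Set (C(TopSimplex n, TopSimplex m)) :=
  {σ | ∃ w : Fin n → TopSimplex m, σ = comb w ∧ ∀ i j, dist (w i) (w j) ≤ r}

theorem sdOp_mem_affineMesh {m n : ℕ} {r : ℝ} (hr : 0 ≤ r)
    {x : (singSSet (TopSimplex m)).Chain n}
    (hx : x ∈ Finsupp.supported ℤ ℤ (affineMesh m r n)) :
    sdOp _ n x ∈ Finsupp.supported ℤ ℤ (affineMesh m ((1 - (n : ℝ)⁻¹) * r) n) := by
  refine map_mem_of_supported _ _ ?_ hx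
  rintro _ ⟨w, rfl, hw⟩
  rw [sdOp_single]
  refine lmapDomain_mem_supported _ (fun u hu => ?_) (simplexSd_mem_supported n)
  refine ⟨comb w ∘ u, (comb_comb w u).symm, fun i j => dist_comb_le w ?_ hr hw (hu i j)⟩
  exact inv_le_one_of_one_le₀ (by exact_mod_cast i.pos)

theorem sdIter_mem_affineMesh (m N : ℕ) :
    sdIter _ N m (Finsupp.single (ContinuousMap.id (TopSimplex m) : (singSSet _).X m) 1) ∈
      Finsupp.supported ℤ ℤ (affineMesh m ((1 - (m : ℝ)⁻¹) ^ N) m) := by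
  have h0 : (m : ℝ)⁻¹ ≤ 1 := by
    -- For `m = 0` the inverse is `0` by convention, so the bound still holds.
    rcases m.eq_zero_or_pos with rfl | h
    · simp
    · exact inv_le_one_of_one_le₀ (by exact_mod_cast h)
  induction N with
  | zero =>
    refine Finsupp.single_mem_supported ℤ 1 ⟨_, comb_vertex.symm, fun i j => ?_⟩
    rw [pow_zero]
    refine (dist_pi_le_iff zero_le_one).mpr fun k => ?_
    exact Real.dist_le_of_mem_Icc_01 ⟨stdSimplex.zero_le _ _, stdSimplex.le_one _ _⟩
      ⟨stdSimplex.zero_le _ _, stdSimplex.le_one _ _⟩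
  | succ N ih =>
    rw [sdIter_succ, pow_succ']
    exact sdOp_mem_affineMesh (pow_nonneg (by linarith) _) ih

theorem dist_comb_vertex_le {n m : ℕ} (w : Fin n → TopSimplex m) {D : ℝ} (hn : 0 ≤ D)
    (hD : ∀ i j, dist (w i) (w j) ≤ D) (s t : TopSimplex n) :
    dist (comb w s) (comb w t) ≤ D := by
  have := dist_comb_le w zero_le_one hn hD (x := s) (y := t)
    (Finset.sum_nonneg fun k _ => le_min (stdSimplex.zero_le _ _) (stdSimplex.zero_le _ _))
  simpa using this

/-- For an open cover, any singular chain becomes small after sufficiently many subdivisions. -/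
theorem eventually_sdIter_mem_simplicesSmall {ι : Type w} (U : ι → Set Y) (hU : ∀ i, IsOpen (U i))
    (hcov : ∀ y, ∃ i, y ∈ U i) [hι : Nonempty ι] {n : ℕ} (x : (singSSet Y).Chain n) :
    ∀ᶠ N in Filter.atTop,
      sdIter Y N n x ∈ Finsupp.supported ℤ ℤ (simplicesSmall U n) := by
  -- Smallness for all large `N`, not just for one, lets the finitely many generators of a chain,
  -- and later several chains, share one `N`.
  have single : ∀ σ : (singSSet Y).X n, ∀ᶠ N in Filter.atTop,
      sdIter Y N n (Finsupp.single σ 1) ∈ Finsupp.supported ℤ ℤ (simplicesSmall U n) := by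
    intro σ
    -- The empty simplex lies in every set, but some member of the cover must be named; this uses
    -- `Nonempty ι`.
    rcases n.eq_zero_or_pos with rfl | hn
    · refine Filter.Eventually.of_forall fun N => sdIter_mem (isSieve_simplicesSmall U) N ?_
      exact Finsupp.single_mem_supported ℤ 1
        ⟨hι.some, mem_simplicesIn_zero _ σ⟩
    obtain ⟨δ, hδ, hball⟩ := lebesgue_number_lemma_of_metric (s := (Set.univ : Set (TopSimplex n)))
      isCompact_univ (c := fun i => σ ⁻¹' U i) (fun i => (hU i).preimage σ.continuous)
      (fun t _ => Set.mem_iUnion.mpr (hcov (σ t)))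
    have hn' : (0 : ℝ) < (n : ℝ)⁻¹ := by positivity
    have hn1 : (n : ℝ)⁻¹ ≤ 1 := inv_le_one_of_one_le₀ (by exact_mod_cast hn)
    have ht := tendsto_pow_atTop_nhds_zero_of_lt_one (r := 1 - (n : ℝ)⁻¹) (by linarith)
      (by linarith)
    filter_upwards [ht.eventually (gt_mem_nhds hδ)] with N hN
    -- By naturality it suffices to subdivide the identity simplex until its mesh drops below a
    -- Lebesgue number of the pulled-back cover.
    have e : sdIter Y N n (Finsupp.single σ 1) = singMap σ n
        (sdIter _ N n (Finsupp.single (ContinuousMap.id (TopSimplex n) : (singSSet _).X n) 1)) := by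
      rw [singMap_sdIter, singMap_single]
      rfl
    rw [e]
    refine lmapDomain_mem_supported _ ?_ (sdIter_mem_affineMesh n N)
    rintro _ ⟨w, rfl, hw⟩
    obtain ⟨i, hi⟩ := hball (comb w (stdSimplex.vertex ⟨0, hn⟩)) (Set.mem_univ _)
    refine ⟨i, ?_⟩
    rintro _ ⟨t, rfl⟩
    exact hi ((dist_comb_vertex_le w (pow_nonneg (by linarith) _) hw _ _).trans_lt hN)
  induction x using Finsupp.induction_linear with
  | zero => exact Filter.Eventually.of_forall fun N => by simp
  | add f g hf hg =>
    filter_upwards [hf, hg] with N h1 h2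
    rw [map_add]
    exact Submodule.add_mem _ h1 h2
  | single σ c =>
    filter_upwards [single σ] with N h
    rw [show Finsupp.single σ c = c • Finsupp.single σ (1 : ℤ) by simp, map_smul]
    exact Submodule.smul_mem _ _ h

end Small

/-! ### The topology of geometric realizations -/

namespace GeomRealization

variable {V : Type u} {K : PreAbstractSimplicialComplex V}

/-- The barycentric coordinates of a point. -/
def coord (x : GeomRealization K) (v : V) : ℝ := x.1 v

theorem coord_nonneg (x : GeomRealization K) (v : V) : 0 ≤ x.coord v := x.2.1 v

theorem support_mem (x : GeomRealization K) : x.1.support ∈ K.faces := x.2.2.1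

theorem support_nonempty (x : GeomRealization K) : x.1.support.Nonempty :=
  (K.isRelLowerSet_faces x.support_mem).1

theorem sum_coord (x : GeomRealization K) : ∑ v ∈ x.1.support, x.coord v = 1 := x.2.2.2

theorem sum_coord_of_subset (x : GeomRealization K) {s : Finset V} (h : x.1.support ⊆ s) :
    ∑ v ∈ s, x.coord v = 1 := by
  rw [← x.sum_coord]
  exact (Finset.sum_subset h fun v _ hv => Finsupp.notMem_support_iff.mp hv).symm

theorem mem_support (x : GeomRealization K) (v : V) : v ∈ x.1.support ↔ 0 < x.coord v := by
  rw [Finsupp.mem_support_iff]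
  exact ⟨fun h => lt_of_le_of_ne (x.coord_nonneg v) h.symm, fun h => h.ne'⟩

theorem coord_eq_zero (x : GeomRealization K) {v : V} (h : v ∉ x.1.support) : x.coord v = 0 :=
  Finsupp.notMem_support_iff.mp h

theorem coord_le_one (x : GeomRealization K) (v : V) : x.coord v ≤ 1 := by
  classical
  rw [← x.sum_coord_of_subset (Finset.subset_insert v x.1.support)]
  exact Finset.single_le_sum (fun v _ => x.coord_nonneg v) (Finset.mem_insert_self _ _)

theorem ext_coord {x y : GeomRealization K} (h : ∀ v, x.coord v = y.coord v) : x = y :=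
  Subtype.ext (Finsupp.ext h)

open Classical in
/-- The point with given coordinates, supported on a face. -/
noncomputable def ofCoord (σ : Finset V) (hσ : σ ∈ K.faces) (c : V → ℝ)
    (h0 : ∀ v, 0 ≤ c v) (hs : ∀ v, c v ≠ 0 → v ∈ σ) (h1 : ∑ v ∈ σ, c v = 1) :
    GeomRealization K :=
  ⟨Finsupp.onFinset σ c hs, h0, by
    refine (K.isRelLowerSet_faces hσ).2 Finsupp.support_onFinset_subset ?_
    obtain ⟨v, hv, hv'⟩ := Finset.exists_ne_zero_of_sum_ne_zero (h1.trans_ne one_ne_zero)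
    exact ⟨v, Finsupp.mem_support_iff.mpr hv'⟩, by
    rw [Finsupp.onFinset_sum _ (fun _ => rfl), h1]⟩

@[simp]
theorem support_ofCoord_subset (σ : Finset V) (hσ : σ ∈ K.faces) (c : V → ℝ)
    (h0 : ∀ v, 0 ≤ c v) (hs : ∀ v, c v ≠ 0 → v ∈ σ) (h1 : ∑ v ∈ σ, c v = 1) :
    (ofCoord σ hσ c h0 hs h1).1.support ⊆ σ := by
  classical
  exact Finsupp.support_onFinset_subset (hf := hs)

theorem coord_ofFace_of_mem (σ : K.faces) (w : stdSimplex ℝ (σ : Finset V)) {v : V}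
    (h : v ∈ (σ : Finset V)) : (ofFace K σ w).coord v = w ⟨v, h⟩ :=
  dif_pos h

theorem coord_ofFace_of_notMem (σ : K.faces) (w : stdSimplex ℝ (σ : Finset V)) {v : V}
    (h : v ∉ (σ : Finset V)) : (ofFace K σ w).coord v = 0 :=
  dif_neg h

theorem support_ofFace_subset (σ : K.faces) (w : stdSimplex ℝ (σ : Finset V)) :
    (ofFace K σ w).1.support ⊆ (σ : Finset V) := fun v hv => by
  by_contra h
  rw [mem_support, coord_ofFace_of_notMem σ w h] at hv
  exact lt_irrefl _ hv

theorem continuous_ofFace (σ : K.faces) : Continuous (ofFace K σ) := by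
  rw [continuous_iff_coinduced_le]
  exact le_iSup (fun σ : K.faces => TopologicalSpace.coinduced (ofFace K σ) inferInstance) σ

theorem continuous_iff_ofFace {Z : Type v} [TopologicalSpace Z] {f : GeomRealization K → Z} :
    Continuous f ↔ ∀ σ, Continuous (f ∘ ofFace K σ) := by
  rw [continuous_iSup_dom]
  exact forall_congr' fun σ => continuous_coinduced_dom

theorem isOpen_iff_ofFace {s : Set (GeomRealization K)} :
    IsOpen s ↔ ∀ σ, IsOpen (ofFace K σ ⁻¹' s) := by
  rw [isOpen_iSup_iff]
  exact forall_congr' fun σ => isOpen_coinduced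

theorem exists_ofFace_eq (x : GeomRealization K) : ∃ (σ : K.faces) (w : _), ofFace K σ w = x := by
  refine ⟨⟨_, x.support_mem⟩, ⟨fun v => x.coord v, fun v => x.coord_nonneg v, ?_⟩,
    ext_coord fun v => ?_⟩
  · rw [Finset.sum_coe_sort x.1.support x.coord, sum_coord]
  · by_cases hv : v ∈ x.1.support
    · rw [coord_ofFace_of_mem _ _ hv]
      rfl
    · rw [coord_ofFace_of_notMem _ _ hv, coord_eq_zero _ hv]

/-- A product of a weak topology with another space need not be weak, but `unitInterval` is locally
compact: after currying, continuity into the space of paths can be tested on each closed simplex. -/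
theorem continuous_prod_of_ofFace {Z : Type v} [TopologicalSpace Z]
    {f : GeomRealization K × unitInterval → Z}
    (h : ∀ σ : K.faces, Continuous fun p : stdSimplex ℝ (σ : Finset V) × unitInterval =>
      f (ofFace K σ p.1, p.2)) : Continuous f := by
  have hx : ∀ x, Continuous fun t => f (x, t) := by
    intro x
    obtain ⟨σ, w, rfl⟩ := x.exists_ofFace_eq
    exact (h σ).comp (Continuous.prodMk continuous_const continuous_id)
  have : Continuous fun x => (⟨fun t => f (x, t), hx x⟩ : C(unitInterval, Z)) := by
    rw [continuous_iff_ofFace]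
    intro σ
    exact (ContinuousMap.curry ⟨_, h σ⟩).continuous
  exact ContinuousMap.continuous_uncurry_of_continuous ⟨_, this⟩

theorem continuous_coord_ofFace (σ : K.faces) (v : V) :
    Continuous fun w => (ofFace K σ w).coord v := by
  by_cases h : v ∈ (σ : Finset V)
  · simp only [coord_ofFace_of_mem σ _ h]
    exact (continuous_apply _).comp continuous_subtype_val
  · simp only [coord_ofFace_of_notMem σ _ h]
    exact continuous_const

theorem continuous_coord (v : V) : Continuous fun x : GeomRealization K => x.coord v :=
  continuous_iff_ofFace.mpr fun σ => continuous_coord_ofFace σ v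

/-- A map into a single closed simplex is continuous as soon as its coordinates are. -/
theorem continuous_of_support_subset {A : Type v} [TopologicalSpace A] (f : A → GeomRealization K)
    (σ : Finset V) (hσ : σ ∈ K.faces) (hf : ∀ a, (f a).1.support ⊆ σ)
    (hc : ∀ v ∈ σ, Continuous fun a => (f a).coord v) : Continuous f := by
  let g : A → stdSimplex ℝ σ := fun a => ⟨fun v : σ => (f a).coord v, fun v => (f a).coord_nonneg v, by
    rw [Finset.sum_coe_sort σ (f a).coord, sum_coord_of_subset _ (hf a)]⟩
  have hg : Continuous g := Continuous.subtype_mk (continuous_pi fun v : σ => hc v v.2) _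
  have : f = ofFace K ⟨σ, hσ⟩ ∘ g := by
    funext a
    refine ext_coord fun v => ?_
    by_cases hv : v ∈ σ
    · rw [Function.comp_apply, coord_ofFace_of_mem _ _ hv]
      rfl
    · rw [Function.comp_apply, coord_ofFace_of_notMem _ _ hv, coord_eq_zero]
      exact fun h => hv (hf a h)
  rw [this]
  exact (continuous_ofFace _).comp hg

end GeomRealization

/-! ### Acyclic carriers -/

namespace AugSSet

variable {A : AugSSet.{u}} {D : AugSSet.{v}}

open Classical in
/-- The chain homotopy constructed by the method of acyclic carriers. -/
noncomputable def carrierHomotopy (f g : ∀ n, A.Chain n →ₗ[ℤ] D.Chain n)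
    (Φ : ∀ n, A.X n → ∀ m, Submodule ℤ (D.Chain m)) : ∀ n, A.Chain n →ₗ[ℤ] D.Chain (n + 1)
  | 0 => 0
  | n + 1 => Finsupp.linearCombination ℤ fun b : A.X (n + 1) =>
    if h : ∃ y ∈ Φ (n + 1) b (n + 2), D.d (n + 1) y =
        f (n + 1) (Finsupp.single b 1) - g (n + 1) (Finsupp.single b 1) -
          carrierHomotopy f g Φ n (A.d n (Finsupp.single b 1))
    then h.choose else 0

/-- Two chain maps with the same acyclic carrier are chain homotopic. -/
theorem exists_homotopy_of_acyclic_carrier (P : ∀ n, Set (A.X n))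
    (hP : ∀ n, ∀ b ∈ P (n + 1), ∀ i, A.δ i b ∈ P n)
    (f g : ∀ n, A.Chain n →ₗ[ℤ] D.Chain n)
    (hf : ∀ n, ∀ b ∈ P (n + 1), D.d n (f (n + 1) (Finsupp.single b 1)) =
      f n (A.d n (Finsupp.single b 1)))
    (hg : ∀ n, ∀ b ∈ P (n + 1), D.d n (g (n + 1) (Finsupp.single b 1)) =
      g n (A.d n (Finsupp.single b 1)))
    (h0 : ∀ b ∈ P 0, f 0 (Finsupp.single b 1) = g 0 (Finsupp.single b 1))
    (Φ : ∀ n, A.X n → ∀ m, Submodule ℤ (D.Chain m))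
    (hΦ : ∀ n, ∀ b ∈ P (n + 1), ∀ i m, Φ n (A.δ i b) m ≤ Φ (n + 1) b m)
    (hfΦ : ∀ n, ∀ b ∈ P n, f n (Finsupp.single b 1) ∈ Φ n b n)
    (hgΦ : ∀ n, ∀ b ∈ P n, g n (Finsupp.single b 1) ∈ Φ n b n)
    (hac : ∀ n, ∀ b ∈ P (n + 1), ∀ x ∈ Φ (n + 1) b (n + 1), D.d n x = 0 →
      ∃ y ∈ Φ (n + 1) b (n + 2), D.d (n + 1) y = x) :
    ∃ h : ∀ n, A.Chain n →ₗ[ℤ] D.Chain (n + 1),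
      (∀ n, ∀ x ∈ Finsupp.supported ℤ ℤ (P (n + 1)), D.d (n + 1) (h (n + 1) x) =
        f (n + 1) x - g (n + 1) x - h n (A.d n x)) ∧
      ∀ n, ∀ b ∈ P n, h n (Finsupp.single b 1) ∈ Φ n b (n + 1) := by
  have hd : ∀ n, ∀ x ∈ Finsupp.supported ℤ ℤ (P (n + 1)),
      A.d n x ∈ Finsupp.supported ℤ ℤ (P n) := fun n x hx => d_mem_supported (hP n) hx
  let h := carrierHomotopy f g Φ
  -- The filling equation and membership in the carrier are proved together: membership in degree
  -- `n` is what makes the next cycle lie in its carrier, so that the choice in `carrierHomotopy`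
  -- never takes the default value on `P`.
  have key : ∀ n, (∀ b ∈ P n, h n (Finsupp.single b 1) ∈ Φ n b (n + 1)) ∧
      ∀ b ∈ P (n + 1), D.d (n + 1) (h (n + 1) (Finsupp.single b 1)) =
          f (n + 1) (Finsupp.single b 1) - g (n + 1) (Finsupp.single b 1) -
            h n (A.d n (Finsupp.single b 1)) ∧
        h (n + 1) (Finsupp.single b 1) ∈ Φ (n + 1) b (n + 2) := by
    intro n
    induction n with
    | zero =>
      refine ⟨fun b _ => Submodule.zero_mem _, fun b hb => ?_⟩
      have ex : ∃ y ∈ Φ 1 b 2, D.d 1 y = f 1 (Finsupp.single b 1) - g 1 (Finsupp.single b 1) -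
          h 0 (A.d 0 (Finsupp.single b 1)) := by
        refine hac 0 b hb _ (Submodule.sub_mem _ (Submodule.sub_mem _ (hfΦ _ b hb) (hgΦ _ b hb))
          (Submodule.zero_mem _)) ?_
        rw [map_sub, map_sub, hf 0 b hb, hg 0 b hb, map_eq_of_supported (f 0) (g 0) h0
          (hd 0 _ (Finsupp.single_mem_supported ℤ 1 hb)), sub_self, zero_sub, neg_eq_zero]
        exact map_zero _
      have e : h 1 (Finsupp.single b 1) = ex.choose := by
        change Finsupp.linearCombination ℤ _ _ = _
        rw [Finsupp.linearCombination_single, one_smul]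
        exact dif_pos ex
      exact ⟨(congrArg (D.d 1) e).trans ex.choose_spec.2,
        show h 1 _ ∈ Φ 1 b 2 by rw [e]; exact ex.choose_spec.1⟩
    | succ n ih =>
      refine ⟨fun b hb => (ih.2 b hb).2, fun b hb => ?_⟩
      have hdb := hd _ _ (Finsupp.single_mem_supported ℤ (1 : ℤ) hb)
      have ex : ∃ y ∈ Φ (n + 2) b (n + 3), D.d (n + 2) y =
          f (n + 2) (Finsupp.single b 1) - g (n + 2) (Finsupp.single b 1) -
          h (n + 1) (A.d (n + 1) (Finsupp.single b 1)) := by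
        refine hac (n + 1) b hb _ (Submodule.sub_mem _ (Submodule.sub_mem _ (hfΦ _ b hb)
          (hgΦ _ b hb)) ?_) ?_
        · rw [d_single, map_sum]
          refine Submodule.sum_mem _ fun i _ => ?_
          rw [map_smul]
          exact Submodule.smul_mem _ _ (hΦ _ b hb i _ (ih.2 _ (hP _ b hb i)).2)
        -- The chain to be filled is a cycle: the inductive formula for `d h` on the boundary of `b`
        -- cancels the contributions of `f` and `g`, leaving only `h d d`, which is zero.
        · have := map_eq_of_supported (D.d (n + 1) ∘ₗ h (n + 1))
            (f (n + 1) - g (n + 1) - h n ∘ₗ A.d n) (fun a ha => (ih.2 a ha).1) hdb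
          rw [LinearMap.comp_apply] at this
          rw [map_sub, map_sub, hf _ b hb, hg _ b hb, this]
          simp only [LinearMap.sub_apply, LinearMap.comp_apply, d_d, map_zero, sub_zero, sub_self]
      have e : h (n + 2) (Finsupp.single b 1) = ex.choose := by
        change Finsupp.linearCombination ℤ _ _ = _
        rw [Finsupp.linearCombination_single, one_smul]
        exact dif_pos ex
      exact ⟨by rw [e]; exact ex.choose_spec.2, by rw [e]; exact ex.choose_spec.1⟩
  refine ⟨h, fun n x hx => ?_, fun n => (key n).1⟩
  exact map_eq_of_supported (D.d (n + 1) ∘ₗ h (n + 1))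
    (f (n + 1) - g (n + 1) - h n ∘ₗ A.d n) (fun a ha => ((key n).2 a ha).1) hx

end AugSSet

/-! ### Strict chains in a poset -/

section Strict

variable {P : Type u} [PartialOrder P]

variable (P) in
/-- The augmented semi-simplicial set of strict chains of a poset. -/
abbrev strictSSet : AugSSet.{u} where
  X n := {s : Fin n → P // StrictMono s}
  δ i s := ⟨s.1 ∘ i.succAbove, s.2.comp (Fin.strictMono_succAbove i)⟩
  δ_δ h s := by
    apply Subtype.ext
    funext k
    simp only [Function.comp, succAbove_succAbove_comm h]

theorem strictMono_cons {m : P} {n : ℕ} {s : Fin n → P} (hs : StrictMono s) (h : ∀ i, m < s i) :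
    StrictMono (Fin.cons m s : Fin (n + 1) → P) := by
  intro i j hij
  induction i using Fin.cases with
  | zero =>
    induction j using Fin.cases with
    | zero => exact absurd hij (lt_irrefl _)
    | succ j => simpa using h j
  | succ i =>
    induction j using Fin.cases with
    | zero => exact absurd hij (Fin.not_lt_zero _)
    | succ j => simpa using hs (Fin.succ_lt_succ_iff.mp hij)

open Classical in
/-- The cone on chains of elements greater than or equal to `m`. -/
noncomputable def strictCone (m : P) (n : ℕ) :
    (strictSSet P).Chain n →ₗ[ℤ] (strictSSet P).Chain (n + 1) :=
  Finsupp.linearCombination ℤ fun s : (strictSSet P).X n =>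
    if h : ∀ i, m < s.1 i then
      Finsupp.single (⟨Fin.cons m s.1, strictMono_cons s.2 h⟩ : (strictSSet P).X (n + 1)) (1 : ℤ)
    else 0

theorem strictCone_of_lt {m : P} {n : ℕ} (s : (strictSSet P).X n) (h : ∀ i, m < s.1 i) :
    strictCone m n (Finsupp.single s 1) =
      Finsupp.single (⟨Fin.cons m s.1, strictMono_cons s.2 h⟩ : (strictSSet P).X (n + 1)) 1 := by
  rw [strictCone, Finsupp.linearCombination_single, one_smul, dif_pos h]

theorem strictCone_of_not_lt {m : P} {n : ℕ} (s : (strictSSet P).X n) (h : ¬ ∀ i, m < s.1 i) :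
    strictCone m n (Finsupp.single s 1) = 0 := by
  rw [strictCone, Finsupp.linearCombination_single, one_smul, dif_neg h]

/-- The strict chains with all elements in a given set. -/
def chainsIn (A : Set P) (n : ℕ) : Set ((strictSSet P).X n) := {s | ∀ i, s.1 i ∈ A}

theorem strictCone_mem {A : Set P} {m : P} (hm : m ∈ A) {n : ℕ} {x : (strictSSet P).Chain n}
    (hx : x ∈ Finsupp.supported ℤ ℤ (chainsIn A n)) :
    strictCone m n x ∈ Finsupp.supported ℤ ℤ (chainsIn A (n + 1)) := by
  refine map_mem_of_supported _ _ (fun s hs => ?_) hx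
  by_cases h : ∀ i, m < s.1 i
  · rw [strictCone_of_lt s h]
    refine Finsupp.single_mem_supported ℤ 1 fun i => ?_
    induction i using Fin.cases with
    | zero => exact hm
    | succ i => exact hs i
  · rw [strictCone_of_not_lt s h]
    exact Submodule.zero_mem _

theorem strict_cons_δ_zero {m : P} {n : ℕ} (s : (strictSSet P).X n) (h : ∀ i, m < s.1 i) :
    (strictSSet P).δ 0 (⟨Fin.cons m s.1, strictMono_cons s.2 h⟩ : (strictSSet P).X (n + 1)) =
      s := Subtype.ext (tuple_cons_δ_zero m s.1)

theorem d_strictCone_zero (m : P) (x : (strictSSet P).Chain 0) :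
    (strictSSet P).d 0 (strictCone m 0 x) = x := by
  refine map_eq_of_forall_single ((strictSSet P).d 0 ∘ₗ strictCone m 0) LinearMap.id
    (fun s => ?_) x
  rw [LinearMap.comp_apply, strictCone_of_lt s (fun i => i.elim0), AugSSet.d_single,
    Fin.sum_univ_succ, strict_cons_δ_zero s (fun i => i.elim0)]
  simp

/-- If the chain already starts at `m`, its cone is degenerate and is set to zero. The right side
vanishes as well: only removing `m` leaves a face with nonzero cone, and that cone is the chain
itself. -/
theorem d_strictCone {m : P} {n : ℕ} {x : (strictSSet P).Chain (n + 1)}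
    (hx : x ∈ Finsupp.supported ℤ ℤ (chainsIn (Set.Ici m) (n + 1))) :
    (strictSSet P).d (n + 1) (strictCone m (n + 1) x) =
      x - strictCone m n ((strictSSet P).d n x) := by
  refine map_eq_of_supported ((strictSSet P).d (n + 1) ∘ₗ strictCone m (n + 1))
    (LinearMap.id - strictCone m n ∘ₗ (strictSSet P).d n) (fun s hs => ?_) hx
  simp only [LinearMap.comp_apply, LinearMap.sub_apply, LinearMap.id_apply]
  rw [AugSSet.d_single, map_sum]
  by_cases h : ∀ i, m < s.1 i
  · rw [strictCone_of_lt s h, AugSSet.d_single, Fin.sum_univ_succ, strict_cons_δ_zero s h,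
      sub_eq_add_neg, ← Finset.sum_neg_distrib]
    congr 1
    · simp
    · refine Finset.sum_congr rfl fun i _ => ?_
      rw [map_smul, strictCone_of_lt ((strictSSet P).δ i s) (fun j => h _), ← neg_smul, Fin.val_succ, pow_succ,
        mul_neg_one]
      congr 2
      exact Subtype.ext (tuple_cons_δ_succ m i s.1)
  · have h0 : s.1 0 = m := by
      by_contra h0
      exact h fun i => (lt_of_le_of_ne (hs 0) (Ne.symm h0)).trans_le (s.2.monotone (Fin.zero_le i))
    rw [strictCone_of_not_lt s h, map_zero, Fin.sum_univ_succ, Finset.sum_eq_zero, add_zero,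
      eq_comm, sub_eq_zero]
    · have h1 : ∀ i : Fin n, m < ((strictSSet P).δ 0 s).1 i := fun i => by
        rw [← h0]
        exact s.2 (Fin.succ_pos i)
      rw [map_smul, strictCone_of_lt _ h1]
      simp only [Fin.val_zero, pow_zero, one_smul]
      congr 1
      apply Subtype.ext
      funext k
      induction k using Fin.cases with
      | zero => exact h0
      | succ k => rfl
    · intro i _
      rw [map_smul, strictCone_of_not_lt, smul_zero]
      intro h1
      have : NeZero n := ⟨by rintro rfl; exact i.elim0⟩
      have h2 := h1 0
      simp only [Function.comp_apply, Fin.succ_succAbove_zero, h0, lt_irrefl] at h2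

/-- Strict chains in a set with a least element form an acyclic complex. -/
theorem exists_d_eq_of_isLeast {A : Set P} {m : P} (hm : IsLeast A m) {n : ℕ}
    {x : (strictSSet P).Chain (n + 1)} (hx : x ∈ Finsupp.supported ℤ ℤ (chainsIn A (n + 1)))
    (hd : (strictSSet P).d n x = 0) :
    ∃ y ∈ Finsupp.supported ℤ ℤ (chainsIn A (n + 2)), (strictSSet P).d (n + 1) y = x :=
  ⟨strictCone m (n + 1) x, strictCone_mem hm.1 hx, by
    rw [d_strictCone (Finsupp.supported_mono (show chainsIn A (n + 1) ⊆ chainsIn (Set.Ici m) (n + 1) from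
      fun s hs i => hm.2 (hs i)) hx), hd, map_zero,
      sub_zero]⟩

/-! ### Affine simplices in the order complex -/

/-- The affine singular simplex of the order complex with given vertices. -/
noncomputable def affineSimplex {n : ℕ} (s : (strictSSet P).X n) :
    C(TopSimplex n, GeomRealization (posetOrderComplex P)) := by
  classical
  -- The unused point of the simplex excludes `n = 0`, where the image is empty and hence not a
  -- face.
  have hne : ∀ _ : TopSimplex n, (Finset.univ.image s.1) ∈ (posetOrderComplex P).faces := fun t => by
    refine ⟨?_, ?_⟩
    · rw [Finset.image_nonempty, Finset.nonempty_iff_ne_empty]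
      intro h0
      have := stdSimplex.sum_eq_one t
      rw [h0, Finset.sum_empty] at this
      exact zero_ne_one this
    · rw [Finset.coe_image, Finset.coe_univ, Set.image_univ]
      exact s.2.monotone.isChain_range
  let f : TopSimplex n → GeomRealization (posetOrderComplex P) := fun t =>
    GeomRealization.ofCoord (Finset.univ.image s.1) (hne t)
      (fun v => ∑ i, if s.1 i = v then t i else 0)
      (fun v => Finset.sum_nonneg fun i _ => by split_ifs <;> simp)
      (fun v hv => by
        obtain ⟨i, -, hi⟩ := Finset.exists_ne_zero_of_sum_ne_zero hv
        exact Finset.mem_image.mpr ⟨i, Finset.mem_univ _, by by_contra h; exact hi (if_neg h)⟩)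
      (by
        rw [Finset.sum_comm, ← stdSimplex.sum_eq_one t]
        exact Finset.sum_congr rfl fun i _ => by simp)
  refine ⟨f, ?_⟩
  rcases isEmpty_or_nonempty (TopSimplex n) with h | ⟨⟨t⟩⟩
  · exact continuous_of_const fun a => h.elim a
  · refine GeomRealization.continuous_of_support_subset f _ (hne t)
      (fun a => GeomRealization.support_ofCoord_subset _ _ _ _ _ _) fun v _ => ?_
    change Continuous fun a : TopSimplex n => ∑ i, if s.1 i = v then a i else 0
    refine continuous_finsetSum _ fun i _ => ?_
    split_ifs
    · exact (continuous_apply i).comp continuous_subtype_val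
    · exact continuous_const

open Classical in
theorem coord_affineSimplex {n : ℕ} (s : (strictSSet P).X n) (t : TopSimplex n) (v : P) :
    (affineSimplex s t).coord v = ∑ i, if s.1 i = v then t i else 0 := rfl

theorem support_affineSimplex_subset {n : ℕ} (s : (strictSSet P).X n) (t : TopSimplex n) :
    ((affineSimplex s t).1.support : Set P) ⊆ Set.range s.1 := by
  classical
  intro v hv
  rw [Finset.mem_coe, GeomRealization.mem_support, coord_affineSimplex] at hv
  obtain ⟨i, -, hi⟩ := Finset.exists_ne_zero_of_sum_ne_zero hv.ne'
  exact ⟨i, by by_contra h; exact hi (if_neg h)⟩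

theorem affineSimplex_δ {n : ℕ} (s : (strictSSet P).X (n + 1)) (i : Fin (n + 1)) :
    affineSimplex ((strictSSet P).δ i s) = (affineSimplex s).comp (topFace i) := by
  classical
  ext1 t
  refine GeomRealization.ext_coord fun v => ?_
  rw [ContinuousMap.comp_apply, coord_affineSimplex, coord_affineSimplex]
  have := sum_stdSimplex_map i.succAbove t (fun j => if s.1 j = v then 1 else 0)
  simp only [mul_ite, mul_one, mul_zero] at this
  exact this.symm

variable (P) in
/-- The map from chains of the poset to singular chains of the order complex. -/
noncomputable def affineMap (n : ℕ) : (strictSSet P).Chain n →ₗ[ℤ]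
    (singSSet (GeomRealization (posetOrderComplex P))).Chain n :=
  Finsupp.lmapDomain ℤ ℤ fun s : (strictSSet P).X n =>
    (affineSimplex s : (singSSet (GeomRealization (posetOrderComplex P))).X n)

theorem affineMap_single {n : ℕ} (s : (strictSSet P).X n) :
    affineMap P n (Finsupp.single s 1) =
      Finsupp.single (affineSimplex s :
        (singSSet (GeomRealization (posetOrderComplex P))).X n) 1 := by
  simp [affineMap]

theorem d_affineMap {n : ℕ} (x : (strictSSet P).Chain (n + 1)) :
    (singSSet _).d n (affineMap P (n + 1) x) = affineMap P n ((strictSSet P).d n x) :=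
  AugSSet.d_lmapDomain _ _ (fun i s => (affineSimplex_δ s i).symm) x

end Strict

/-! ### The cover of the order complex by open stars of barycenters -/

/-- The geometric realization of the order complex of a poset. -/
abbrev OrderRealization (P : Type u) [PartialOrder P] : Type u :=
  GeomRealization (posetOrderComplex P)

section Star

variable {P : Type u} [PartialOrder P]

open GeomRealization

/-- The points whose coordinates in `τ` are positive and larger than all the other coordinates. -/
def starSet (τ : Finset P) : Set (OrderRealization P) :=
  {x | τ.Nonempty ∧ ∀ v ∈ τ, 0 < x.coord v ∧ ∀ u ∉ τ, x.coord u < x.coord v}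

theorem isOpen_starSet (τ : Finset P) : IsOpen (starSet τ) := by
  classical
  rw [isOpen_iff_ofFace]
  intro σ
  by_cases hτ : τ.Nonempty
  -- On a closed simplex only the vertices of `σ` outside `τ` need comparison, since all others have
  -- coordinate zero; the conditions become finite in number.
  · have : ofFace _ σ ⁻¹' starSet τ = ⋂ v ∈ τ, {w | 0 < (ofFace _ σ w).coord v} ∩
        ⋂ u ∈ (σ : Finset P) \ τ, {w | (ofFace _ σ w).coord u < (ofFace _ σ w).coord v} := by
      ext w
      simp only [starSet, hτ, true_and, Set.mem_preimage, Set.mem_ofPred_eq, Set.mem_iInter,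
        Set.mem_inter_iff, Finset.mem_sdiff]
      refine forall₂_congr fun v hv => and_congr_right fun h0 => ⟨fun h u hu => h u hu.2,
        fun h u hu => ?_⟩
      by_cases hu' : u ∈ (σ : Finset P)
      · exact h u ⟨hu', hu⟩
      · rwa [coord_ofFace_of_notMem _ _ hu']
    rw [this]
    exact isOpen_biInter_finset fun v _ =>
      (isOpen_lt continuous_const (continuous_coord_ofFace σ v)).inter
        (isOpen_biInter_finset fun u _ =>
          isOpen_lt (continuous_coord_ofFace σ u) (continuous_coord_ofFace σ v))
  · have : ofFace _ σ ⁻¹' starSet τ = ∅ := by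
      ext w
      simp [starSet, hτ]
    rw [this]
    exact isOpen_empty

theorem exists_forall_coord_le (x : OrderRealization P) :
    ∃ v ∈ x.1.support, ∀ u, x.coord u ≤ x.coord v := by
  obtain ⟨v, hv, h⟩ := Finset.exists_max_image x.1.support x.coord x.support_nonempty
  refine ⟨v, hv, fun u => ?_⟩
  by_cases hu : u ∈ x.1.support
  · exact h u hu
  · rw [coord_eq_zero _ hu]
    exact x.coord_nonneg v

/-- The set of vertices at which the largest coordinate is attained serves as `τ`. -/
theorem exists_mem_starSet (x : OrderRealization P) : ∃ τ, x ∈ starSet τ := by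
  classical
  obtain ⟨v, hv, h⟩ := exists_forall_coord_le x
  refine ⟨x.1.support.filter fun u => x.coord u = x.coord v,
    ⟨v, Finset.mem_filter.mpr ⟨hv, rfl⟩⟩, fun u hu => ?_⟩
  rw [Finset.mem_filter] at hu
  refine ⟨(mem_support _ _).mp hu.1, fun u' hu' => ?_⟩
  rw [hu.2]
  refine lt_of_le_of_ne (h u') fun e => hu' (Finset.mem_filter.mpr ⟨?_, e⟩)
  rw [mem_support, e]
  exact (mem_support _ _).mp hv

/-- A vertex with the largest coordinate. -/
noncomputable def topVertex (x : OrderRealization P) : P := (exists_forall_coord_le x).choose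

theorem topVertex_mem_support (x : OrderRealization P) : topVertex x ∈ x.1.support :=
  (exists_forall_coord_le x).choose_spec.1

theorem topVertex_mem_of_mem_starSet {x : OrderRealization P} {τ : Finset P}
    (h : x ∈ starSet τ) : topVertex x ∈ τ := by
  by_contra h0
  obtain ⟨⟨v, hv⟩, h⟩ := h
  exact absurd ((exists_forall_coord_le x).choose_spec.2 v) (not_le.mpr ((h v hv).2 _ h0))

theorem subset_support_of_mem_starSet {x : OrderRealization P} {τ : Finset P}
    (h : x ∈ starSet τ) : τ ⊆ x.1.support := fun v hv => (mem_support _ _).mpr (h.2 v hv).1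

/-- The vertices closest to the images of the vertices of a singular simplex. -/
def vertexSet {n : ℕ} (σ : C(TopSimplex n, OrderRealization P)) : Set P :=
  Set.range fun i => topVertex (σ (stdSimplex.vertex i))

theorem vertexSet_δ_subset {n : ℕ} (σ : C(TopSimplex (n + 1), OrderRealization P))
    (i : Fin (n + 1)) : vertexSet (σ.comp (topFace i)) ⊆ vertexSet σ := by
  rintro _ ⟨k, rfl⟩
  refine ⟨i.succAbove k, ?_⟩
  simp [topFace]

/-- A small simplex lies in one `starSet τ`. Its dominant vertices belong to `τ`, and `τ` is
contained in the support of every point of the simplex. This makes the vertex set a chain of the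
poset and the carriers below contractible. -/
theorem vertexSet_subset_support {n : ℕ} {σ : C(TopSimplex n, OrderRealization P)}
    (hσ : σ ∈ simplicesSmall starSet n) (t : TopSimplex n) :
    vertexSet σ ⊆ (σ t).1.support := by
  obtain ⟨τ, hτ⟩ := hσ
  rintro _ ⟨i, rfl⟩
  exact subset_support_of_mem_starSet (hτ ⟨t, rfl⟩) (topVertex_mem_of_mem_starSet (hτ ⟨_, rfl⟩))

theorem exists_isLeast_vertexSet {n : ℕ} {σ : C(TopSimplex (n + 1), OrderRealization P)}
    (hσ : σ ∈ simplicesSmall starSet (n + 1)) : ∃ m, IsLeast (vertexSet σ) m := by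
  have hsub := vertexSet_subset_support hσ (stdSimplex.vertex 0)
  have hchain := (σ (stdSimplex.vertex 0)).support_mem.2
  obtain ⟨m, hm⟩ := (Set.finite_range _).exists_minimal (s := vertexSet σ) ⟨_, 0, rfl⟩
  refine ⟨m, hm.1, fun p hp => ?_⟩
  rcases hchain.total (hsub hm.1) (hsub hp) with h | h
  · exact h
  · exact hm.2 hp h

open Classical in
/-- The least element of the vertex set of a small simplex. -/
noncomputable def leastVertex {n : ℕ} (σ : C(TopSimplex (n + 1), OrderRealization P)) : P :=
  if h : ∃ m, IsLeast (vertexSet σ) m then h.choose else topVertex (σ (stdSimplex.vertex 0))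

theorem isLeast_leastVertex {n : ℕ} {σ : C(TopSimplex (n + 1), OrderRealization P)}
    (hσ : σ ∈ simplicesSmall starSet (n + 1)) : IsLeast (vertexSet σ) (leastVertex σ) := by
  have h := exists_isLeast_vertexSet hσ
  rw [leastVertex, dif_pos h]
  exact h.choose_spec

variable (P) in
/-- A simplicial approximation operator, a chain map on small singular chains. -/
noncomputable def approxMap : ∀ n, (singSSet (OrderRealization P)).Chain n →ₗ[ℤ]
    (strictSSet P).Chain n
  | 0 => Finsupp.lmapDomain ℤ ℤ fun _ =>
    (⟨Fin.elim0, fun i => i.elim0⟩ : (strictSSet P).X 0)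
  -- The map from vertices to dominant vertices need not preserve order, so it does not directly
  -- give a strict chain. Coning the approximated boundary from the least dominant vertex avoids any
  -- choice of ordering.
  | n + 1 => Finsupp.linearCombination ℤ fun σ : (singSSet (OrderRealization P)).X (n + 1) =>
    strictCone (leastVertex σ) n (approxMap n ((singSSet _).d n (Finsupp.single σ 1)))

theorem approxMap_single {n : ℕ} (σ : (singSSet (OrderRealization P)).X (n + 1)) :
    approxMap P (n + 1) (Finsupp.single σ 1) =
      strictCone (leastVertex σ) n (approxMap P n ((singSSet _).d n (Finsupp.single σ 1))) := by
  rw [approxMap, Finsupp.linearCombination_single, one_smul]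

theorem approxMap_single_mem {n : ℕ} {σ : (singSSet (OrderRealization P)).X n}
    (hσ : σ ∈ simplicesSmall starSet n) :
    approxMap P n (Finsupp.single σ 1) ∈ Finsupp.supported ℤ ℤ (chainsIn (vertexSet σ) n) := by
  induction n with
  | zero =>
    rw [approxMap, Finsupp.lmapDomain_apply, Finsupp.mapDomain_single]
    exact Finsupp.single_mem_supported ℤ 1 fun i => i.elim0
  | succ n ih =>
    rw [approxMap_single]
    refine strictCone_mem (isLeast_leastVertex hσ).1 ?_
    rw [AugSSet.d_single, map_sum]
    refine Submodule.sum_mem _ fun i _ => ?_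
    rw [map_smul]
    refine Submodule.smul_mem _ _ ?_
    exact Finsupp.supported_mono (show chainsIn (vertexSet ((singSSet _).δ i σ)) n ⊆
      chainsIn (vertexSet σ) n from fun s hs j => vertexSet_δ_subset σ i (hs j))
      (ih (isSieve_simplicesSmall _ σ hσ (topFace i)))

/-- The approximations of the faces use only elements above the least vertex, so the cone formula
applies; its correction term is the cone on the approximation of `d d σ`, which is zero. -/
theorem d_approxMap {n : ℕ} {x : (singSSet (OrderRealization P)).Chain (n + 1)}
    (hx : x ∈ Finsupp.supported ℤ ℤ (simplicesSmall starSet (n + 1))) :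
    (strictSSet P).d n (approxMap P (n + 1) x) = approxMap P n ((singSSet _).d n x) := by
  induction n with
  | zero =>
    refine map_eq_of_supported ((strictSSet P).d 0 ∘ₗ approxMap P 1)
      (approxMap P 0 ∘ₗ (singSSet _).d 0) (fun σ hσ => ?_) hx
    rw [LinearMap.comp_apply, LinearMap.comp_apply, approxMap_single, d_strictCone_zero]
  | succ n ih =>
    refine map_eq_of_supported ((strictSSet P).d (n + 1) ∘ₗ approxMap P (n + 2))
      (approxMap P (n + 1) ∘ₗ (singSSet _).d (n + 1)) (fun σ hσ => ?_) hx
    have hσ' : (singSSet (OrderRealization P)).d (n + 1) (Finsupp.single σ 1) ∈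
        Finsupp.supported ℤ ℤ (simplicesSmall starSet (n + 1)) :=
      (isSieve_simplicesSmall _).d_mem (Finsupp.single_mem_supported ℤ 1 hσ)
    rw [LinearMap.comp_apply, LinearMap.comp_apply, approxMap_single, d_strictCone, ih hσ',
      AugSSet.d_d, map_zero, map_zero, sub_zero]
    rw [AugSSet.d_single, map_sum]
    refine Submodule.sum_mem _ fun i _ => ?_
    rw [map_smul]
    refine Submodule.smul_mem _ _ ?_
    exact Finsupp.supported_mono (show chainsIn (vertexSet ((singSSet _).δ i σ)) (n + 1) ⊆
      chainsIn (Set.Ici (leastVertex σ)) (n + 1) from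
        fun s hs j => (isLeast_leastVertex hσ).2 (vertexSet_δ_subset σ i (hs j)))
      (approxMap_single_mem (isSieve_simplicesSmall _ σ hσ (topFace i)))

/-! ### Contraction of closed stars -/

open Classical in
/-- Send the elements that are not comparable to `a` to `a`. -/
noncomputable def collapseVertex (a v : P) : P := if v ≤ a ∨ a ≤ v then v else a

theorem collapseVertex_comparable (a v : P) : collapseVertex a v ≤ a ∨ a ≤ collapseVertex a v := by
  unfold collapseVertex
  split_ifs with h
  · exact h
  · exact Or.inl le_rfl

-- Two elements comparable to `a` are left alone and stay comparable to each other; any other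
-- element becomes `a`. Thus collapsing respects chains, which makes the contraction a map on the
-- whole realization instead of only on the closed star of `a`.
open Classical in
theorem insert_image_collapseVertex_mem (a : P) {σ : Finset P}
    (hσ : σ ∈ (posetOrderComplex P).faces) :
    insert a (σ.image (collapseVertex a)) ∈ (posetOrderComplex P).faces := by
  refine ⟨Finset.insert_nonempty _ _, ?_⟩
  rw [Finset.coe_insert, Finset.coe_image]
  refine IsChain.insert ?_ ?_
  · rintro _ ⟨v, hv, rfl⟩ _ ⟨w, hw, rfl⟩ hne
    unfold collapseVertex at hne ⊢
    split_ifs at hne ⊢ with h1 h2 h2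
    · exact hσ.2 hv hw (by simpa using hne)
    · exact h1
    · exact h2.symm
    · exact absurd rfl hne
  · rintro _ ⟨v, hv, rfl⟩ _
    exact (collapseVertex_comparable a v).symm

open Classical in
/-- The coordinates of the contraction to the vertex `a`. -/
noncomputable def contractCoord (a : P) (x : OrderRealization P) (t : unitInterval) (v : P) : ℝ :=
  (1 - (t : ℝ)) * (∑ u ∈ x.1.support, if collapseVertex a u = v then x.coord u else 0) +
    (t : ℝ) * if a = v then 1 else 0

open Classical in
theorem contractCoord_eq_of_subset (a : P) (x : OrderRealization P) (t : unitInterval) (v : P)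
    {σ : Finset P} (h : x.1.support ⊆ σ) : contractCoord a x t v =
      (1 - (t : ℝ)) * (∑ u ∈ σ, if collapseVertex a u = v then x.coord u else 0) +
        (t : ℝ) * if a = v then 1 else 0 := by
  rw [contractCoord]
  congr 2
  refine Finset.sum_subset h fun u _ hu => ?_
  rw [coord_eq_zero x hu, ite_self]

open Classical in
/-- The contraction to the vertex `a`, after collapsing to the closed star of `a`. -/
noncomputable def contractFun (a : P) (p : OrderRealization P × unitInterval) :
    OrderRealization P :=
  ofCoord _ (insert_image_collapseVertex_mem a p.1.support_mem) (contractCoord a p.1 p.2)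
    (fun v => add_nonneg
      (mul_nonneg (sub_nonneg.mpr p.2.2.2) (Finset.sum_nonneg fun u _ => by
        split_ifs
        · exact p.1.coord_nonneg u
        · exact le_rfl))
      (mul_nonneg p.2.2.1 (by split_ifs <;> simp)))
    (fun v hv => by
      by_contra h
      rw [Finset.mem_insert, Finset.mem_image, not_or, not_exists] at h
      refine hv ?_
      rw [contractCoord, if_neg (fun e => h.1 e.symm), mul_zero, add_zero, Finset.sum_eq_zero,
        mul_zero]
      exact fun u hu => if_neg fun e => h.2 u ⟨hu, e⟩)
    (by
      simp only [contractCoord]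
      rw [Finset.sum_add_distrib, ← Finset.mul_sum, ← Finset.mul_sum, Finset.sum_comm]
      have h1 : ∀ u ∈ p.1.1.support, (∑ v ∈ insert a (p.1.1.support.image (collapseVertex a)),
          if collapseVertex a u = v then p.1.coord u else 0) = p.1.coord u := fun u hu => by
        rw [Finset.sum_ite_eq, if_pos]
        exact Finset.mem_insert_of_mem (Finset.mem_image_of_mem _ hu)
      rw [Finset.sum_congr rfl h1, sum_coord, Finset.sum_ite_eq,
        if_pos (Finset.mem_insert_self _ _)]
      ring)

/-- The contraction to the vertex `a`, after collapsing to the closed star of `a`. -/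
noncomputable def contract (a : P) : C(OrderRealization P × unitInterval, OrderRealization P) :=
  ⟨contractFun a, by
    classical
    refine continuous_prod_of_ofFace fun σ => ?_
    refine continuous_of_support_subset _ _ (insert_image_collapseVertex_mem a σ.2) (fun p => ?_)
      fun v _ => ?_
    · refine (support_ofCoord_subset _ _ _ _ _ _).trans ?_
      exact Finset.insert_subset_insert _ (Finset.image_subset_image (support_ofFace_subset σ p.1))
    · change Continuous fun p : stdSimplex ℝ ((σ : Finset P)) × unitInterval =>
        contractCoord a (ofFace _ σ p.1) p.2 v
      simp only [fun p : stdSimplex ℝ ((σ : Finset P)) × unitInterval =>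
        contractCoord_eq_of_subset a (ofFace _ σ p.1) p.2 v (support_ofFace_subset σ p.1)]
      refine Continuous.add (Continuous.mul (by fun_prop) (continuous_finsetSum _ fun u _ => ?_))
        (Continuous.mul (by fun_prop) continuous_const)
      split_ifs
      · exact (continuous_coord_ofFace σ u).comp continuous_fst
      · exact continuous_const⟩

open Classical in
theorem coord_contract (a : P) (x : OrderRealization P) (t : unitInterval) (v : P) :
    (contract a (x, t)).coord v =
      (1 - (t : ℝ)) * (∑ u ∈ x.1.support, if collapseVertex a u = v then x.coord u else 0) +
        (t : ℝ) * if a = v then 1 else 0 := rfl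

theorem contract_one (a : P) (x y : OrderRealization P) : contract a (x, 1) = contract a (y, 1) := by
  refine ext_coord fun v => ?_
  simp [coord_contract]

theorem collapseVertex_of_mem {a v : P} {σ : Finset P} (hσ : σ ∈ (posetOrderComplex P).faces)
    (ha : a ∈ σ) (hv : v ∈ σ) : collapseVertex a v = v :=
  if_pos (hσ.2.total hv ha)

/-- The support of `y` is a face containing both `a` and the support of `x`, so the collapse is the
identity on the support of `x`. -/
theorem contract_zero (a : P) {x y : OrderRealization P} (h : x.1.support ⊆ y.1.support)
    (ha : a ∈ y.1.support) : contract a (x, 0) = x := by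
  classical
  refine ext_coord fun v => ?_
  rw [coord_contract]
  have : ∀ u ∈ x.1.support, (if collapseVertex a u = v then x.coord u else 0) =
      if u = v then x.coord u else 0 := fun u hu => by
    rw [collapseVertex_of_mem y.support_mem ha (h hu)]
  rw [Finset.sum_congr rfl this, Finset.sum_ite_eq']
  split_ifs with hv
  · simp
  · simp
  · simp [coord_eq_zero x hv]
  · simp [coord_eq_zero x hv]

theorem support_contract_subset (a : P) {x y : OrderRealization P}
    (h : x.1.support ⊆ y.1.support) (ha : a ∈ y.1.support) (t : unitInterval) :
    (contract a (x, t)).1.support ⊆ y.1.support := by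
  classical
  have hs : (contract a (x, t)).1.support ⊆ insert a (x.1.support.image (collapseVertex a)) := by
    change (contractFun a (x, t)).1.support ⊆ _
    unfold contractFun
    exact support_ofCoord_subset _ _ _ _ _ _
  refine hs.trans ?_
  refine Finset.insert_subset ha fun v hv => ?_
  obtain ⟨u, hu, rfl⟩ := Finset.mem_image.mp hv
  rw [collapseVertex_of_mem y.support_mem ha (h hu)]
  exact h hu

end Star

/-! ### Singular chains of contractible subspaces -/

section Contraction

variable {Y : Type u} [TopologicalSpace Y]

/-- The constant singular simplex. -/
def constSimplex (p : Y) (n : ℕ) : (singSSet Y).X n := ContinuousMap.const _ p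

theorem d_constSimplex (p : Y) (n : ℕ) (c : ℤ) :
    (singSSet Y).d n (Finsupp.single (constSimplex p (n + 1)) c) =
      if Even (n + 1) then 0 else Finsupp.single (constSimplex p n) c := by
  rw [AugSSet.d_single]
  have : ∀ i : Fin (n + 1), (singSSet Y).δ i (constSimplex p (n + 1)) = constSimplex p n :=
    fun i => rfl
  rw [Finset.sum_congr rfl fun i _ => by rw [this i], ← Finset.sum_smul, Fin.sum_neg_one_pow]
  split_ifs <;> simp

/-- On constant simplices the boundary is alternately zero and the identity. The empty simplex makes
this pattern exact in the lowest degree too. -/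
theorem exists_d_eq_of_constSimplex (p : Y) (n : ℕ) (c : ℤ)
    (h : (singSSet Y).d n (Finsupp.single (constSimplex p (n + 1)) c) = 0) :
    ∃ e : ℤ, (singSSet Y).d (n + 1) (Finsupp.single (constSimplex p (n + 2)) e) =
      Finsupp.single (constSimplex p (n + 1)) c := by
  rw [d_constSimplex] at h
  split_ifs at h with hn
  · refine ⟨c, ?_⟩
    rw [d_constSimplex, if_neg (by rw [Nat.even_add_one]; exact not_not.mpr hn)]
  · refine ⟨0, ?_⟩
    rw [Finsupp.single_eq_zero.mp h]
    simp

/-- A subspace with a contraction (defined on a larger space) is acyclic. -/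
theorem exists_d_eq_of_contraction {A : Set Y} {H : C(Y × unitInterval, Y)} {p : Y}
    (hne : A.Nonempty) (h1 : ∀ y, H (y, 1) = p) (h0 : ∀ y ∈ A, H (y, 0) = y)
    (hA : ∀ y ∈ A, ∀ t, H (y, t) ∈ A) {n : ℕ} {z : (singSSet Y).Chain (n + 1)}
    (hz : z ∈ Finsupp.supported ℤ ℤ (simplicesIn A (n + 1))) (hd : (singSSet Y).d n z = 0) :
    ∃ y ∈ Finsupp.supported ℤ ℤ (simplicesIn A (n + 2)), (singSSet Y).d (n + 1) y = z := by
  have hp : p ∈ A := by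
    obtain ⟨a, ha⟩ := hne
    rw [← h1 a]
    exact hA a ha 1
  -- At time 0 the homotopy need only fix `A` pointwise; chains in `A` do not see its other values.
  let g : C(Y, Y) := H.comp ((ContinuousMap.id Y).prodMk (ContinuousMap.const _ 0))
  obtain ⟨h, h2, h3⟩ := exists_singMap_homotopy H (ContinuousMap.const Y p) g h1 fun y => rfl
  have e1 : singMap g (n + 1) z = z := by
    refine map_eq_of_supported (singMap g (n + 1)) LinearMap.id (fun σ hσ => ?_) hz
    rw [singMap_single]
    change _ = Finsupp.single _ _
    congr 1
    ext1 t
    exact h0 _ (hσ ⟨t, rfl⟩)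
  have h4 := h2 n z
  rw [hd, map_zero, sub_zero, e1] at h4
  obtain ⟨c, hc⟩ : ∃ c, singMap (ContinuousMap.const Y p) (n + 1) z =
      Finsupp.single (constSimplex p (n + 1)) c := by
    have : singMap (ContinuousMap.const Y p) (n + 1) z ∈
        Finsupp.supported ℤ ℤ {constSimplex p (n + 1)} := by
      refine map_mem_of_supported (s := Set.univ) _ _ (fun σ _ => ?_) (by simp)
      rw [singMap_single]
      exact Finsupp.single_mem_supported ℤ 1 (Set.mem_singleton _)
    exact Finsupp.support_subset_singleton'.mp fun σ hσ => Finset.mem_singleton.mpr (this hσ)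
  have hcd : (singSSet Y).d n (Finsupp.single (constSimplex p (n + 1)) c) = 0 := by
    rw [← hc, d_singMap, hd, map_zero]
  obtain ⟨e, he⟩ := exists_d_eq_of_constSimplex p n c hcd
  -- The homotopy gives `d (h z)` as the constant chain minus `z`; filling the constant chain and
  -- subtracting `h z` therefore fills `z`.
  refine ⟨Finsupp.single (constSimplex p (n + 2)) e - h (n + 1) z, Submodule.sub_mem _ ?_ ?_, ?_⟩
  · refine Finsupp.single_mem_supported ℤ _ ?_
    rintro _ ⟨t, rfl⟩
    exact hp
  · refine h3 (n + 1) (simplicesIn A (n + 1)) _ (fun σ hσ θ => ?_) z hz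
    rintro _ ⟨t, rfl⟩
    exact hA _ (hσ ⟨_, rfl⟩) _
  · rw [map_sub, he, h4, ← hc]
    abel

end Contraction

/-! ### Simplicial and singular chains of an order complex -/

section Comparison

variable {P : Type u} [PartialOrder P]

open GeomRealization

theorem mem_subcomplexSet_of_subset {L : PreAbstractSimplicialComplex P} {x y : OrderRealization P}
    (h : x.1.support ⊆ y.1.support) (hy : y ∈ subcomplexSet _ L) : x ∈ subcomplexSet _ L :=
  (L.isRelLowerSet_faces hy).2 h x.support_nonempty

/-- The points whose support is contained in the support of a point of the simplex `σ`. -/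
def closedCarrier {n : ℕ} (σ : C(TopSimplex n, OrderRealization P)) : Set (OrderRealization P) :=
  {x | ∃ t, x.1.support ⊆ (σ t).1.support}

theorem closedCarrier_comp_subset {n m : ℕ} (σ : C(TopSimplex n, OrderRealization P))
    (θ : C(TopSimplex m, TopSimplex n)) : closedCarrier (σ.comp θ) ⊆ closedCarrier σ :=
  fun _ ⟨t, ht⟩ => ⟨θ t, ht⟩

theorem closedCarrier_subset {n : ℕ} {σ : C(TopSimplex n, OrderRealization P)}
    {L : PreAbstractSimplicialComplex P} (hσ : σ ∈ simplicesIn (subcomplexSet _ L) n) :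
    closedCarrier σ ⊆ subcomplexSet _ L :=
  fun _ ⟨t, ht⟩ => mem_subcomplexSet_of_subset ht (hσ ⟨t, rfl⟩)

/-- One dominant vertex lies in the support of every point of a small simplex. Hence the carrier, a
union of closed simplices all containing that vertex, contracts to it. -/
theorem exists_d_eq_of_closedCarrier {n : ℕ} {σ : C(TopSimplex (n + 1), OrderRealization P)}
    (hσ : σ ∈ simplicesSmall starSet (n + 1)) {m : ℕ}
    {z : (singSSet (OrderRealization P)).Chain (m + 1)}
    (hz : z ∈ Finsupp.supported ℤ ℤ (simplicesIn (closedCarrier σ) (m + 1)))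
    (hd : (singSSet _).d m z = 0) :
    ∃ y ∈ Finsupp.supported ℤ ℤ (simplicesIn (closedCarrier σ) (m + 2)),
      (singSSet _).d (m + 1) y = z := by
  have ha : ∀ t, topVertex (σ (stdSimplex.vertex 0)) ∈ (σ t).1.support := fun t =>
    vertexSet_subset_support hσ t ⟨0, rfl⟩
  refine exists_d_eq_of_contraction (A := closedCarrier σ) (H := contract (topVertex (σ (stdSimplex.vertex 0))))
    (p := contract (topVertex (σ (stdSimplex.vertex 0))) (σ (stdSimplex.vertex 0), 1))
    ⟨σ (stdSimplex.vertex 0), _, Finset.Subset.rfl⟩ (fun y => contract_one _ _ _)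
    (fun y hy => ?_) (fun y hy s => ?_) hz hd
  · obtain ⟨t, ht⟩ := hy
    exact contract_zero _ ht (ha t)
  · obtain ⟨t, ht⟩ := hy
    exact ⟨t, support_contract_subset _ ht (ha t) s⟩

/-- The strict chains whose affine simplices lie in a subcomplex. -/
def chainsOf (L : PreAbstractSimplicialComplex P) (n : ℕ) : Set ((strictSSet P).X n) :=
  {s | affineSimplex s ∈ simplicesIn (subcomplexSet _ L) n}

theorem coord_affineSimplex_apply {n : ℕ} (s : (strictSSet P).X n) (t : TopSimplex n) (i : Fin n) :
    (affineSimplex s t).coord (s.1 i) = t i := by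
  classical
  rw [coord_affineSimplex]
  simp [s.2.injective.eq_iff]

theorem support_affineSimplex_barycenter {n : ℕ} (s : (strictSSet P).X (n + 1)) :
    ((affineSimplex s stdSimplex.barycenter).1.support : Set P) = Set.range s.1 := by
  refine (support_affineSimplex_subset s _).antisymm ?_
  rintro _ ⟨i, rfl⟩
  rw [Finset.mem_coe, mem_support, coord_affineSimplex_apply]
  refine lt_of_lt_of_eq ?_ (stdSimplex.barycenter_apply i).symm
  positivity

theorem mem_chainsOf_of_subset {L : PreAbstractSimplicialComplex P} {n : ℕ}
    {s : (strictSSet P).X n} {y : OrderRealization P} (hy : y ∈ subcomplexSet _ L)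
    (h : Set.range s.1 ⊆ y.1.support) : s ∈ chainsOf L n := by
  rintro _ ⟨t, rfl⟩
  refine mem_subcomplexSet_of_subset (y := y) ?_ hy
  exact Finset.coe_subset.mp ((support_affineSimplex_subset s t).trans h)

/-- The barycenter has the full vertex set as support, so it lies in a subcomplex only if the whole
simplex does. -/
theorem mem_chainsOf_iff {L : PreAbstractSimplicialComplex P} {n : ℕ}
    {s : (strictSSet P).X (n + 1)} :
    s ∈ chainsOf L (n + 1) ↔ affineSimplex s stdSimplex.barycenter ∈ subcomplexSet _ L :=
  ⟨fun h => h ⟨_, rfl⟩, fun h =>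
    mem_chainsOf_of_subset h (support_affineSimplex_barycenter s).ge⟩

theorem chainsOf_δ {L : PreAbstractSimplicialComplex P} {n : ℕ} {s : (strictSSet P).X (n + 1)}
    (hs : s ∈ chainsOf L (n + 1)) (i : Fin (n + 1)) : (strictSSet P).δ i s ∈ chainsOf L n := by
  rw [chainsOf, Set.mem_ofPred_eq, affineSimplex_δ]
  exact isSieve_simplicesIn _ _ hs _

theorem chainsIn_subset_chainsOf {L : PreAbstractSimplicialComplex P} {n m : ℕ}
    {s : (strictSSet P).X n} (hs : s ∈ chainsOf L n) :
    chainsIn (Set.range s.1) (m + 1) ⊆ chainsOf L (m + 1) := by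
  intro r hr
  cases n with
  | zero =>
    obtain ⟨i, -⟩ := hr 0
    exact i.elim0
  | succ n =>
    refine mem_chainsOf_of_subset (mem_chainsOf_iff.mp hs) ?_
    rw [support_affineSimplex_barycenter]
    rintro _ ⟨i, rfl⟩
    exact hr i

theorem affineMap_mem {L : PreAbstractSimplicialComplex P} {n : ℕ} {x : (strictSSet P).Chain n}
    (hx : x ∈ Finsupp.supported ℤ ℤ (chainsOf L n)) :
    affineMap P n x ∈ Finsupp.supported ℤ ℤ (simplicesIn (subcomplexSet _ L) n) :=
  lmapDomain_mem_supported (s := chainsOf L n) (t := simplicesIn (subcomplexSet _ L) n)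
    (fun s : (strictSSet P).X n => affineSimplex s) (fun _ hs => hs) hx

theorem approxMap_mem {L : PreAbstractSimplicialComplex P} {n : ℕ}
    {x : (singSSet (OrderRealization P)).Chain n}
    (hx : x ∈ Finsupp.supported ℤ ℤ
      (simplicesSmall starSet n ∩ simplicesIn (subcomplexSet _ L) n)) :
    approxMap P n x ∈ Finsupp.supported ℤ ℤ (chainsOf L n) := by
  refine map_mem_of_supported _ _ (fun σ hσ => ?_) hx
  refine Finsupp.supported_mono ?_ (approxMap_single_mem hσ.1)
  intro s hs
  cases n with
  | zero => exact mem_simplicesIn_zero _ _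
  | succ n =>
    refine mem_chainsOf_of_subset (hσ.2 ⟨stdSimplex.vertex 0, rfl⟩) ?_
    rintro _ ⟨i, rfl⟩
    exact vertexSet_subset_support hσ.1 _ (hs i)

theorem affineMap_mem_simplicesIn {A : Set P} {n : ℕ} {x : (strictSSet P).Chain n}
    (hx : x ∈ Finsupp.supported ℤ ℤ (chainsIn A n)) :
    affineMap P n x ∈ Finsupp.supported ℤ ℤ
      (simplicesIn {y : OrderRealization P | (y.1.support : Set P) ⊆ A} n) :=
  lmapDomain_mem_supported _ (fun s hs => by
    rintro _ ⟨t, rfl⟩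
    refine (support_affineSimplex_subset s t).trans ?_
    rintro _ ⟨i, rfl⟩
    exact hs i) hx

variable (P) in
/-- Simplicial approximation is homotopic to the identity on small singular chains. -/
theorem exists_affineMap_approxMap_homotopy :
    ∃ h : ∀ n, (singSSet (OrderRealization P)).Chain n →ₗ[ℤ]
        (singSSet (OrderRealization P)).Chain (n + 1),
      (∀ n, ∀ x ∈ Finsupp.supported ℤ ℤ (simplicesSmall starSet (n + 1)),
        (singSSet _).d (n + 1) (h (n + 1) x) =
          affineMap P (n + 1) (approxMap P (n + 1) x) - x - h n ((singSSet _).d n x)) ∧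
      ∀ L : PreAbstractSimplicialComplex P, ∀ n, ∀ x ∈ Finsupp.supported ℤ ℤ
        (simplicesSmall starSet n ∩ simplicesIn (subcomplexSet _ L) n),
        h n x ∈ Finsupp.supported ℤ ℤ (simplicesIn (subcomplexSet _ L) (n + 1)) := by
  obtain ⟨h, h1, h2⟩ := AugSSet.exists_homotopy_of_acyclic_carrier
    (A := singSSet (OrderRealization P)) (D := singSSet (OrderRealization P))
    (simplicesSmall starSet)
    (fun n b hb i => isSieve_simplicesSmall _ b hb (topFace i))
    (fun n => affineMap P n ∘ₗ approxMap P n) (fun n => LinearMap.id)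
    (fun n σ hσ => by
      rw [LinearMap.comp_apply, d_affineMap, d_approxMap (Finsupp.single_mem_supported ℤ 1 hσ)]
      rfl)
    (fun n σ hσ => rfl)
    (fun σ hσ => by
      have : Subsingleton ((singSSet (OrderRealization P)).X 0) := ⟨fun a b => by
        ext1 t
        have := stdSimplex.sum_eq_one t
        simp at this⟩
      rw [LinearMap.comp_apply, approxMap, Finsupp.lmapDomain_apply, Finsupp.mapDomain_single,
        affineMap_single]
      change _ = Finsupp.single _ _
      congr 1
      exact Subsingleton.elim _ _)
    -- This carrier contains `σ` and all affine simplices on its dominant vertices, and it stays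
    -- inside every subcomplex that contains `σ`, so one homotopy works for all `L`.
    (fun n σ m => Finsupp.supported ℤ ℤ (simplicesIn (closedCarrier σ) m))
    (fun n σ hσ i m => Finsupp.supported_mono (simplicesIn_mono (closedCarrier_comp_subset _ _) m))
    (fun n σ hσ => by
      refine Finsupp.supported_mono ?_ (affineMap_mem_simplicesIn (approxMap_single_mem hσ))
      cases n with
      | zero => exact fun τ _ => mem_simplicesIn_zero _ τ
      | succ n =>
        refine simplicesIn_mono (fun y hy => ?_) _
        exact ⟨stdSimplex.vertex 0, Finset.coe_subset.mp
          (Set.Subset.trans hy (vertexSet_subset_support hσ _))⟩)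
    (fun n σ hσ => by
      refine Finsupp.single_mem_supported ℤ 1 ?_
      rintro _ ⟨t, rfl⟩
      exact ⟨t, Finset.Subset.rfl⟩)
    (fun n σ hσ x hx hd => exists_d_eq_of_closedCarrier hσ hx hd)
  refine ⟨h, h1, fun L n x hx => map_mem_of_supported _ _ (fun σ hσ => ?_) hx⟩
  exact Finsupp.supported_mono (simplicesIn_mono (closedCarrier_subset hσ.2) _) (h2 n σ hσ.1)

theorem mem_supported_inter {α : Type*} {s t : Set α} {x : α →₀ ℤ}
    (hs : x ∈ Finsupp.supported ℤ ℤ s) (ht : x ∈ Finsupp.supported ℤ ℤ t) :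
    x ∈ Finsupp.supported ℤ ℤ (s ∩ t) := Set.subset_inter hs ht

/-- Every relative singular cycle is homologous to a chain of affine simplices. -/
theorem exists_affineMap_add_eq (L : PreAbstractSimplicialComplex P) {n : ℕ}
    (z : (singSSet (OrderRealization P)).Chain (n + 1))
    (hz : (singSSet _).d n z ∈ Finsupp.supported ℤ ℤ (simplicesIn (subcomplexSet _ L) n)) :
    ∃ c : (strictSSet P).Chain (n + 1), (strictSSet P).d n c ∈ Finsupp.supported ℤ ℤ (chainsOf L n) ∧
      ∃ y, z - affineMap P (n + 1) c - (singSSet _).d (n + 1) y ∈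
        Finsupp.supported ℤ ℤ (simplicesIn (subcomplexSet _ L) (n + 1)) := by
  have hcov := @exists_mem_starSet P _
  obtain ⟨N, hN⟩ := (eventually_sdIter_mem_simplicesSmall starSet isOpen_starSet hcov z).exists
  obtain ⟨T, hT1, hT2⟩ := exists_sdIter_homotopy (OrderRealization P) N
  obtain ⟨h, h1, h2⟩ := exists_affineMap_approxMap_homotopy P
  have hd : (singSSet _).d n (sdIter _ N (n + 1) z) ∈ Finsupp.supported ℤ ℤ
      (simplicesSmall starSet n ∩ simplicesIn (subcomplexSet _ L) n) :=
    mem_supported_inter ((isSieve_simplicesSmall _).d_mem hN) (by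
      rw [d_sdIter]
      exact sdIter_mem (isSieve_simplicesIn _) N hz)
  -- The two homotopies connect `z` to its subdivision and the subdivision to its affine
  -- approximation. The remaining terms come from the boundary of `z` and lie in the subcomplex.
  refine ⟨approxMap P (n + 1) (sdIter _ N (n + 1) z), ?_,
    -(h (n + 1) (sdIter _ N (n + 1) z)) - T (n + 1) z, ?_⟩
  · rw [d_approxMap hN]
    exact approxMap_mem hd
  · have : z - affineMap P (n + 1) (approxMap P (n + 1) (sdIter _ N (n + 1) z)) -
        (singSSet _).d (n + 1) (-(h (n + 1) (sdIter _ N (n + 1) z)) - T (n + 1) z) =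
        -(h n ((singSSet _).d n (sdIter _ N (n + 1) z))) - T n ((singSSet _).d n z) := by
      rw [map_sub, map_neg, h1 n _ hN, hT1 n z]
      abel
    rw [this]
    exact Submodule.sub_mem _ (Submodule.neg_mem _ (h2 L n _ hd))
      (hT2 _ (isSieve_simplicesIn _) n _ hz)

/-- The strict chains that become small together with all their faces after `N` subdivisions. -/
def goodChains (N : ℕ) : ∀ n, Set ((strictSSet P).X n)
  | 0 => Set.univ
  | n + 1 => {s | sdIter _ N (n + 1) (affineMap P (n + 1) (Finsupp.single s 1)) ∈
      Finsupp.supported ℤ ℤ (simplicesSmall starSet (n + 1)) ∧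
      ∀ i, (strictSSet P).δ i s ∈ goodChains N n}

/-- The number of subdivisions needed depends on the chain, and finitely many conditions on `N`
suffice for each one. Including the faces makes the good chains closed under the boundary. -/
theorem eventually_mem_goodChains {n : ℕ} (s : (strictSSet P).X n) :
    ∀ᶠ N in Filter.atTop, s ∈ goodChains N n := by
  induction n with
  | zero => exact Filter.Eventually.of_forall fun _ => Set.mem_univ _
  | succ n ih =>
    exact (eventually_sdIter_mem_simplicesSmall starSet isOpen_starSet exists_mem_starSet _).and
      (Filter.eventually_all.mpr fun i => ih _)

theorem sdIter_zero_eq {Y : Type u} [TopologicalSpace Y] (N : ℕ) (x : (singSSet Y).Chain 0) :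
    sdIter Y N 0 x = x := by
  have : Subsingleton ((singSSet Y).X 0) := ⟨fun a b => by
    ext1 t
    have := stdSimplex.sum_eq_one t
    simp at this⟩
  have h1 : sdOp Y 0 = LinearMap.id := by
    refine LinearMap.ext fun x => map_eq_of_forall_single _ _ (fun σ => ?_) x
    rw [sdOp_single]
    change Finsupp.lmapDomain ℤ ℤ _ (Finsupp.single _ 1) = Finsupp.single _ _
    rw [Finsupp.lmapDomain_apply, Finsupp.mapDomain_single]
    congr 1
    exact Subsingleton.elim _ _
  rw [sdIter, h1, ← Module.End.one_eq_id, one_pow]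
  rfl

-- Subdividing an affine simplex does not leave its closed simplex, and a dominant vertex belongs to
-- the support; so the round trip and the identity are both carried by subchains of `s`. These are
-- acyclic because `s` has a least element.
variable (P) in
theorem exists_approxMap_affineMap_homotopy (N : ℕ) :
    ∃ h : ∀ n, (strictSSet P).Chain n →ₗ[ℤ] (strictSSet P).Chain (n + 1),
      (∀ n, ∀ x ∈ Finsupp.supported ℤ ℤ (goodChains N (n + 1)),
        (strictSSet P).d (n + 1) (h (n + 1) x) =
          approxMap P (n + 1) (sdIter _ N (n + 1) (affineMap P (n + 1) x)) - x -
            h n ((strictSSet P).d n x)) ∧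
      ∀ L : PreAbstractSimplicialComplex P, ∀ n, ∀ x ∈ Finsupp.supported ℤ ℤ
        (goodChains N n ∩ chainsOf L n),
        h n x ∈ Finsupp.supported ℤ ℤ (chainsOf L (n + 1)) := by
  obtain ⟨h, h1, h2⟩ := AugSSet.exists_homotopy_of_acyclic_carrier
    (A := strictSSet P) (D := strictSSet P) (goodChains N)
    (fun n b hb i => hb.2 i)
    (fun n => approxMap P n ∘ₗ sdIter _ N n ∘ₗ affineMap P n) (fun n => LinearMap.id)
    (fun n s hs => by
      simp only [LinearMap.comp_apply]
      rw [d_approxMap hs.1, d_sdIter, d_affineMap])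
    (fun n s hs => rfl)
    (fun s hs => by
      simp only [LinearMap.comp_apply]
      rw [sdIter_zero_eq, affineMap_single, approxMap, Finsupp.lmapDomain_apply,
        Finsupp.mapDomain_single]
      change _ = Finsupp.single _ _
      congr 1
      exact Subtype.ext (Subsingleton.elim _ _))
    (fun n s m => Finsupp.supported ℤ ℤ (chainsIn (Set.range s.1) m))
    (fun n s hs i m => Finsupp.supported_mono fun r hr j => by
      obtain ⟨k, hk⟩ := hr j
      exact ⟨i.succAbove k, hk⟩)
    (fun n s hs => by
      have hsmall : sdIter _ N n (affineMap P n (Finsupp.single s 1)) ∈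
          Finsupp.supported ℤ ℤ (simplicesSmall starSet n) := by
        cases n with
        | zero =>
          rw [sdIter_zero_eq, affineMap_single]
          exact Finsupp.single_mem_supported ℤ 1 ⟨∅, mem_simplicesIn_zero _ _⟩
        | succ n => exact hs.1
      have hin := sdIter_mem (isSieve_simplicesIn _) N (affineMap_mem_simplicesIn
        (A := Set.range s.1) (Finsupp.single_mem_supported ℤ (1 : ℤ)
          (show s ∈ chainsIn (Set.range s.1) n from fun i => ⟨i, rfl⟩)))
      refine map_mem_of_supported (approxMap P n) _ (fun σ hσ => ?_)
        (mem_supported_inter hsmall hin)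
      refine Finsupp.supported_mono ?_ (approxMap_single_mem hσ.1)
      intro r hr j
      obtain ⟨i, hi⟩ := hr j
      rw [← hi]
      exact hσ.2 ⟨_, rfl⟩ (topVertex_mem_support _))
    (fun n s hs => Finsupp.single_mem_supported ℤ 1 fun i => ⟨i, rfl⟩)
    (fun n s hs x hx hd => exists_d_eq_of_isLeast (m := s.1 0)
      (by
        refine ⟨⟨0, rfl⟩, ?_⟩
        rintro _ ⟨i, rfl⟩
        exact s.2.monotone (Fin.zero_le i)) hx hd)
  refine ⟨h, h1, fun L n x hx => map_mem_of_supported _ _ (fun s hs => ?_) hx⟩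
  exact Finsupp.supported_mono (chainsIn_subset_chainsOf hs.2) (h2 n s hs.1)

/-- A chain of affine simplices that is a relative singular boundary is a relative simplicial
boundary. -/
theorem exists_eq_d_add (L : PreAbstractSimplicialComplex P) {n : ℕ}
    (c : (strictSSet P).Chain (n + 1))
    (hc : (strictSSet P).d n c ∈ Finsupp.supported ℤ ℤ (chainsOf L n))
    (y : (singSSet (OrderRealization P)).Chain (n + 2))
    (hy : affineMap P (n + 1) c - (singSSet _).d (n + 1) y ∈
      Finsupp.supported ℤ ℤ (simplicesIn (subcomplexSet _ L) (n + 1))) :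
    ∃ e : (strictSSet P).Chain (n + 2), c - (strictSSet P).d (n + 1) e ∈
      Finsupp.supported ℤ ℤ (chainsOf L (n + 1)) := by
  have hcov := @exists_mem_starSet P _
  obtain ⟨r, hr⟩ : ∃ r, r = affineMap P (n + 1) c - (singSSet _).d (n + 1) y := ⟨_, rfl⟩
  rw [← hr] at hy
  have hc' : affineMap P (n + 1) c = (singSSet _).d (n + 1) y + r := by rw [hr]; abel
  -- One `N` must serve the bounding chain `y`, the remainder `r` in the subcomplex, and all
  -- generators of `c`.
  obtain ⟨N, hNy, hNr, hNc⟩ :=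
    ((eventually_sdIter_mem_simplicesSmall starSet isOpen_starSet hcov y).and
    ((eventually_sdIter_mem_simplicesSmall starSet isOpen_starSet hcov r).and
    ((Filter.eventually_all_finset c.support).mpr fun s _ => eventually_mem_goodChains s))).exists
  have hNc : c ∈ Finsupp.supported ℤ ℤ (goodChains N (n + 1)) := hNc
  obtain ⟨h, h1, h2⟩ := exists_approxMap_affineMap_homotopy P N
  -- Approximating the equation `aff c = d y + r` replaces `d y` by a simplicial boundary, and the
  -- homotopy `h` returns from the approximation of `aff c` to `c`.
  refine ⟨approxMap P (n + 2) (sdIter _ N (n + 2) y) - h (n + 1) c, ?_⟩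
  have e : c - (strictSSet P).d (n + 1) (approxMap P (n + 2) (sdIter _ N (n + 2) y) -
      h (n + 1) c) = approxMap P (n + 1) (sdIter _ N (n + 1) r) - h n ((strictSSet P).d n c) := by
    rw [map_sub, d_approxMap hNy, d_sdIter, h1 n c hNc, hc', map_add, map_add]
    abel
  rw [e]
  refine Submodule.sub_mem _ (approxMap_mem (mem_supported_inter hNr
    (sdIter_mem (isSieve_simplicesIn _) N hy))) (h2 L n _ (mem_supported_inter ?_ hc))
  exact AugSSet.d_mem_supported (fun s hs i => hs.2 i) hNc

end Comparison

/-! ### Singular chains of a quotient space -/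

namespace PointedQuotient

variable {X : Type u} [TopologicalSpace X] {A : Set X}

variable (A) in
/-- The base point. -/
def pt : PointedQuotient X A := Quot.mk _ (Sum.inr PUnit.unit)

variable (A) in
/-- The quotient map. -/
def proj : C(X, PointedQuotient X A) :=
  ⟨fun x => Quot.mk _ (Sum.inl x), continuous_quot_mk.comp continuous_inl⟩

theorem proj_of_mem {x : X} (hx : x ∈ A) : proj A x = pt A :=
  Quot.sound ⟨x, hx, rfl, rfl⟩

theorem eq_pt_or_exists (y : PointedQuotient X A) : y = pt A ∨ ∃ x ∉ A, proj A x = y := by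
  induction y using Quot.ind with
  | mk p =>
    rcases p with x | x
    · by_cases hx : x ∈ A
      · exact Or.inl (proj_of_mem hx)
      · exact Or.inr ⟨x, hx, rfl⟩
    · exact Or.inl rfl

open Classical in
/-- The element of `X` that represents a point other than the base point. -/
noncomputable def toOption : PointedQuotient X A → Option X :=
  Quot.lift (Sum.elim (fun x => if x ∈ A then none else some x) fun _ => none) (by
    rintro _ _ ⟨y, hy, rfl, rfl⟩
    simp [hy])

theorem toOption_proj {x : X} (hx : x ∉ A) : toOption (proj A x) = some x := if_neg hx

theorem proj_eq_pt_iff {x : X} : proj A x = pt A ↔ x ∈ A := by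
  refine ⟨fun h => ?_, proj_of_mem⟩
  by_contra hx
  have := congrArg toOption h
  rw [toOption_proj hx] at this
  exact Option.some_ne_none _ this

theorem proj_injOn : Set.InjOn (proj A) Aᶜ := fun x hx y hy h => by
  have := congrArg toOption h
  rwa [toOption_proj hx, toOption_proj hy, Option.some_inj] at this

theorem isOpen_iff {s : Set (PointedQuotient X A)} : IsOpen s ↔ IsOpen (proj A ⁻¹' s) := by
  change IsOpen (Quot.mk _ ⁻¹' s) ↔ _
  rw [isOpen_sum_iff]
  exact and_iff_left (isOpen_discrete _)

/-- The image of a set together with the base point. -/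
def nhd (N : Set X) : Set (PointedQuotient X A) := {y | y = pt A ∨ ∃ x ∈ N, proj A x = y}

theorem proj_mem_nhd_iff {N : Set X} (hN : A ⊆ N) {x : X} : proj A x ∈ nhd N ↔ x ∈ N := by
  refine ⟨fun h => ?_, fun h => Or.inr ⟨x, h, rfl⟩⟩
  rcases h with h | ⟨x', hx', h⟩
  · exact hN (proj_eq_pt_iff.mp h)
  · by_cases hx : x ∈ A
    · exact hN hx
    by_cases hx'A : x' ∈ A
    · rw [proj_of_mem hx'A, eq_comm, proj_eq_pt_iff] at h
      exact absurd h hx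
    · rwa [← proj_injOn hx'A hx h]

theorem isOpen_nhd {N : Set X} (hN : A ⊆ N) (h : IsOpen N) :
    IsOpen (nhd N : Set (PointedQuotient X A)) := by
  rw [isOpen_iff]
  convert h using 1
  ext x
  exact proj_mem_nhd_iff hN

theorem isOpen_compl_pt (hA : IsClosed A) : IsOpen {y : PointedQuotient X A | y ≠ pt A} := by
  rw [isOpen_iff]
  convert hA.isOpen_compl using 1
  ext x
  exact not_congr proj_eq_pt_iff

theorem isOpenEmbedding_proj (hA : IsClosed A) :
    Topology.IsOpenEmbedding fun x : (Aᶜ : Set X) => proj A x := by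
  refine .of_continuous_injective_isOpenMap ((proj A).continuous.comp continuous_subtype_val)
    (fun x y h => Subtype.ext (proj_injOn x.2 y.2 h)) fun O hO => ?_
  rw [isOpen_iff]
  convert hA.isOpen_compl.isOpenMap_subtype_val _ hO using 1
  ext x
  constructor
  · rintro ⟨x', hx', h⟩
    have hx : x ∉ A := fun hx => x'.2 (by
      rw [← proj_eq_pt_iff]
      exact h.trans (proj_of_mem hx))
    exact ⟨x', hx', proj_injOn x'.2 hx h⟩
  · rintro ⟨x', hx', rfl⟩
    exact ⟨x', hx', rfl⟩

/-- Since `A` is closed, its complement embeds as an open subspace of the quotient, so maps that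
miss the base point lift continuously. -/
theorem exists_comp_proj_eq (hA : IsClosed A) {T : Type v} [TopologicalSpace T]
    (σ : C(T, PointedQuotient X A)) (hσ : ∀ t, σ t ≠ pt A) :
    ∃ τ : C(T, X), (∀ t, τ t ∉ A) ∧ (proj A).comp τ = σ := by
  have h : ∀ t, ∃ x : (Aᶜ : Set X), proj A x = σ t := fun t => by
    obtain ⟨x, hx, h⟩ := (eq_pt_or_exists (σ t)).resolve_left (hσ t)
    exact ⟨⟨x, hx⟩, h⟩
  choose f hf using h
  have hc : Continuous f := by
    rw [(isOpenEmbedding_proj hA).isEmbedding.continuous_iff]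
    convert σ.continuous using 1
    funext t
    exact hf t
  exact ⟨⟨fun t => f t, continuous_subtype_val.comp hc⟩, fun t => (f t).2, ContinuousMap.ext hf⟩

theorem exists_singMap_proj_eq (hA : IsClosed A) {n : ℕ}
    {z : (singSSet (PointedQuotient X A)).Chain n}
    (hz : z ∈ Finsupp.supported ℤ ℤ (simplicesIn {y | y ≠ pt A} n)) :
    ∃ w ∈ Finsupp.supported ℤ ℤ (simplicesIn Aᶜ n), singMap (proj A) n w = z := by
  have : z ∈ (Finsupp.supported ℤ ℤ (simplicesIn Aᶜ n)).map (singMap (proj A) n) := by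
    refine map_mem_of_supported LinearMap.id _ (fun σ hσ => ?_) hz
    obtain ⟨τ, hτ, h⟩ := exists_comp_proj_eq hA σ fun t => hσ ⟨t, rfl⟩
    refine ⟨Finsupp.single τ 1, Finsupp.single_mem_supported ℤ 1 ?_, ?_⟩
    · rintro _ ⟨t, rfl⟩
      exact hτ t
    · rw [singMap_single, h]
      rfl
  exact this

/-- Projection is injective on simplices that avoid `A`, so no coefficients cancel and each simplex
of `w` is seen in the image. -/
theorem mem_of_singMap_proj_mem {N : Set X} (hN : A ⊆ N) {n : ℕ} {w : (singSSet X).Chain n}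
    (hw : w ∈ Finsupp.supported ℤ ℤ (simplicesIn Aᶜ n))
    (h : singMap (proj A) n w ∈ Finsupp.supported ℤ ℤ (simplicesIn (nhd N) n)) :
    w ∈ Finsupp.supported ℤ ℤ (simplicesIn N n) := by
  classical
  have hinj : Set.InjOn (fun σ : (singSSet X).X n =>
      ((proj A).comp σ : (singSSet (PointedQuotient X A)).X n)) w.support := fun σ hσ τ hτ e => by
    ext1 t
    exact proj_injOn (hw hσ ⟨t, rfl⟩) (hw hτ ⟨t, rfl⟩) (DFunLike.congr_fun e t)
  intro σ hσ
  have h1 : (proj A).comp σ ∈ simplicesIn (nhd N) n := by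
    refine h ?_
    rw [singMap, Finsupp.lmapDomain_apply, Finset.mem_coe, Finsupp.mapDomain_support_of_injOn _ hinj]
    exact Finset.mem_image_of_mem _ hσ
  rintro _ ⟨t, rfl⟩
  exact (proj_mem_nhd_iff hN).mp (h1 ⟨t, rfl⟩)

/-- The homotopy induced on the quotient. -/
noncomputable def liftHomotopy (D : C(X × unitInterval, X)) (hD : ∀ x ∈ A, ∀ t, D (x, t) ∈ A) :
    C(PointedQuotient X A × unitInterval, PointedQuotient X A) :=
  -- Currying lets the homotopy descend by the universal property of the quotient, with no need to
  -- know that the product of a quotient map with the interval is a quotient map.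
  ContinuousMap.uncurry ⟨Quot.lift
    (Sum.elim (((proj A).comp D).curry) fun _ => ContinuousMap.const _ (pt A)) (by
      rintro _ _ ⟨y, hy, rfl, rfl⟩
      ext1 t
      exact proj_of_mem (hD y hy t)),
    continuous_quot_lift _ (continuous_sum_dom.mpr
      ⟨((proj A).comp D).curry.continuous, continuous_const⟩)⟩

theorem liftHomotopy_proj (D : C(X × unitInterval, X)) (hD : ∀ x ∈ A, ∀ t, D (x, t) ∈ A) (x : X)
    (t : unitInterval) : liftHomotopy D hD (proj A x, t) = proj A (D (x, t)) := rfl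

theorem liftHomotopy_pt (D : C(X × unitInterval, X)) (hD : ∀ x ∈ A, ∀ t, D (x, t) ∈ A)
    (t : unitInterval) : liftHomotopy D hD (pt A, t) = pt A := rfl

end PointedQuotient

theorem exists_add_eq_of_union {α : Type*} {s t : Set α} {x : α →₀ ℤ}
    (hx : x ∈ Finsupp.supported ℤ ℤ (s ∪ t)) :
    ∃ y ∈ Finsupp.supported ℤ ℤ s, ∃ z ∈ Finsupp.supported ℤ ℤ t, y + z = x := by
  rw [Finsupp.supported_union] at hx
  exact Submodule.mem_sup.mp hx

theorem exists_homotopy_to_id {Y : Type u} [TopologicalSpace Y] (D : C(Y × unitInterval, Y))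
    (f : C(Y, Y)) (h1 : ∀ y, D (y, 1) = f y) (h0 : ∀ y, D (y, 0) = y) :
    ∃ h : ∀ n, (singSSet Y).Chain n →ₗ[ℤ] (singSSet Y).Chain (n + 1),
      (∀ n x, (singSSet Y).d (n + 1) (h (n + 1) x) =
        singMap f (n + 1) x - x - h n ((singSSet Y).d n x)) ∧
      ∀ B : Set Y, (∀ y ∈ B, ∀ t, D (y, t) ∈ B) → ∀ n, ∀ x ∈ Finsupp.supported ℤ ℤ
        (simplicesIn B n), h n x ∈ Finsupp.supported ℤ ℤ (simplicesIn B (n + 1)) := by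
  obtain ⟨h, e1, e2⟩ := exists_singMap_homotopy D f (ContinuousMap.id Y) h1 h0
  refine ⟨h, fun n x => ?_, fun B hB n x hx => e2 n _ _ (fun σ hσ θ => ?_) x hx⟩
  · rw [e1]
    congr 2
    exact map_eq_of_forall_single (singMap (ContinuousMap.id Y) (n + 1)) LinearMap.id
      (fun σ => by rw [singMap_single]; rfl) x
  · rintro _ ⟨t, rfl⟩
    exact hB _ (hσ ⟨_, rfl⟩) _

theorem singMap_mem {Y : Type u} {Z : Type v} [TopologicalSpace Y] [TopologicalSpace Z]
    (g : C(Y, Z)) {B : Set Y} {C : Set Z} (h : ∀ y ∈ B, g y ∈ C) {n : ℕ}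
    {x : (singSSet Y).Chain n} (hx : x ∈ Finsupp.supported ℤ ℤ (simplicesIn B n)) :
    singMap g n x ∈ Finsupp.supported ℤ ℤ (simplicesIn C n) :=
  lmapDomain_mem_supported (s := simplicesIn B n) (t := simplicesIn C n)
    (fun σ : (singSSet Y).X n => (g.comp σ : (singSSet Z).X n)) (fun σ hσ => by
      rintro _ ⟨t, rfl⟩
      exact h _ (hσ ⟨t, rfl⟩)) hx

theorem simplicesSmall_subset_union {Y : Type u} [TopologicalSpace Y] (U : Bool → Set Y) (n : ℕ) :
    simplicesSmall U n ⊆ simplicesIn (U true) n ∪ simplicesIn (U false) n := by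
  rintro σ ⟨b, hb⟩
  cases b
  · exact Or.inr hb
  · exact Or.inl hb

theorem eventually_exists_add_eq {Y : Type u} [TopologicalSpace Y] {U W : Set Y} (hU : IsOpen U)
    (hW : IsOpen W) (hUW : ∀ y, y ∈ U ∨ y ∈ W) {n : ℕ} (x : (singSSet Y).Chain n) :
    ∀ᶠ N in Filter.atTop, ∃ y ∈ Finsupp.supported ℤ ℤ (simplicesIn U n),
      ∃ z ∈ Finsupp.supported ℤ ℤ (simplicesIn W n), y + z = sdIter Y N n x := by
  refine (eventually_sdIter_mem_simplicesSmall (fun b : Bool => if b then U else W)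
    (fun b => by cases b <;> simpa) (fun y => ?_) x).mono fun N hN => ?_
  · rcases hUW y with h | h
    · exact ⟨true, by simpa using h⟩
    · exact ⟨false, by simpa using h⟩
  · have := exists_add_eq_of_union (Finsupp.supported_mono (simplicesSmall_subset_union _ n) hN)
    simpa using this

namespace PointedQuotient

variable {X : Type u} [TopologicalSpace X] {A N : Set X}

theorem mem_nhd_or_ne (N : Set X) (y : PointedQuotient X A) : y ≠ pt A ∨ y ∈ nhd N := by
  by_cases h : y = pt A
  · exact Or.inr (Or.inl h)
  · exact Or.inl h

/-- Chains of the quotient that are cycles modulo the base point lift to relative cycles. -/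
theorem exists_singMap_add_eq (hA : IsClosed A) (hN : IsOpen N) (hAN : A ⊆ N)
    (D : C(X × unitInterval, X)) (hD : ∀ x ∈ A, ∀ t, D (x, t) ∈ A) (h0 : ∀ x, D (x, 0) = x)
    (h1 : ∀ x ∈ N, D (x, 1) ∈ A) {n : ℕ} (z : (singSSet (PointedQuotient X A)).Chain (n + 1))
    (hz : (singSSet _).d n z ∈ Finsupp.supported ℤ ℤ (simplicesIn {pt A} n)) :
    ∃ x : (singSSet X).Chain (n + 1),
      (singSSet X).d n x ∈ Finsupp.supported ℤ ℤ (simplicesIn A n) ∧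
      ∃ y, z - singMap (proj A) (n + 1) x - (singSSet _).d (n + 1) y ∈
        Finsupp.supported ℤ ℤ (simplicesIn {pt A} (n + 1)) := by
  -- After subdivision the chain splits into `z1`, which misses the base point and lifts, and `z2`,
  -- which is near the base point and will be collapsed.
  obtain ⟨N', z1, hz1, z2, hz2, hzz⟩ := (eventually_exists_add_eq (isOpen_compl_pt hA)
    (isOpen_nhd hAN hN) (mem_nhd_or_ne N) z).exists
  obtain ⟨T, hT1, hT2⟩ := exists_sdIter_homotopy (PointedQuotient X A) N'
  obtain ⟨w, hw, rfl⟩ := exists_singMap_proj_eq hA hz1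
  obtain ⟨z', hz'⟩ : ∃ z', z' = sdIter _ N' (n + 1) z := ⟨_, rfl⟩
  rw [← hz'] at hzz
  let f : C(X, X) := D.comp ((ContinuousMap.id X).prodMk (ContinuousMap.const _ 1))
  let D' := liftHomotopy D hD
  let f' : C(PointedQuotient X A, PointedQuotient X A) :=
    D'.comp ((ContinuousMap.id _).prodMk (ContinuousMap.const _ 1))
  have hpt : ∀ y ∈ ({pt A} : Set (PointedQuotient X A)), ∀ t, D' (y, t) ∈
      ({pt A} : Set (PointedQuotient X A)) := by
    rintro _ rfl t
    exact liftHomotopy_pt D hD t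
  obtain ⟨H, hH1, hH2⟩ := exists_homotopy_to_id D' f' (fun _ => rfl) (fun y => by
    rcases eq_pt_or_exists y with rfl | ⟨x, -, rfl⟩
    · exact liftHomotopy_pt D hD 0
    · rw [liftHomotopy_proj, h0])
  have hdz' : (singSSet _).d n z' ∈ Finsupp.supported ℤ ℤ (simplicesIn {pt A} n) := by
    rw [hz', d_sdIter]
    exact sdIter_mem (isSieve_simplicesIn _) N' hz
  -- The boundary of the lift lies near `A`: its image differs from the boundary of `z2` only by a
  -- chain at the base point, and it can be read off upstairs because `w` avoids `A`.
  have hdw : (singSSet X).d n w ∈ Finsupp.supported ℤ ℤ (simplicesIn N n) := by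
    refine mem_of_singMap_proj_mem hAN ((isSieve_simplicesIn _).d_mem hw) ?_
    rw [← d_singMap, eq_sub_of_add_eq hzz, map_sub]
    refine Submodule.sub_mem _ (Finsupp.supported_mono (simplicesIn_mono ?_ n) hdz')
      ((isSieve_simplicesIn _).d_mem hz2)
    rintro _ rfl
    exact Or.inl rfl
  have hf' : singMap f' (n + 1) (singMap (proj A) (n + 1) w) =
      singMap (proj A) (n + 1) (singMap f (n + 1) w) := by
    simp only [singMap, lmapDomain_comp_apply]
    rfl
  -- The end map of the deformation sends `N` into `A`, making the lift a relative cycle and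
  -- collapsing `z2` to the base point.
  refine ⟨singMap f (n + 1) w, ?_, -(H (n + 1) z') - T (n + 1) z, ?_⟩
  · rw [d_singMap]
    exact singMap_mem f h1 hdw
  · have : z - singMap (proj A) (n + 1) (singMap f (n + 1) w) -
        (singSSet _).d (n + 1) (-(H (n + 1) z') - T (n + 1) z) =
        singMap f' (n + 1) z2 - H n ((singSSet _).d n z') - T n ((singSSet _).d n z) := by
      rw [map_sub, map_neg, hH1, hT1, ← hz', ← hf', ← hzz, map_add]
      abel
    rw [this]
    refine Submodule.sub_mem _ (Submodule.sub_mem _ (singMap_mem f' ?_ hz2) (hH2 _ hpt n _ hdz'))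
      (hT2 _ (isSieve_simplicesIn _) n _ hz)
    rintro _ (rfl | ⟨x, hx, rfl⟩)
    · exact liftHomotopy_pt D hD 1
    · exact proj_of_mem (h1 x hx)

/-- A relative cycle that becomes a boundary in the quotient is a relative boundary. -/
theorem exists_sub_d_mem (hA : IsClosed A) (hN : IsOpen N) (hAN : A ⊆ N)
    (D : C(X × unitInterval, X)) (hD : ∀ x ∈ A, ∀ t, D (x, t) ∈ A) (h0 : ∀ x, D (x, 0) = x)
    (h1 : ∀ x ∈ N, D (x, 1) ∈ A) {n : ℕ} (x : (singSSet X).Chain (n + 1))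
    (hx : (singSSet X).d n x ∈ Finsupp.supported ℤ ℤ (simplicesIn A n))
    (y : (singSSet (PointedQuotient X A)).Chain (n + 2))
    (hy : singMap (proj A) (n + 1) x - (singSSet _).d (n + 1) y ∈
      Finsupp.supported ℤ ℤ (simplicesIn {pt A} (n + 1))) :
    ∃ e, x - (singSSet X).d (n + 1) e ∈ Finsupp.supported ℤ ℤ (simplicesIn A (n + 1)) := by
  -- Both `y` in the quotient and `x` upstairs are split, with a common number of subdivisions; the
  -- part `x1` avoids `A`, as needed for reading it off from its projection.
  obtain ⟨N', ⟨y1, hy1, y2, hy2, hyy⟩, x1, hx1, x2, hx2, hxx⟩ := ((eventually_exists_add_eq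
    (isOpen_compl_pt hA) (isOpen_nhd hAN hN) (mem_nhd_or_ne N) y).and (eventually_exists_add_eq
      hA.isOpen_compl hN (fun y => (em (y ∈ A)).symm.imp id fun h => hAN h) x)).exists
  obtain ⟨T, hT1, hT2⟩ := exists_sdIter_homotopy X N'
  obtain ⟨w, hw, rfl⟩ := exists_singMap_proj_eq hA hy1
  let f : C(X, X) := D.comp ((ContinuousMap.id X).prodMk (ContinuousMap.const _ 1))
  obtain ⟨H, hH1, hH2⟩ := exists_homotopy_to_id D f (fun _ => rfl) h0
  have hdx : (singSSet _).d n (sdIter X N' (n + 1) x) ∈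
      Finsupp.supported ℤ ℤ (simplicesIn A n) := by
    rw [d_sdIter]
    exact sdIter_mem (isSieve_simplicesIn _) N' hx
  have hptN : ({pt A} : Set (PointedQuotient X A)) ⊆ nhd N := by
    rintro _ rfl
    exact Or.inl rfl
  -- The projection of this chain lies in the neighborhood, by the hypothesis on `y`. Since both
  -- terms avoid `A`, the chain itself lies in `N`.
  have hxw : x1 - (singSSet X).d (n + 1) w ∈ Finsupp.supported ℤ ℤ (simplicesIn N (n + 1)) := by
    refine mem_of_singMap_proj_mem hAN
      (Submodule.sub_mem _ hx1 ((isSieve_simplicesIn _).d_mem hw)) ?_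
    have e : singMap (proj A) (n + 1) (x1 - (singSSet X).d (n + 1) w) =
        sdIter _ N' (n + 1) (singMap (proj A) (n + 1) x - (singSSet _).d (n + 1) y) -
          singMap (proj A) (n + 1) x2 + (singSSet _).d (n + 1) y2 := by
      rw [map_sub, map_sub, ← d_sdIter, ← hyy, ← singMap_sdIter, ← hxx, map_add, map_add,
        d_singMap]
      abel
    rw [e]
    exact Submodule.add_mem _ (Submodule.sub_mem _
      (Finsupp.supported_mono (simplicesIn_mono hptN _) (sdIter_mem (isSieve_simplicesIn _) N' hy))
      (singMap_mem _ (fun x hx => (proj_mem_nhd_iff hAN).mpr hx) hx2))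
      ((isSieve_simplicesIn _).d_mem hy2)
  -- Subdivide, deform, and use the lift of `y1` as bounding chain; what is left over is pushed into
  -- `A` by `f` or comes from the boundary of `x`.
  refine ⟨singMap f (n + 2) w - H (n + 1) (sdIter X N' (n + 1) x) - T (n + 1) x, ?_⟩
  have : x - (singSSet X).d (n + 1) (singMap f (n + 2) w -
      H (n + 1) (sdIter X N' (n + 1) x) - T (n + 1) x) =
      singMap f (n + 1) (x1 - (singSSet X).d (n + 1) w + x2) -
        H n ((singSSet _).d n (sdIter X N' (n + 1) x)) - T n ((singSSet X).d n x) := by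
    rw [map_sub, map_sub, hH1, hT1, d_singMap, ← hxx, map_add, map_add,
      (singMap f (n + 1)).map_add (_ - _), (singMap f (n + 1)).map_sub]
    abel
  rw [this]
  exact Submodule.sub_mem _ (Submodule.sub_mem _
    (singMap_mem f h1 (Submodule.add_mem _ hxw hx2)) (hH2 _ hD n _ hdx))
    (hT2 _ (isSieve_simplicesIn _) n _ hx)

end PointedQuotient

/-! ### Neighborhoods of subcomplexes -/

namespace GeomRealization

variable {V : Type u} {K : PreAbstractSimplicialComplex V} (L : PreAbstractSimplicialComplex V)

/-- The coordinates, as elements of the unit interval. -/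
noncomputable def unitCoord (x : GeomRealization K) (v : V) : unitInterval :=
  ⟨x.coord v, x.coord_nonneg v, x.coord_le_one v⟩

theorem unitCoord_pos_iff (x : GeomRealization K) (v : V) :
    0 < x.unitCoord v ↔ v ∈ x.1.support := (x.mem_support v).symm

theorem unitCoord_eq_zero (x : GeomRealization K) {v : V} (h : v ∉ x.1.support) :
    x.unitCoord v = 0 := Subtype.ext (x.coord_eq_zero h)

theorem continuous_unitCoord_ofFace (σ : K.faces) (v : V) :
    Continuous fun w => (ofFace K σ w).unitCoord v :=
  (continuous_coord_ofFace σ v).subtype_mk _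

/-- The largest coordinate. -/
noncomputable def maxCoord (x : GeomRealization K) : unitInterval := x.1.support.sup x.unitCoord

theorem maxCoord_eq_of_subset (x : GeomRealization K) {σ : Finset V} (h : x.1.support ⊆ σ) :
    x.maxCoord = σ.sup x.unitCoord := by
  refine le_antisymm (Finset.sup_mono h) (Finset.sup_le fun v _ => ?_)
  by_cases hv' : v ∈ x.1.support
  · exact Finset.le_sup hv'
  · rw [unitCoord_eq_zero x hv']
    exact bot_le

theorem exists_coord_eq_maxCoord (x : GeomRealization K) :
    ∃ v ∈ x.1.support, x.coord v = x.maxCoord := by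
  obtain ⟨v, hv, h⟩ := Finset.exists_mem_eq_sup x.1.support x.support_nonempty x.unitCoord
  exact ⟨v, hv, congrArg Subtype.val h.symm⟩

theorem maxCoord_pos (x : GeomRealization K) : 0 < (x.maxCoord : ℝ) := by
  obtain ⟨v, hv, h⟩ := x.exists_coord_eq_maxCoord
  rw [← h]
  exact (x.mem_support v).mp hv

theorem continuous_maxCoord : Continuous (maxCoord (K := K)) := by
  refine continuous_iff_ofFace.mpr fun σ => ?_
  have : maxCoord ∘ ofFace K σ = fun w =>
      (σ : Finset V).sup fun v => (ofFace K σ w).unitCoord v :=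
    funext fun w => maxCoord_eq_of_subset _ (support_ofFace_subset σ w)
  rw [this]
  exact Continuous.finset_sup_apply fun v _ => continuous_unitCoord_ofFace σ v

open Classical in
/-- A function that measures the distance to the subcomplex `L`: the supremum of the levels whose
superlevel sets are not in `L`. -/
noncomputable def exitLevel (x : GeomRealization K) : unitInterval :=
  {τ ∈ x.1.support.powerset | τ.Nonempty ∧ τ ∉ L.faces}.sup fun τ => τ.inf x.unitCoord

-- Enlarging the vertex set adds only sets with minimal coordinate zero. On a closed simplex the
-- index set can thus be fixed, which gives continuity.
open Classical in
theorem exitLevel_eq_of_subset (x : GeomRealization K) {σ : Finset V} (h : x.1.support ⊆ σ) :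
    x.exitLevel L =
      {τ ∈ σ.powerset | τ.Nonempty ∧ τ ∉ L.faces}.sup fun τ => τ.inf x.unitCoord := by
  refine le_antisymm (Finset.sup_mono fun τ hτ => ?_) (Finset.sup_le fun τ hτ => ?_)
  · rw [Finset.mem_filter, Finset.mem_powerset] at hτ ⊢
    exact ⟨hτ.1.trans h, hτ.2⟩
  · rw [Finset.mem_filter, Finset.mem_powerset] at hτ
    by_cases hs : τ ⊆ x.1.support
    · exact Finset.le_sup (f := fun τ : Finset V => τ.inf x.unitCoord)
        (Finset.mem_filter.mpr ⟨Finset.mem_powerset.mpr hs, hτ.2⟩)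
    · obtain ⟨v, hv, hv'⟩ := Finset.not_subset.mp hs
      refine (Finset.inf_le hv).trans ?_
      rw [unitCoord_eq_zero x hv']
      exact bot_le

theorem continuous_exitLevel : Continuous (exitLevel (K := K) L) := by
  classical
  refine continuous_iff_ofFace.mpr fun σ => ?_
  have : exitLevel L ∘ ofFace K σ = fun w =>
      {τ ∈ (σ : Finset V).powerset | τ.Nonempty ∧ τ ∉ L.faces}.sup fun τ =>
        τ.inf fun v => (ofFace K σ w).unitCoord v :=
    funext fun w => exitLevel_eq_of_subset L _ (support_ofFace_subset σ w)
  rw [this]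
  exact Continuous.finset_sup_apply fun τ _ =>
    Continuous.finset_inf_apply fun v _ => continuous_unitCoord_ofFace σ v

/-- A nonface with all coordinates above the exit level would itself have raised that level. So
truncating coordinates at the exit level moves a point into `L`, whether or not `L` is a full
subcomplex. -/
theorem mem_faces_of_exitLevel_lt {x : GeomRealization K} {τ : Finset V} (hτ : τ.Nonempty)
    (h : ∀ v ∈ τ, x.exitLevel L < x.unitCoord v) : τ ∈ L.faces := by
  classical
  by_contra hL
  have hsub : τ ⊆ x.1.support := fun v hv =>
    (unitCoord_pos_iff x v).mp (lt_of_le_of_lt bot_le (h v hv))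
  have h1 : τ.inf x.unitCoord ≤ x.exitLevel L :=
    Finset.le_sup (f := fun τ : Finset V => τ.inf x.unitCoord)
      (Finset.mem_filter.mpr ⟨Finset.mem_powerset.mpr hsub, hτ, hL⟩)
  obtain ⟨v, hv, h2⟩ := Finset.exists_mem_eq_inf τ hτ x.unitCoord
  rw [h2] at h1
  exact absurd (h v hv) (not_lt.mpr h1)

theorem exitLevel_eq_zero_iff {x : GeomRealization K} :
    x.exitLevel L = 0 ↔ x ∈ subcomplexSet K L := by
  classical
  constructor
  · intro h
    refine mem_faces_of_exitLevel_lt L (x := x) x.support_nonempty fun v hv => ?_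
    rw [h]
    exact (unitCoord_pos_iff x v).mpr hv
  · intro h
    rw [exitLevel, Finset.filter_false_of_mem, Finset.sup_empty]
    · rfl
    · rintro τ hτ ⟨h1, h2⟩
      exact h2 ((L.isRelLowerSet_faces h).2 (Finset.mem_powerset.mp hτ) h1)

theorem isClosed_subcomplexSet : IsClosed (subcomplexSet K L) := by
  have : subcomplexSet K L = exitLevel L ⁻¹' {0} := by
    ext x
    exact (exitLevel_eq_zero_iff L).symm
  rw [this]
  exact isClosed_singleton.preimage (continuous_exitLevel L)

/-- An open neighborhood of a subcomplex. -/
def subcomplexNhd : Set (GeomRealization K) :=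
  {x | (x.exitLevel L : ℝ) < (x.maxCoord : ℝ) / 2}

theorem isOpen_subcomplexNhd : IsOpen (subcomplexNhd (K := K) L) :=
  isOpen_lt (continuous_subtype_val.comp (continuous_exitLevel L))
    ((continuous_subtype_val.comp continuous_maxCoord).div_const 2)

theorem subcomplexSet_subset_nhd : subcomplexSet K L ⊆ subcomplexNhd L := fun x hx => by
  rw [subcomplexNhd, Set.mem_ofPred_eq, (exitLevel_eq_zero_iff L).mpr hx]
  exact half_pos x.maxCoord_pos

/-- The coordinates of the deformation, before normalization. -/
noncomputable def cutCoord (x : GeomRealization K) (t : unitInterval) (v : V) : ℝ :=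
  max (x.coord v - t * min (x.exitLevel L : ℝ) ((x.maxCoord : ℝ) / 2)) 0

theorem cutCoord_nonneg (x : GeomRealization K) (t : unitInterval) (v : V) :
    0 ≤ cutCoord L x t v := le_max_right _ _

theorem min_exitLevel_nonneg (x : GeomRealization K) :
    0 ≤ min (x.exitLevel L : ℝ) ((x.maxCoord : ℝ) / 2) :=
  le_min (x.exitLevel L).2.1 (half_pos x.maxCoord_pos).le

theorem cutCoord_eq_zero (x : GeomRealization K) (t : unitInterval) {v : V}
    (h : v ∉ x.1.support) : cutCoord L x t v = 0 := by
  refine max_eq_right ?_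
  rw [coord_eq_zero x h, zero_sub]
  exact neg_nonpos.mpr (mul_nonneg t.2.1 (min_exitLevel_nonneg L x))

theorem sum_cutCoord_of_subset (x : GeomRealization K) (t : unitInterval) {σ : Finset V}
    (h : x.1.support ⊆ σ) : ∑ v ∈ x.1.support, cutCoord L x t v = ∑ v ∈ σ, cutCoord L x t v :=
  Finset.sum_subset h fun _ _ hv => cutCoord_eq_zero L x t hv

/-- The cut is at most half of the largest coordinate, so that coordinate survives. The cap by half
of `maxCoord` is what lets the normalized deformation be defined everywhere. -/
theorem sum_cutCoord_pos (x : GeomRealization K) (t : unitInterval) :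
    0 < ∑ v ∈ x.1.support, cutCoord L x t v := by
  obtain ⟨v, hv, h⟩ := x.exists_coord_eq_maxCoord
  refine lt_of_lt_of_le ?_ (Finset.single_le_sum (fun v _ => cutCoord_nonneg L x t v) hv)
  refine lt_max_of_lt_left ?_
  rw [h, sub_pos]
  have h1 := x.maxCoord_pos
  have h2 := min_exitLevel_nonneg L x
  calc (t : ℝ) * min (x.exitLevel L : ℝ) ((x.maxCoord : ℝ) / 2)
      ≤ 1 * min (x.exitLevel L : ℝ) ((x.maxCoord : ℝ) / 2) :=
        mul_le_mul_of_nonneg_right t.2.2 h2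
    _ ≤ (x.maxCoord : ℝ) / 2 := by
        rw [one_mul]
        exact min_le_right _ _
    _ < x.maxCoord := half_lt_self h1

/-- The deformation of a neighborhood of a subcomplex into the subcomplex. -/
noncomputable def deformFun (p : GeomRealization K × unitInterval) : GeomRealization K :=
  ofCoord p.1.1.support p.1.support_mem
    (fun v => cutCoord L p.1 p.2 v / ∑ u ∈ p.1.1.support, cutCoord L p.1 p.2 u)
    (fun v => div_nonneg (cutCoord_nonneg L _ _ v) (sum_cutCoord_pos L _ _).le)
    (fun v hv => by
      by_contra h
      rw [cutCoord_eq_zero L _ _ h, zero_div] at hv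
      exact hv rfl)
    (by rw [← Finset.sum_div, div_self (sum_cutCoord_pos L _ _).ne'])

theorem support_deformFun_subset (p : GeomRealization K × unitInterval) :
    (deformFun L p).1.support ⊆ p.1.1.support := support_ofCoord_subset _ _ _ _ _ _

theorem coord_deformFun (x : GeomRealization K) (t : unitInterval) (v : V) :
    (deformFun L (x, t)).coord v = cutCoord L x t v / ∑ u ∈ x.1.support, cutCoord L x t u := rfl

/-- The deformation of a neighborhood of a subcomplex into the subcomplex. -/
noncomputable def deform : C(GeomRealization K × unitInterval, GeomRealization K) :=
  ⟨deformFun L, by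
    refine continuous_prod_of_ofFace fun σ => ?_
    refine continuous_of_support_subset _ _ σ.2 (fun p =>
      (support_deformFun_subset L _).trans (support_ofFace_subset σ p.1)) fun v _ => ?_
    have hcut : ∀ v, Continuous fun p : stdSimplex ℝ ((σ : Finset V)) × unitInterval =>
        cutCoord L (ofFace K σ p.1) p.2 v := fun v => by
      have h1 : Continuous fun p : stdSimplex ℝ ((σ : Finset V)) × unitInterval =>
          ofFace K σ p.1 := (continuous_ofFace σ).comp continuous_fst
      exact (((continuous_coord v).comp h1).sub ((continuous_subtype_val.comp continuous_snd).mul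
        ((continuous_subtype_val.comp ((continuous_exitLevel L).comp h1)).min
          ((continuous_subtype_val.comp (continuous_maxCoord.comp h1)).div_const 2)))).max
        continuous_const
    have : (fun p : stdSimplex ℝ ((σ : Finset V)) × unitInterval =>
        (deformFun L (ofFace K σ p.1, p.2)).coord v) = fun p =>
        cutCoord L (ofFace K σ p.1) p.2 v /
          ∑ u ∈ (σ : Finset V), cutCoord L (ofFace K σ p.1) p.2 u := by
      funext p
      rw [coord_deformFun, sum_cutCoord_of_subset L _ _ (support_ofFace_subset σ p.1)]
    rw [this]
    refine (hcut v).div (continuous_finsetSum _ fun u _ => hcut u) fun p => ?_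
    rw [← sum_cutCoord_of_subset L _ _ (support_ofFace_subset σ p.1)]
    exact (sum_cutCoord_pos L _ _).ne'⟩

theorem deform_zero (x : GeomRealization K) : deform L (x, 0) = x := by
  refine ext_coord fun v => ?_
  have h : ∀ v, cutCoord L x 0 v = x.coord v := fun v => by
    simp [cutCoord, x.coord_nonneg v]
  change cutCoord L x 0 v / ∑ u ∈ x.1.support, cutCoord L x 0 u = _
  simp only [h]
  rw [sum_coord, div_one]

theorem deform_mem {x : GeomRealization K} (hx : x ∈ subcomplexSet K L) (t : unitInterval) :
    deform L (x, t) ∈ subcomplexSet K L :=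
  (L.isRelLowerSet_faces hx).2 (support_deformFun_subset L (x, t)) (support_nonempty _)

theorem deform_one_mem {x : GeomRealization K} (hx : x ∈ subcomplexNhd L) :
    deform L (x, 1) ∈ subcomplexSet K L := by
  refine mem_faces_of_exitLevel_lt L (x := x) (support_nonempty _) fun v hv => ?_
  rw [mem_support] at hv
  change 0 < cutCoord L x 1 v / ∑ u ∈ x.1.support, cutCoord L x 1 u at hv
  rw [div_pos_iff_of_pos_right (sum_cutCoord_pos L x 1)] at hv
  -- In the neighborhood the cap is inactive, so at time 1 exactly the vertices above the exit level
  -- survive.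
  have h : cutCoord L x 1 v = max (x.coord v - x.exitLevel L) 0 := by
    rw [cutCoord, min_eq_left (le_of_lt hx)]
    simp
  rw [h, lt_max_iff, or_iff_left (lt_irrefl _), sub_pos] at hv
  exact hv

end GeomRealization

/-! ### Chains of the poset and singular chains of the quotient -/

section QuotientComparison

variable {P : Type u} [PartialOrder P] (L : PreAbstractSimplicialComplex P)

open GeomRealization PointedQuotient

/-- The quotient of the realization of the order complex by the realization of a subcomplex. -/
abbrev RelativeRealization : Type u :=
  PointedQuotient (OrderRealization P) (subcomplexSet (posetOrderComplex P) L)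

/-- The map from chains of a poset to singular chains of the quotient. -/
noncomputable def quotientAffineMap (n : ℕ) : (strictSSet P).Chain n →ₗ[ℤ]
    (singSSet (RelativeRealization L)).Chain n :=
  singMap (proj (subcomplexSet _ L)) n ∘ₗ affineMap P n

theorem d_quotientAffineMap {n : ℕ} (x : (strictSSet P).Chain (n + 1)) :
    (singSSet _).d n (quotientAffineMap L (n + 1) x) =
      quotientAffineMap L n ((strictSSet P).d n x) := by
  simp only [quotientAffineMap, LinearMap.comp_apply]
  rw [d_singMap, d_affineMap]

theorem quotientAffineMap_mem {n : ℕ} {x : (strictSSet P).Chain n}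
    (hx : x ∈ Finsupp.supported ℤ ℤ (chainsOf L n)) :
    quotientAffineMap L n x ∈ Finsupp.supported ℤ ℤ (simplicesIn {pt _} n) :=
  singMap_mem _ (fun _ hx => proj_of_mem hx) (affineMap_mem hx)

/-- Surjectivity of the comparison: lift to a relative singular cycle, then replace that by affine
simplices. -/
theorem exists_quotientAffineMap_add_eq {n : ℕ}
    (z : (singSSet (RelativeRealization L)).Chain (n + 1))
    (hz : (singSSet _).d n z ∈ Finsupp.supported ℤ ℤ (simplicesIn {pt _} n)) :
    ∃ c : (strictSSet P).Chain (n + 1),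
      (strictSSet P).d n c ∈ Finsupp.supported ℤ ℤ (chainsOf L n) ∧
      ∃ y, z - quotientAffineMap L (n + 1) c - (singSSet _).d (n + 1) y ∈
        Finsupp.supported ℤ ℤ (simplicesIn {pt _} (n + 1)) := by
  obtain ⟨x, hx, y1, hy1⟩ := exists_singMap_add_eq (isClosed_subcomplexSet L)
    (isOpen_subcomplexNhd L) (subcomplexSet_subset_nhd L) (deform L) (fun _ h => deform_mem L h)
    (deform_zero L) (fun _ h => deform_one_mem L h) z hz
  obtain ⟨c, hc, y2, hy2⟩ := exists_affineMap_add_eq L x hx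
  refine ⟨c, hc, y1 + singMap (proj _) (n + 2) y2, ?_⟩
  have := Submodule.add_mem _ hy1
    (singMap_mem (proj _) (C := {pt (subcomplexSet _ L)}) (fun _ hx => proj_of_mem hx) hy2)
  convert this using 1
  rw [quotientAffineMap, LinearMap.comp_apply, map_add, d_singMap, map_sub, map_sub]
  abel

/-- Injectivity of the comparison: a bounding chain in the quotient gives a relative singular one,
and that gives a relative simplicial one. -/
theorem exists_sub_d_mem_chainsOf {n : ℕ} (c : (strictSSet P).Chain (n + 1))
    (hc : (strictSSet P).d n c ∈ Finsupp.supported ℤ ℤ (chainsOf L n))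
    (y : (singSSet (RelativeRealization L)).Chain (n + 2))
    (hy : quotientAffineMap L (n + 1) c - (singSSet _).d (n + 1) y ∈
      Finsupp.supported ℤ ℤ (simplicesIn {pt _} (n + 1))) :
    ∃ e : (strictSSet P).Chain (n + 2), c - (strictSSet P).d (n + 1) e ∈
      Finsupp.supported ℤ ℤ (chainsOf L (n + 1)) := by
  obtain ⟨e, he⟩ := PointedQuotient.exists_sub_d_mem (isClosed_subcomplexSet L)
    (isOpen_subcomplexNhd L) (subcomplexSet_subset_nhd L) (deform L) (fun _ h => deform_mem L h)
    (deform_zero L) (fun _ h => deform_one_mem L h) (affineMap P (n + 1) c) (by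
      rw [d_affineMap]
      exact affineMap_mem hc) y hy
  exact exists_eq_d_add L c hc e he

end QuotientComparison

/-! ### Homology of complexes of abelian groups by elements -/

section ElementwiseHomology

open CategoryTheory

variable (C : ChainComplex AddCommGrpCat.{u} ℕ) (k : ℕ)

theorem exists_iCycles_eq (x : C.X k) (hx : ∀ j, (C.d k j).hom x = 0) :
    ∃ c : C.cycles k, (C.iCycles k).hom c = x := by
  have hex := ShortComplex.exact_of_f_is_kernel
    (ShortComplex.mk (C.iCycles k) (C.d k _) (C.iCycles_d k _)) (C.cyclesIsKernel k _ rfl)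
  rw [ShortComplex.ab_exact_iff] at hex
  exact hex x (hx _)

theorem d_iCycles_apply (c : C.cycles k) (j : ℕ) : (C.d k j).hom ((C.iCycles k).hom c) = 0 := by
  rw [← AddCommGrpCat.comp_apply, C.iCycles_d k j]
  rfl

theorem iCycles_injective : Function.Injective (C.iCycles k).hom :=
  (AddCommGrpCat.mono_iff_injective _).mp inferInstance

theorem homologyπ_surjective : Function.Surjective (C.homologyπ k).hom :=
  (AddCommGrpCat.epi_iff_surjective _).mp inferInstance

theorem homologyπ_eq_zero_iff (c : C.cycles k) : (C.homologyπ k).hom c = 0 ↔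
    ∃ y : C.X (k + 1), (C.d (k + 1) k).hom y = (C.iCycles k).hom c := by
  have hex := ShortComplex.exact_of_g_is_cokernel
    (ShortComplex.mk (C.toCycles (k + 1) k) (C.homologyπ k) (C.toCycles_comp_homologyπ _ _))
    (C.homologyIsCokernel (k + 1) k (by simp))
  rw [ShortComplex.ab_exact_iff] at hex
  constructor
  · intro h
    obtain ⟨y, hy⟩ := hex c h
    refine ⟨y, ?_⟩
    rw [← C.toCycles_i (k + 1) k, AddCommGrpCat.comp_apply]
    exact congrArg _ hy
  · rintro ⟨y, hy⟩
    have : (C.toCycles (k + 1) k).hom y = c := by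
      apply iCycles_injective
      rw [← hy, ← C.toCycles_i (k + 1) k, AddCommGrpCat.comp_apply]
    rw [← this, ← AddCommGrpCat.comp_apply, C.toCycles_comp_homologyπ]
    rfl

variable {C} {D E : ChainComplex AddCommGrpCat.{u} ℕ}

theorem homologyMap_homologyπ (φ : C ⟶ D) (c : C.cycles k) :
    (HomologicalComplex.homologyMap φ k).hom ((C.homologyπ k).hom c) =
      (D.homologyπ k).hom ((HomologicalComplex.cyclesMap φ k).hom c) := by
  rw [← AddCommGrpCat.comp_apply, ← AddCommGrpCat.comp_apply,
    HomologicalComplex.homologyπ_naturality]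

theorem iCycles_cyclesMap (φ : C ⟶ D) (c : C.cycles k) :
    (D.iCycles k).hom ((HomologicalComplex.cyclesMap φ k).hom c) =
      (φ.f k).hom ((C.iCycles k).hom c) := by
  rw [← AddCommGrpCat.comp_apply, ← AddCommGrpCat.comp_apply, HomologicalComplex.cyclesMap_i]

/-- A criterion by elements for a map to identify the homology of `C` with the kernel of a map
in homology. -/
theorem nonempty_ker_homologyMap_addEquiv (φ : C ⟶ D) (ψ : D ⟶ E) (h0 : φ ≫ ψ = 0)
    (hinj : ∀ x : C.X k, (∀ j, (C.d k j).hom x = 0) → ∀ y : D.X (k + 1),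
      (φ.f k).hom x = (D.d (k + 1) k).hom y → ∃ e : C.X (k + 1), (C.d (k + 1) k).hom e = x)
    (hsurj : ∀ z : D.X k, (∀ j, (D.d k j).hom z = 0) → ∀ w : E.X (k + 1),
      (ψ.f k).hom z = (E.d (k + 1) k).hom w → ∃ (x : C.X k) (y : D.X (k + 1)),
      (∀ j, (C.d k j).hom x = 0) ∧ z - (φ.f k).hom x = (D.d (k + 1) k).hom y) :
    Nonempty ((HomologicalComplex.homologyMap ψ k).hom.ker ≃+ C.homology k) := by
  have hmem : ∀ a, (HomologicalComplex.homologyMap φ k).hom a ∈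
      (HomologicalComplex.homologyMap ψ k).hom.ker := fun a => by
    rw [AddMonoidHom.mem_ker, ← AddCommGrpCat.comp_apply, ← HomologicalComplex.homologyMap_comp,
      h0, HomologicalComplex.homologyMap_zero]
    rfl
  let F := (HomologicalComplex.homologyMap φ k).hom.codRestrict _ hmem
  refine ⟨(AddEquiv.ofBijective F ⟨?_, ?_⟩).symm⟩
  · rw [injective_iff_map_eq_zero]
    intro a ha
    obtain ⟨c, rfl⟩ := homologyπ_surjective C k a
    have h1 : (HomologicalComplex.homologyMap φ k).hom ((C.homologyπ k).hom c) = 0 :=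
      congrArg Subtype.val ha
    rw [homologyMap_homologyπ, homologyπ_eq_zero_iff] at h1
    obtain ⟨y, hy⟩ := h1
    rw [iCycles_cyclesMap] at hy
    rw [homologyπ_eq_zero_iff]
    exact hinj _ (d_iCycles_apply C k c) y hy.symm
  · rintro ⟨b, hb⟩
    obtain ⟨c, rfl⟩ := homologyπ_surjective D k b
    rw [AddMonoidHom.mem_ker, homologyMap_homologyπ, homologyπ_eq_zero_iff] at hb
    obtain ⟨w, hw⟩ := hb
    rw [iCycles_cyclesMap] at hw
    obtain ⟨x, y, hx, hxy⟩ := hsurj _ (d_iCycles_apply D k c) w hw.symm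
    obtain ⟨c', rfl⟩ := exists_iCycles_eq C k x hx
    refine ⟨(C.homologyπ k).hom c', Subtype.ext ?_⟩
    change (HomologicalComplex.homologyMap φ k).hom ((C.homologyπ k).hom c') = _
    rw [homologyMap_homologyπ, eq_comm, ← sub_eq_zero, ← map_sub, homologyπ_eq_zero_iff]
    exact ⟨y, by rw [← hxy, map_sub, iCycles_cyclesMap]⟩

end ElementwiseHomology

/-! ### Comparison with the singular chain complex -/

section SingularComplex

open CategoryTheory Limits AlgebraicTopology

/-- The singular chain complex with integer coefficients. -/
noncomputable abbrev singularComplex (Y : Type u) [TopologicalSpace Y] :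
    ChainComplex AddCommGrpCat.{u} ℕ :=
  SSet.chainComplex (TopCat.toSSet.obj (TopCat.of Y)) (AddCommGrpCat.of (ULift.{u} ℤ))

variable {Y : Type u} [TopologicalSpace Y]

/-- The simplex of the singular simplicial set given by a continuous map. -/
noncomputable def toSimplex {n : ℕ} (σ : (singSSet Y).X (n + 1)) :
    (TopCat.toSSet.obj (TopCat.of Y)).obj (.op (SimplexCategory.mk n)) :=
  ((TopCat.of Y).toSSetObjEquiv (.op (SimplexCategory.mk n))).symm σ

theorem toSimplex_surjective (n : ℕ) : Function.Surjective (toSimplex (Y := Y) (n := n)) :=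
  Equiv.surjective _

/-- The map from chains of continuous maps to the singular chain complex. -/
noncomputable def toSingular (n : ℕ) :
    (singSSet Y).Chain (n + 1) →+ (singularComplex Y).X n :=
  Finsupp.liftAddHom fun σ : (singSSet Y).X (n + 1) =>
    ((TopCat.toSSet.obj (TopCat.of Y)).ιChainComplex (R := AddCommGrpCat.of (ULift.{u} ℤ))
      (toSimplex σ)).hom.comp AddEquiv.ulift.symm.toAddMonoidHom

theorem toSingular_single {n : ℕ} (σ : (singSSet Y).X (n + 1)) (c : ℤ) :
    toSingular n (Finsupp.single σ c) =
      ((TopCat.toSSet.obj (TopCat.of Y)).ιChainComplex (R := AddCommGrpCat.of (ULift.{u} ℤ))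
        (toSimplex σ)).hom (ULift.up c) := by
  simp only [toSingular, Finsupp.liftAddHom_apply_single]
  rfl

theorem d_toSingular {n : ℕ} (x : (singSSet Y).Chain (n + 2)) :
    ((singularComplex Y).d (n + 1) n).hom (toSingular (n + 1) x) =
      toSingular n ((singSSet Y).d (n + 1) x) := by
  suffices h : ((singularComplex Y).d (n + 1) n).hom.comp (toSingular (n + 1)) =
      (toSingular n).comp ((singSSet Y).d (n + 1)).toAddMonoidHom from DFunLike.congr_fun h x
  refine Finsupp.addHom_ext fun σ c => ?_
  change ((singularComplex Y).d (n + 1) n).hom (toSingular (n + 1) (Finsupp.single σ c)) =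
      toSingular n ((singSSet Y).d (n + 1) (Finsupp.single σ c))
  rw [AugSSet.d_single, map_sum, toSingular_single, ← AddCommGrpCat.comp_apply,
    SSet.ιChainComplex_d]
  change (AddCommGrpCat.homAddEquiv (∑ i, _)) _ = _
  rw [map_sum, AddMonoidHom.finsetSum_apply]
  refine Finset.sum_congr rfl fun i _ => ?_
  refine Eq.trans ?_ (map_zsmul (toSingular n) ((-1) ^ (i : ℕ))
    (Finsupp.single ((singSSet Y).δ i σ) c)).symm
  exact congrArg (fun z => (-1 : ℤ) ^ (i : ℕ) • z)
    (toSingular_single ((singSSet Y).δ i σ) c).symm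

/-- The singular chain group is a coproduct of copies of the integers over the simplices; its
universal property supplies the inverse. Degree `n` corresponds to `n + 1` vertices. -/
theorem toSingular_bijective (n : ℕ) : Function.Bijective (toSingular (Y := Y) n) := by
  let X := TopCat.toSSet.obj (TopCat.of Y)
  let R := AddCommGrpCat.of (ULift.{u} ℤ)
  let e := (TopCat.of Y).toSSetObjEquiv (.op (SimplexCategory.mk n))
  let g : (singularComplex Y).X n ⟶ AddCommGrpCat.of ((singSSet Y).Chain (n + 1)) :=
    Cofan.IsColimit.desc (X.isColimitChainComplexXCofan R n) fun x =>
      AddCommGrpCat.ofHom ((Finsupp.singleAddHom (e x)).comp AddEquiv.ulift.toAddMonoidHom)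
  have hg : ∀ x, X.ιChainComplex x ≫ g =
      AddCommGrpCat.ofHom ((Finsupp.singleAddHom (e x)).comp AddEquiv.ulift.toAddMonoidHom) :=
    fun x => Cofan.IsColimit.fac _ _ x
  have h1 : ∀ x, g.hom (toSingular n x) = x := by
    intro x
    suffices h : g.hom.comp (toSingular n) = AddMonoidHom.id _ from DFunLike.congr_fun h x
    refine Finsupp.addHom_ext fun σ c => ?_
    change g.hom (toSingular n (Finsupp.single σ c)) = Finsupp.single σ c
    rw [toSingular_single, ← AddCommGrpCat.comp_apply, hg]
    change Finsupp.single (e (e.symm σ)) c = Finsupp.single σ c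
    rw [Equiv.apply_symm_apply]
  have h2 : g ≫ AddCommGrpCat.ofHom (toSingular n) = 𝟙 _ := by
    refine SSet.chainComplex_hom_ext fun x => ?_
    rw [← Category.assoc, hg, Category.comp_id]
    ext1
    refine AddMonoidHom.ext fun c => ?_
    obtain ⟨σ, rfl⟩ := toSimplex_surjective n x
    change toSingular n (Finsupp.single (e (e.symm σ)) c.down) = _
    rw [Equiv.apply_symm_apply, toSingular_single]
  exact ⟨Function.LeftInverse.injective h1, fun y => ⟨g.hom y, by
    change (g ≫ AddCommGrpCat.ofHom (toSingular n)).hom y = y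
    rw [h2]
    rfl⟩⟩

/-- The chain map induced by a continuous map. -/
noncomputable abbrev singularComplexMap {Z : Type u} [TopologicalSpace Z] (g : C(Y, Z)) :
    singularComplex Y ⟶ singularComplex Z :=
  SSet.chainComplexMap (TopCat.toSSet.map (TopCat.ofHom g)) _

theorem singularComplexMap_toSingular {Z : Type u} [TopologicalSpace Z] (g : C(Y, Z)) {n : ℕ}
    (x : (singSSet Y).Chain (n + 1)) :
    ((singularComplexMap g).f n).hom (toSingular n x) = toSingular n (singMap g (n + 1) x) := by
  suffices h : ((singularComplexMap g).f n).hom.comp (toSingular n) =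
      (toSingular n).comp (singMap g (n + 1)).toAddMonoidHom from DFunLike.congr_fun h x
  refine Finsupp.addHom_ext fun σ c => ?_
  change ((singularComplexMap g).f n).hom (toSingular n (Finsupp.single σ c)) =
    toSingular n (singMap g (n + 1) (Finsupp.single σ c))
  rw [singMap_single, toSingular_single, toSingular_single, ← AddCommGrpCat.comp_apply,
    SSet.ι_chainComplexMap_f]
  rfl

end SingularComplex

/-! ### Strict chains of maximal length -/

section Magnitude

variable {X : Type u} [MetricSpace X] {P : Type u} [PartialOrder P] {π : P → X} {ℓ : ℝ}

/-- A strict chain is determined by its set of elements, so the enumeration that witnesses a short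
simplex must be `s` itself. -/
theorem mem_chainsOf_shortChains_iff {k : ℕ} {s : (strictSSet P).X (k + 1)} :
    s ∈ chainsOf (shortChains P π ℓ) (k + 1) ↔ seqLength (π ∘ s.1) < ℓ := by
  rw [mem_chainsOf_iff]
  constructor
  · rintro ⟨n, s', hs', h, hl⟩
    rw [support_affineSimplex_barycenter] at h
    have hk : k = n := by
      have h1 := congrArg Set.ncard h
      rw [← Set.image_univ, ← Set.image_univ, Set.ncard_image_of_injective _ s.2.injective,
        Set.ncard_image_of_injective _ hs'.injective, Set.ncard_univ, Set.ncard_univ] at h1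
      simpa using h1
    subst hk
    rw [(StrictMono.range_inj s.2 hs').mp h]
    exact hl
  · exact fun h => ⟨k, s.1, s.2, support_affineSimplex_barycenter s, h⟩

variable {E : Set (X × X)} {ι : ∀ k, MagSeq E ℓ k → (strictSSet P).X (k + 1)}

theorem injective_of_comp_eq (hπ : ∀ k x, π ∘ (ι k x).1 = x.seq) (k : ℕ) :
    Function.Injective (ι k) := fun x y h => MagSeq.ext (by rw [← hπ, ← hπ, h])

theorem notMem_chainsOf (hπ : ∀ k x, π ∘ (ι k x).1 = x.seq) {k : ℕ} (x : MagSeq E ℓ k) :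
    ι k x ∉ chainsOf (shortChains P π ℓ) (k + 1) := by
  rw [mem_chainsOf_shortChains_iff, hπ, x.length_eq]
  exact lt_irrefl ℓ

variable (ι) in
/-- The linear map from magnitude chains to chains of the poset. -/
noncomputable def magMap (k : ℕ) : (MagSeq E ℓ k →₀ ℤ) →ₗ[ℤ] (strictSSet P).Chain (k + 1) :=
  Finsupp.lmapDomain ℤ ℤ (ι k)

/-- Magnitude generators go injectively to chains that are not short. With `exists_magMap_add_eq`,
this says that magnitude chains form a complement to the short chains. -/
theorem eq_zero_of_magMap_mem (hπ : ∀ k x, π ∘ (ι k x).1 = x.seq) {k : ℕ} {x : MagSeq E ℓ k →₀ ℤ}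
    (hx : magMap ι k x ∈ Finsupp.supported ℤ ℤ (chainsOf (shortChains P π ℓ) (k + 1))) : x = 0 := by
  classical
  rw [← Finsupp.support_eq_empty, Finset.eq_empty_iff_forall_notMem]
  intro a ha
  refine notMem_chainsOf hπ a (hx ?_)
  rw [magMap, Finsupp.lmapDomain_apply, Finset.mem_coe,
    Finsupp.mapDomain_support_of_injective (injective_of_comp_eq hπ k)]
  exact Finset.mem_image_of_mem _ ha

theorem exists_magMap_add_eq
    (hι : ∀ k (s : (strictSSet P).X (k + 1)), ¬ seqLength (π ∘ s.1) < ℓ → ∃ x, ι k x = s)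
    {k : ℕ} (c : (strictSSet P).Chain (k + 1)) :
    ∃ x, c - magMap ι k x ∈ Finsupp.supported ℤ ℤ (chainsOf (shortChains P π ℓ) (k + 1)) := by
  have : c ∈ LinearMap.range (magMap ι k) ⊔
      Finsupp.supported ℤ ℤ (chainsOf (shortChains P π ℓ) (k + 1)) := by
    refine map_mem_of_supported (s := Set.univ) LinearMap.id _ (fun s _ => ?_)
      (by simp)
    by_cases h : seqLength (π ∘ s.1) < ℓ
    · exact Submodule.mem_sup_right
        (Finsupp.single_mem_supported ℤ 1 (mem_chainsOf_shortChains_iff.mpr h))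
    · obtain ⟨x, rfl⟩ := hι k s h
      exact Submodule.mem_sup_left ⟨Finsupp.single x 1, by
        rw [magMap, Finsupp.lmapDomain_apply, Finsupp.mapDomain_single]
        rfl⟩
  obtain ⟨_, ⟨x, rfl⟩, r, hr, rfl⟩ := Submodule.mem_sup.mp this
  exact ⟨x, by rwa [add_sub_cancel_left]⟩

/-- Faces that keep length `ℓ` correspond term by term. Every other face, including the two end
faces, is shorter by the triangle inequality and so lies in the subcomplex. -/
theorem d_magMap_sub_mem (hπ : ∀ k x, π ∘ (ι k x).1 = x.seq)
    (hι : ∀ k (s : (strictSSet P).X (k + 1)), ¬ seqLength (π ∘ s.1) < ℓ → ∃ x, ι k x = s)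
    {k : ℕ} (x : MagSeq E ℓ (k + 1) →₀ ℤ) :
    (strictSSet P).d (k + 1) (magMap ι (k + 1) x) - magMap ι k (magBoundary E ℓ k x) ∈
      Finsupp.supported ℤ ℤ (chainsOf (shortChains P π ℓ) (k + 1)) := by
  refine map_mem_of_supported (s := Set.univ) ((strictSSet P).d (k + 1) ∘ₗ magMap ι (k + 1) -
    magMap ι k ∘ₗ magBoundary E ℓ k) _ (fun x _ => ?_) (by simp)
  rw [LinearMap.sub_apply, LinearMap.comp_apply, LinearMap.comp_apply, magBoundary_eq_sum,
    magMap, Finsupp.lmapDomain_apply, Finsupp.mapDomain_single, AugSSet.d_single,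
    LinearMap.sum_apply, map_sum, ← Finset.sum_sub_distrib]
  refine Submodule.sum_mem _ fun i _ => ?_
  rw [LinearMap.smul_apply, map_smul, ← smul_sub]
  refine Submodule.smul_mem _ _ ?_
  rw [magFace, Finsupp.linearCombination_single, one_smul, MagSeq.face]
  have hseq : π ∘ ((strictSSet P).δ i (ι (k + 1) x)).1 = x.seq ∘ i.succAbove := by
    rw [← hπ]
    rfl
  split_ifs with h
  · obtain ⟨y, hy⟩ := hι k ((strictSSet P).δ i (ι (k + 1) x)) (by rw [hseq, h]; exact lt_irrefl ℓ)
    have : y = x.remove i h := MagSeq.ext (by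
      rw [← hπ, hy, hseq]
      rfl)
    rw [magMap, Finsupp.lmapDomain_apply, Finsupp.mapDomain_single, ← this, hy, sub_self]
    exact Submodule.zero_mem _
  · rw [map_zero, sub_zero]
    refine Finsupp.single_mem_supported ℤ 1 (mem_chainsOf_shortChains_iff.mpr ?_)
    rw [hseq]
    refine lt_of_le_of_ne ?_ h
    exact (seqLength_comp_le x.seq _ (Fin.strictMono_succAbove i)).trans x.length_eq.le

end Magnitude

/-! ### Reduction of singular chains modulo the base point -/

section Reduction

variable {Y : Type u} [TopologicalSpace Y]

/-- Subtract the corresponding constant simplices from singular simplices. -/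
noncomputable def reduceMap (p : Y) (n : ℕ) : (singSSet Y).Chain n →ₗ[ℤ] (singSSet Y).Chain n :=
  LinearMap.id - singMap (ContinuousMap.const Y p) n

theorem reduceMap_apply (p : Y) {n : ℕ} (x : (singSSet Y).Chain n) :
    reduceMap p n x = x - singMap (ContinuousMap.const Y p) n x := rfl

theorem d_reduceMap (p : Y) {n : ℕ} (x : (singSSet Y).Chain (n + 1)) :
    (singSSet Y).d n (reduceMap p (n + 1) x) = reduceMap p n ((singSSet Y).d n x) := by
  rw [reduceMap_apply, reduceMap_apply, map_sub, d_singMap]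

/-- Identities modulo chains at the base point become exact after applying `reduceMap`. -/
theorem reduceMap_eq_zero {p : Y} {n : ℕ} {x : (singSSet Y).Chain n}
    (hx : x ∈ Finsupp.supported ℤ ℤ (simplicesIn {p} n)) : reduceMap p n x = 0 := by
  refine map_eq_of_supported (reduceMap p n) 0 (fun σ hσ => ?_) hx
  have : (ContinuousMap.const Y p).comp σ = σ := by
    ext1 t
    exact (hσ ⟨t, rfl⟩ : σ t = p).symm
  rw [reduceMap_apply, singMap_single, this, LinearMap.zero_apply]
  exact sub_self _

theorem singMap_const_mem (p : Y) {n : ℕ} (x : (singSSet Y).Chain n) :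
    singMap (ContinuousMap.const Y p) n x ∈ Finsupp.supported ℤ ℤ (simplicesIn {p} n) :=
  singMap_mem (B := Set.univ) _ (fun _ _ => rfl) (fun _ _ _ _ => Set.mem_univ _)

theorem singMap_const_reduceMap {Z : Type v} [TopologicalSpace Z] (p : Y) (q : Z) {n : ℕ}
    (x : (singSSet Y).Chain n) :
    singMap (ContinuousMap.const Y q) n (reduceMap p n x) = 0 := by
  rw [reduceMap_apply, map_sub, sub_eq_zero]
  simp only [singMap, lmapDomain_comp_apply]
  rfl

end Reduction

/-! ### The comparison isomorphism -/

section Isomorphism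

open CategoryTheory

variable {X : Type u} [MetricSpace X] {P : Type u} [PartialOrder P] {π : P → X} {ℓ : ℝ}
  {E : Set (X × X)} {ι : ∀ k, MagSeq E ℓ k → (strictSSet P).X (k + 1)}

variable (π ι) in
/-- The map from magnitude chains to reduced singular chains of the quotient. -/
noncomputable def magSingMap (k : ℕ) : (MagSeq E ℓ k →₀ ℤ) →ₗ[ℤ]
    (singSSet (RelativeRealization (shortChains P π ℓ))).Chain (k + 1) :=
  reduceMap (PointedQuotient.pt _) (k + 1) ∘ₗ
    quotientAffineMap (shortChains P π ℓ) (k + 1) ∘ₗ magMap ι k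

theorem magSingMap_apply {k : ℕ} (x : MagSeq E ℓ k →₀ ℤ) :
    magSingMap π ι k x = reduceMap (PointedQuotient.pt _) (k + 1)
      (quotientAffineMap (shortChains P π ℓ) (k + 1) (magMap ι k x)) := rfl

/-- The two boundaries differ by short chains. These become constant at the base point in the
quotient, and `reduceMap` kills them. -/
theorem d_magSingMap (hπ : ∀ k x, π ∘ (ι k x).1 = x.seq)
    (hι : ∀ k (s : (strictSSet P).X (k + 1)), ¬ seqLength (π ∘ s.1) < ℓ → ∃ x, ι k x = s)
    {k : ℕ} (x : MagSeq E ℓ (k + 1) →₀ ℤ) :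
    (singSSet _).d (k + 1) (magSingMap π ι (k + 1) x) =
      magSingMap π ι k (magBoundary E ℓ k x) := by
  rw [magSingMap_apply, magSingMap_apply, d_reduceMap, d_quotientAffineMap, ← sub_eq_zero,
    ← map_sub, ← map_sub]
  exact reduceMap_eq_zero (quotientAffineMap_mem _ (d_magMap_sub_mem hπ hι x))

theorem magnitudeComplexOn_d (k : ℕ) : (magnitudeComplexOn E ℓ).d (k + 1) k =
    AddCommGrpCat.ofHom (magBoundary E ℓ k).toAddMonoidHom :=
  ChainComplex.of_d (fun k => AddCommGrpCat.of (MagSeq E ℓ k →₀ ℤ))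
    (fun k => AddCommGrpCat.ofHom (magBoundary E ℓ k).toAddMonoidHom) k

theorem magnitudeComplexOn_d_apply {k : ℕ} (x : MagSeq E ℓ (k + 1) →₀ ℤ) :
    ((magnitudeComplexOn E ℓ).d (k + 1) k).hom x = magBoundary E ℓ k x := by
  rw [magnitudeComplexOn_d]
  rfl

/-- The chain map from magnitude chains to singular chains of the quotient. -/
noncomputable def magChainMap (hπ : ∀ k x, π ∘ (ι k x).1 = x.seq)
    (hι : ∀ k (s : (strictSSet P).X (k + 1)), ¬ seqLength (π ∘ s.1) < ℓ → ∃ x, ι k x = s) :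
    magnitudeComplexOn E ℓ ⟶ singularComplex (RelativeRealization (shortChains P π ℓ)) where
  f k := AddCommGrpCat.ofHom ((toSingular k).comp (magSingMap π ι k).toAddMonoidHom)
  comm' i j hij := by
    obtain rfl : j + 1 = i := hij
    rw [magnitudeComplexOn_d]
    ext1
    refine AddMonoidHom.ext fun (x : MagSeq E ℓ (j + 1) →₀ ℤ) => ?_
    change ((singularComplex _).d (j + 1) j).hom (toSingular (j + 1) (magSingMap π ι (j + 1) x)) =
      toSingular j (magSingMap π ι j (magBoundary E ℓ j x))
    rw [d_toSingular, d_magSingMap hπ hι]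

theorem d_magMap_mem_of_cycle (hπ : ∀ k x, π ∘ (ι k x).1 = x.seq)
    (hι : ∀ k (s : (strictSSet P).X (k + 1)), ¬ seqLength (π ∘ s.1) < ℓ → ∃ x, ι k x = s)
    {k : ℕ} (x : MagSeq E ℓ k →₀ ℤ)
    (hx : ∀ j, ((magnitudeComplexOn E ℓ).d k j).hom x = 0) :
    (strictSSet P).d k (magMap ι k x) ∈
      Finsupp.supported ℤ ℤ (chainsOf (shortChains P π ℓ) k) := by
  cases k with
  | zero => exact fun s _ => mem_simplicesIn_zero _ _
  | succ k =>
    have h := d_magMap_sub_mem hπ hι x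
    have h0 : magBoundary E ℓ k x = 0 := (magnitudeComplexOn_d_apply x).symm.trans (hx k)
    rwa [h0, map_zero, sub_zero] at h

/-- The only input about the poset is that its chains that are not short are the magnitude
generators, with matching positions; a single causal interval and the disjoint union of all of them
are both instances. -/
theorem nonempty_reducedHomology_addEquiv (hπ : ∀ k x, π ∘ (ι k x).1 = x.seq)
    (hι : ∀ k (s : (strictSSet P).X (k + 1)), ¬ seqLength (π ∘ s.1) < ℓ → ∃ x, ι k x = s) (k : ℕ) :
    Nonempty (ReducedHomology k (RelativeRealization (shortChains P π ℓ)) ≃+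
      (magnitudeComplexOn E ℓ).homology k) := by
  let Y := RelativeRealization (shortChains P π ℓ)
  let p : Y := PointedQuotient.pt _
  refine nonempty_ker_homologyMap_addEquiv k (magChainMap hπ hι)
    (singularComplexMap (ContinuousMap.const Y PUnit.unit.{u + 1})) ?_ ?_ ?_
  · ext1 n
    ext1
    refine AddMonoidHom.ext fun (x : MagSeq E ℓ n →₀ ℤ) => ?_
    change ((singularComplexMap _).f n).hom (toSingular n (magSingMap π ι n x)) = 0
    rw [singularComplexMap_toSingular, magSingMap_apply, singMap_const_reduceMap, map_zero]
  · intro (x : MagSeq E ℓ k →₀ ℤ) hx y hy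
    obtain ⟨y, rfl⟩ := (toSingular_bijective (k + 1)).2 y
    rw [d_toSingular] at hy
    have hy' : magSingMap π ι k x = (singSSet Y).d (k + 1) y := (toSingular_bijective k).1 hy
    rw [magSingMap_apply, reduceMap_apply, sub_eq_iff_eq_add, ← sub_eq_iff_eq_add'] at hy'
    -- The reduced image differs from the unreduced one by a chain at the base point, so the
    -- relative injectivity statement applies.
    obtain ⟨e, he⟩ := exists_sub_d_mem_chainsOf _ (magMap ι k x) (d_magMap_mem_of_cycle hπ hι x hx)
      y (by
        rw [hy']
        exact singMap_const_mem _ _)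
    obtain ⟨e', he'⟩ := exists_magMap_add_eq hι e
    refine ⟨e', ?_⟩
    suffices h0 : x - magBoundary E ℓ k e' = 0 from
      (magnitudeComplexOn_d_apply e').trans (sub_eq_zero.mp h0).symm
    -- Modulo short chains, `x` is the boundary of `e`, hence of the magnitude part `e'`; a
    -- magnitude chain that is zero modulo short chains is zero.
    refine eq_zero_of_magMap_mem hπ ?_
    have h1 := AugSSet.d_mem_supported (fun s hs i => chainsOf_δ hs i) he'
    have := Submodule.add_mem _ (Submodule.add_mem _ he h1) (d_magMap_sub_mem hπ hι e')
    convert this using 1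
    rw [map_sub, map_sub]
    abel
  · intro z hz w hw
    obtain ⟨z, rfl⟩ := (toSingular_bijective k).2 z
    obtain ⟨w, rfl⟩ := (toSingular_bijective (k + 1)).2 w
    rw [singularComplexMap_toSingular, d_toSingular] at hw
    have hw' := (toSingular_bijective k).1 hw
    -- In degree 0 the boundary consists of the empty simplex, which lies in every set; otherwise it
    -- is zero.
    have hdz : (singSSet Y).d k z ∈ Finsupp.supported ℤ ℤ (simplicesIn {p} k) := by
      cases k with
      | zero => exact fun s _ => mem_simplicesIn_zero _ _
      | succ k =>
        have h := hz k
        rw [d_toSingular, ← map_zero (toSingular k)] at h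
        rw [(toSingular_bijective k).1 h]
        exact Submodule.zero_mem _
    obtain ⟨c, hc, y, hy⟩ := exists_quotientAffineMap_add_eq _ z hdz
    obtain ⟨x, hx⟩ := exists_magMap_add_eq hι c
    -- The first term accounts for the reduced part of `z`. The second bounds its constant part,
    -- using that the image of `z` in a point is the boundary of `w`.
    refine ⟨x, toSingular (k + 1) (reduceMap p (k + 2) y +
      singMap (ContinuousMap.const _ p) (k + 2) w), fun j => ?_, ?_⟩
    · by_cases hj : j + 1 = k
      · subst hj
        refine (magnitudeComplexOn_d_apply x).trans ?_
        refine eq_zero_of_magMap_mem hπ ?_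
        have h1 := AugSSet.d_mem_supported (fun s hs i => chainsOf_δ hs i) hx
        have := Submodule.sub_mem _ (Submodule.sub_mem _ hc h1) (d_magMap_sub_mem hπ hι x)
        convert this using 1
        rw [map_sub]
        abel
      · rw [(magnitudeComplexOn E ℓ).shape k j hj]
        rfl
    · rw [d_toSingular]
      change toSingular k z - toSingular k (magSingMap π ι k x) = _
      rw [← map_sub]
      congr 1
      have h1 := reduceMap_eq_zero hy
      have h2 := reduceMap_eq_zero (quotientAffineMap_mem _ hx)
      have h3 : singMap (ContinuousMap.const Y p) (k + 1) z =
          (singSSet Y).d (k + 1) (singMap (ContinuousMap.const _ p) (k + 2) w) := by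
        rw [d_singMap, ← hw']
        simp only [singMap, lmapDomain_comp_apply]
        rfl
      rw [map_sub, map_sub, sub_eq_zero] at h2
      rw [map_sub, map_sub, h2, ← magSingMap_apply, reduceMap_apply, h3] at h1
      rw [map_add, d_reduceMap, ← sub_eq_zero, ← h1]
      abel

end Isomorphism

/-! ### Maximal chains of causal intervals -/

section Causal

variable {X : Type u} [MetricSpace X] {ℓ : ℝ}

/-- Each causal relation bounds a distance by an elapsed time, and the elapsed times telescope. -/
theorem sum_seqGap_le {k : ℕ} {s : Fin (k + 1) → Spacetime X} (hs : Monotone s)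
    {p q : Fin (k + 1)} (h : p ≤ q) :
    ∑ j ∈ Finset.Ico (p : ℕ) q, seqGap (fun i => (s i).pt) j ≤ (s q).time - (s p).time := by
  let τ : ℕ → ℝ := fun j => (s (Fin.ofNat (k + 1) (min j k))).time
  have e : ∀ p : Fin (k + 1), τ p = (s p).time := fun p => by
    have : Fin.ofNat (k + 1) (min (p : ℕ) k) = p := by
      ext
      simp only [Fin.ofNat]
      rw [min_eq_left (Nat.lt_succ_iff.mp p.is_lt), Nat.mod_eq_of_lt p.is_lt]
    simp only [τ, this]
  rw [← e p, ← e q, ← Finset.sum_Ico_sub τ (Fin.le_def.mp h)]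
  refine Finset.sum_le_sum fun j _ => hs ?_
  simp only [Fin.ofNat, Fin.le_def]
  rw [Nat.mod_eq_of_lt (by omega), Nat.mod_eq_of_lt (by omega)]
  omega

/-- The time coordinates that turn a sequence of points into a chain of tight causal relations. -/
noncomputable def seqTime {k : ℕ} (x : Fin (k + 1) → X) (i : Fin (k + 1)) : ℝ :=
  ∑ j ∈ Finset.Ico 0 (i : ℕ), seqGap x j

theorem seqTime_zero {k : ℕ} (x : Fin (k + 1) → X) : seqTime x 0 = 0 := by simp [seqTime]

theorem seqTime_last {k : ℕ} (x : Fin (k + 1) → X) : seqTime x (Fin.last k) = seqLength x := by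
  rw [seqTime, seqLength_eq_sum, Fin.val_last]

theorem dist_le_seqTime_sub {k : ℕ} (x : Fin (k + 1) → X) {p q : Fin (k + 1)} (h : p ≤ q) :
    dist (x p) (x q) ≤ seqTime x q - seqTime x p := by
  refine (dist_le_sum_seqGap x h).trans ?_
  rw [seqTime, seqTime, ← Finset.sum_Ico_consecutive _ (Nat.zero_le _) (Fin.le_def.mp h),
    add_sub_cancel_left]

/-- The chain of events given by a sequence of points. -/
noncomputable def seqEvent {k : ℕ} (x : Fin (k + 1) → X) (i : Fin (k + 1)) : Spacetime X :=
  ⟨x i, seqTime x i⟩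

theorem strictMono_seqEvent {k : ℕ} {x : Fin (k + 1) → X}
    (hx : ∀ i : Fin k, x i.castSucc ≠ x i.succ) : StrictMono (seqEvent x) := by
  rw [Fin.strictMono_iff_lt_succ]
  intro i
  refine lt_of_le_of_ne (dist_le_seqTime_sub x (Fin.castSucc_lt_succ).le) fun h => hx i ?_
  exact congrArg Spacetime.pt h

theorem seqEvent_mem {E : Set (X × X)} {k : ℕ} (x : MagSeq E ℓ k) (i : Fin (k + 1)) :
    seqEvent x.seq i ∈
      Set.Icc (⟨x.seq 0, 0⟩ : Spacetime X) ⟨x.seq (Fin.last k), ℓ⟩ := by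
  constructor
  · have h := dist_le_seqTime_sub x.seq (Fin.zero_le i)
    rw [seqTime_zero] at h
    exact h
  · have h := dist_le_seqTime_sub x.seq (Fin.le_last i)
    rw [seqTime_last, x.length_eq] at h
    exact h

/-- A strict chain of maximal length in a causal interval is determined by its positions. -/
theorem exists_seqEvent_eq {a b : X} {k : ℕ} {s : Fin (k + 1) → Spacetime X} (hs : StrictMono s)
    (ha : (⟨a, 0⟩ : Spacetime X) ≤ s 0) (hb : s (Fin.last k) ≤ ⟨b, ℓ⟩)
    (hl : ¬ seqLength (fun i => (s i).pt) < ℓ) :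
    ∃ x : MagSeq {(a, b)} ℓ k, seqEvent x.seq = s := by
  have h0 : dist a (s 0).pt ≤ (s 0).time - 0 := ha
  have h1 : dist (s (Fin.last k)).pt b ≤ ℓ - (s (Fin.last k)).time := hb
  have d0 : 0 ≤ dist a (s 0).pt := dist_nonneg
  have d1 : 0 ≤ dist (s (Fin.last k)).pt b := dist_nonneg
  have hsum := sum_seqGap_le hs.monotone (Fin.zero_le (Fin.last k))
  rw [Fin.val_zero, Fin.val_last, ← seqLength_eq_sum] at hsum
  -- The parts before and after `i` are each bounded by elapsed time, while the total length is at
  -- least `ℓ` and the available time is at most `ℓ`. All bounds are therefore equalities, and the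
  -- first event has time 0.
  have htime : ∀ i, seqTime (fun i => (s i).pt) i = (s i).time := fun i => by
    have e1 := sum_seqGap_le hs.monotone (Fin.zero_le i)
    have e2 := sum_seqGap_le hs.monotone (Fin.le_last i)
    have e3 := Finset.sum_Ico_consecutive (seqGap fun i => (s i).pt) (Nat.zero_le (i : ℕ))
      (Nat.lt_succ_iff.mp i.is_lt)
    rw [Fin.val_zero] at e1
    rw [Fin.val_last] at e2
    rw [← seqLength_eq_sum] at e3
    rw [seqTime]
    linarith
  refine ⟨⟨fun i => (s i).pt, fun i h => ?_, by linarith, ?_⟩, ?_⟩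
  -- Elapsed time equals distance, so two consecutive events at one position would also have the
  -- same time, against strictness.
  · refine (hs (Fin.castSucc_lt_succ (i := i))).ne (Spacetime.ext h ?_)
    have e := dist_le_seqTime_sub (fun i => (s i).pt) (Fin.castSucc_lt_succ (i := i)).le
    have e1 : seqTime (fun i => (s i).pt) i.succ - seqTime (fun i => (s i).pt) i.castSucc =
        dist (s i.castSucc).pt (s i.succ).pt := by
      rw [seqTime, seqTime, Fin.val_succ, Fin.val_castSucc,
        Finset.sum_Ico_succ_top (Nat.zero_le _), add_sub_cancel_left, seqGap_fin]
    rw [htime, htime, h, dist_self] at e1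
    linarith
  · have e0 : a = (s 0).pt := dist_le_zero.mp (by linarith)
    have e1 : (s (Fin.last k)).pt = b := dist_le_zero.mp (by linarith)
    change ((s 0).pt, (s (Fin.last k)).pt) ∈ _
    rw [← e0, e1]
    rfl
  · funext i
    exact Spacetime.ext rfl (htime i)

end Causal

theorem nonempty_reducedHomology_magnitudeHomotopyType {X : Type u} [MetricSpace X] (ℓ : ℝ) (k : ℕ)
    (a b : X) : Nonempty
      (ReducedHomology k (MagnitudeHomotopyType ℓ a b) ≃+ magnitudeHomology k ℓ a b) := by
  have hends : ∀ k, ∀ x : MagSeq {(a, b)} ℓ k, x.seq 0 = a ∧ x.seq (Fin.last k) = b :=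
    fun k x => Prod.mk.inj x.ends_mem
  refine nonempty_reducedHomology_addEquiv (ι := fun k x => ⟨fun i => ⟨seqEvent x.seq i, by
    have := seqEvent_mem x i
    rwa [(hends k x).1, (hends k x).2] at this⟩, fun i j hij => strictMono_seqEvent x.ne hij⟩)
    (fun k x => rfl) (fun k s hs => ?_) k
  obtain ⟨x, hx⟩ := exists_seqEvent_eq (s := fun i => (s.1 i).1) (fun i j hij => s.2 hij)
    (s.1 0).2.1 (s.1 (Fin.last k)).2.2 hs
  exact ⟨x, Subtype.ext (funext fun i => Subtype.ext (congrFun hx i))⟩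

theorem nonempty_reducedHomology_totalMagnitudeHomotopyType (X : Type u) [MetricSpace X] (ℓ : ℝ)
    (k : ℕ) : Nonempty
      (ReducedHomology k (TotalMagnitudeHomotopyType X ℓ) ≃+ totalMagnitudeHomology X k ℓ) := by
  refine nonempty_reducedHomology_addEquiv (ι := fun k x => ⟨fun i =>
    ⟨(x.seq 0, x.seq (Fin.last k)), seqEvent x.seq i, seqEvent_mem x i⟩,
      fun i j hij => Sigma.mk_lt_mk_iff.mpr (strictMono_seqEvent x.ne hij)⟩)
    (fun k x => rfl) (fun k s hs => ?_) k
  obtain ⟨s, hmono⟩ := s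
  -- Elements of different summands are incomparable, so the whole chain lies in the summand of its
  -- first element.
  obtain ⟨⟨a, b⟩, s', rfl⟩ : ∃ (p : X × X) (s' : Fin (k + 1) → CausalInterval ℓ p.1 p.2),
      s = fun i => ⟨p, s' i⟩ := by
    have h : ∀ i, ∃ y, s i = ⟨(s 0).1, y⟩ := fun i => by
      obtain ⟨h, -⟩ := Sigma.le_def.mp (hmono.monotone (Fin.zero_le i))
      generalize s i = p at h
      obtain ⟨p, y⟩ := p
      dsimp only at h
      subst h
      exact ⟨y, rfl⟩
    choose s' hs' using h
    exact ⟨_, s', funext hs'⟩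
  have hmono' : StrictMono s' := fun i j hij => 
    (Sigma.mk_lt_mk_iff (α := fun p : X × X => CausalInterval ℓ p.1 p.2)).mp (hmono hij)
  obtain ⟨x, hx⟩ := exists_seqEvent_eq (s := fun i => (s' i).1) (fun i j hij => hmono' hij)
    (s' 0).2.1 (s' (Fin.last k)).2.2 hs
  -- The summand index is recorded by equations on the end points of `y`; substituting `a` and `b`
  -- then makes the dependent pairs comparable.
  obtain ⟨y, hy, h0, h1⟩ : ∃ y : MagSeq (Set.univ : Set (X × X)) ℓ k,
      (seqEvent y.seq = fun i => (s' i).1) ∧ y.seq 0 = a ∧ y.seq (Fin.last k) = b :=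
    ⟨⟨x.seq, x.ne, x.length_eq, Set.mem_univ _⟩, hx, Prod.mk.inj x.ends_mem⟩
  subst h0 h1
  refine ⟨y, Subtype.ext (funext fun i => ?_)⟩
  exact congrArg (Sigma.mk _) (Subtype.ext (congrFun hy i))

theorem theorem4p5 {X : Type u} [MetricSpace X] (ℓ : ℝ) (hℓ : 0 ≤ ℓ) (k : ℕ) :
    (∀ a b : X, Nonempty
      (ReducedHomology k (MagnitudeHomotopyType ℓ a b) ≃+ magnitudeHomology k ℓ a b)) ∧
    Nonempty
      (ReducedHomology k (TotalMagnitudeHomotopyType X ℓ) ≃+ totalMagnitudeHomology X k ℓ) :=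
  ⟨nonempty_reducedHomology_magnitudeHomotopyType ℓ k,
    nonempty_reducedHomology_totalMagnitudeHomotopyType X ℓ k⟩
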